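/- **Setting.** Let $k,n_s\ge 1$ and $n_T=k\,n_s$. Given are $k$ subsystems with the same structured state matrix $\bar A_s\in\{0,*\}^{n_s\times n_s}$ and a structured input matrix $\bar B\in\{0,*\}^{n_T\times 1}$. Write $x^i_p$ ($1\le i\le k$, $1\le p\le n_s$) for the states and $u$ for the input. There is an internal edge $x^i_q\to x^i_p$ iff $(\bar A_s)_{pq}=*$, and an input edge $u\to x^i_p$ iff the entry of $\bar B$ in row $n_s(i-1)+p$ is $*$; any edge $x^j_q\to x^i_p$ with $i\ne j$ is an interconnection. A state is accessible (with respect to a set of interconnections) if there is a path from $u$ to it using internal edges, input edges and those interconnections; a set of states is accessible if all its states are. Assume that the composite system in which all interconnections are present is structurally controllable, i.e. has a controllable real realization with this zero pattern. Let $\mathcal N$ be the set of those strongly connected components of the subsystem digraphs (internal edges only) which no edge enters from outside and which are not accessible when there are no interconnections. Let $\mathcal B(\bar A,\bar B)$ be the bipartite graph with left nodes $x'^i_p$, right nodes $x^j_q$ and $u$, and edges $(x'^i_p,x^i_q)$ with $(\bar A_s)_{pq}=*$ (set $\mathcal E_X$), all $(x'^i_p,x^j_q)$ with $i\neq j$ (set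 $\mathcal E_I$), and $(x'^i_p,u)$ with $u\to x^i_p$ (set $\mathcal E_U$). Let $\mathcal B(\bar A,\bar B,\mathcal N)$ be the same graph with the elements of $\mathcal N$ added as right nodes, together with the edges $(x'^i_p,\mathcal N_h)$ for $x^i_p\in\mathcal N_h$ (set $\mathcal E_{\mathcal N}$). Edges in $\mathcal E_U,\mathcal E_X,\mathcal E_{\mathcal N},\mathcal E_I$ cost $0,1,2,3$, respectively. A matching is perfect if its size is that of the smaller side. An edge $(x'^i_p,x^j_q)\in\mathcal E_I$ stands for the interconnection $x^j_q\to x^i_p$. **Algorithm 1.** 1. Construct $\mathcal B(\bar A,\bar B)$ and $\mathcal B(\bar A,\bar B,\mathcal N)$ with the costs, and find a minimum-cost perfect matching $M^*$ of $\mathcal B(\bar A,\bar B,\mathcal N)$. 2. Put $M'=M^*\cap(\mathcal E_X\cup\mathcal E_U)$; find a perfect matching $M''$ of the graph obtained from $\mathcal B(\bar A,\bar B)$ by deleting all nodes met by $M'$; put $\widetilde M=M'\cup M''$. 3. Let $V_{\mathcal N'}$ be the set of left nodes $x'^i_p$ that are matched in $\widetilde M$ by an edge in $\mathcal E_I$ and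 lie in some $\mathcal N_h\in\mathcal N$ that is not accessible with respect to $\widetilde M\cap\mathcal E_I$. While $V_{\mathcal N'}\ne\emptyset$: choose $x'^i_p\in V_{\mathcal N'}$, say with $(x'^i_p,x^j_q)\in\widetilde M$, and let $x^t_r$ be the unmatched accessible right state. If $i\ne t$, replace $(x'^i_p,x^j_q)$ in $\widetilde M$ by $(x'^i_p,x^t_r)$. If $i=t$, find an edge $(x'^j_s,x^w_v)\in\widetilde M$ with $w\ne j$ whose replacement by $(x'^j_s,x^t_r)$ makes the component $\mathcal N_h$ of $x^i_p$ accessible, and carry out this replacement. After each pass $V_{\mathcal N'}$ and $x^t_r$ are determined anew. 4. While some $\mathcal N_h\in\mathcal N$ is not accessible with respect to $\widetilde M\cap\mathcal E_I$ and the interconnections added so far, add an interconnection from an accessible state to a state in such an $\mathcal N_h$ of another subsystem. The output $\mathcal I_A$ consists of the interconnections in $\widetilde M\cap\mathcal E_I$ and the added ones. **Theorem.** Algorithm 1 runs in time $O(n_T^3)$. Precisely: there are a unit-cost RAM program with words of $O(\log n_T)$ bits, and a constant $C$, such that for all $k$, $n_s$, $\bar A_s$, $\bar B$ as above the program carries out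 a complete execution of Algorithm 1 (it writes the two bipartite graphs, $M^*$, the successive matchings $\widetilde M$, the added interconnections and $\mathcal I_A$ to memory) and halts within $C\,n_T^3$ steps, of which at most $C\,n_T^2$ are spent after the bipartite graphs and $M^*$ have been obtained. Moreover, in every execution of Algorithm 1, whatever choices are made, each of the two loops makes at most $n_T$ passes. -/

import Mathlib

/-! ## A word RAM, given as a structured programming language

Programs manipulate natural-number variables and natural-number arrays (both indexed by `ℕ`).
Every elementary operation costs one time unit.  The semantics is relative to a word bound `W`:
a value can be stored, and an array cell written, only if it is smaller than `W` (for the other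
cells a read returns the initial contents).  An intermediate value in a fixed expression is then
bounded by a fixed power of `W`. -/

namespace WordRAM

/-- Memory contents: the scalar variables and the arrays. -/
structure Store where
  var : ℕ → ℕ
  arr : ℕ → ℕ → ℕ

/-- Arithmetic expressions. Subtraction is truncated; `lt` and `eq` return `0` or `1`. -/
inductive Expr where
  | const (m : ℕ)
  | var (x : ℕ)
  | get (a : ℕ) (e : Expr)
  | add (e f : Expr)
  | sub (e f : Expr)
  | mul (e f : Expr)
  | lt (e f : Expr)
  | eq (e f : Expr)

/-- The value of an expression. -/
def Expr.eval (s : Store) : Expr → ℕ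
  | .const m => m
  | .var x => s.var x
  | .get a e => s.arr a (e.eval s)
  | .add e f => e.eval s + f.eval s
  | .sub e f => e.eval s - f.eval s
  | .mul e f => e.eval s * f.eval s
  | .lt e f => if e.eval s < f.eval s then 1 else 0
  | .eq e f => if e.eval s = f.eval s then 1 else 0

/-- The time needed to evaluate an expression: one unit for each node. -/
def Expr.time : Expr → ℕ
  | .const _ => 1
  | .var _ => 1
  | .get _ e => 1 + e.time
  | .add e f => 1 + e.time + f.time
  | .sub e f => 1 + e.time + f.time
  | .mul e f => 1 + e.time + f.time
  | .lt e f => 1 + e.time + f.time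
  | .eq e f => 1 + e.time + f.time

/-- Programs. A test counts as true when its value is not `0`. -/
inductive Cmd where
  | skip
  | assign (x : ℕ) (e : Expr)
  | set (a : ℕ) (i e : Expr)
  | seq (c d : Cmd)
  | ite (e : Expr) (c d : Cmd)
  | loop (e : Expr) (c : Cmd)

/-- The store after the assignment of `m` to the variable `x`. -/
def Store.setVar (s : Store) (x m : ℕ) : Store :=
  { s with var := Function.update s.var x m }

/-- The store after the assignment of `m` to the cell `i` of the array `a`. -/
def Store.setArr (s : Store) (a i m : ℕ) : Store :=
  { s with arr := Function.update s.arr a (Function.update (s.arr a) i m) }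

/-- `Exec W c s t s'`: started in the store `s` on a machine with words smaller than `W`, the
program `c` halts after exactly `t` time units in the store `s'`. -/
inductive Exec (W : ℕ) : Cmd → Store → ℕ → Store → Prop where
  | skip (s : Store) : Exec W .skip s 1 s
  | assign (s : Store) (x : ℕ) (e : Expr) (h : e.eval s < W) :
      Exec W (.assign x e) s (1 + e.time) (s.setVar x (e.eval s))
  | set (s : Store) (a : ℕ) (i e : Expr) (hi : i.eval s < W) (he : e.eval s < W) :
      Exec W (.set a i e) s (1 + i.time + e.time) (s.setArr a (i.eval s) (e.eval s))
  | seq {c d : Cmd} {s s' s'' : Store} {t t' : ℕ} (hc : Exec W c s t s')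
      (hd : Exec W d s' t' s'') : Exec W (.seq c d) s (t + t') s''
  | ite_true {e : Expr} {c : Cmd} (d : Cmd) {s s' : Store} {t : ℕ} (h : e.eval s ≠ 0)
      (hc : Exec W c s t s') : Exec W (.ite e c d) s (1 + e.time + t) s'
  | ite_false {e : Expr} (c : Cmd) {d : Cmd} {s s' : Store} {t : ℕ} (h : e.eval s = 0)
      (hd : Exec W d s t s') : Exec W (.ite e c d) s (1 + e.time + t) s'
  | loop_done {e : Expr} (c : Cmd) {s : Store} (h : e.eval s = 0) :
      Exec W (.loop e c) s (1 + e.time) s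
  | loop_step {e : Expr} {c : Cmd} {s s' s'' : Store} {t t' : ℕ} (h : e.eval s ≠ 0)
      (hc : Exec W c s t s') (hl : Exec W (.loop e c) s' t' s'') :
      Exec W (.loop e c) s (1 + e.time + t + t') s''

end WordRAM

/-! ## Bipartite graphs and matchings -/

/-- A finite bipartite graph with edges between `left` and `right`. -/
structure BipGraph (α β : Type*) where
  left : Finset α
  right : Finset β
  edges : Finset (α × β)
  edges_subset : edges ⊆ left ×ˢ right

namespace BipGraph

variable {α β : Type*}

/-- A set of edges no two of which share an endpoint. -/
def IsMatching (G : BipGraph α β) (M : Finset (α × β)) : Prop :=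
  M ⊆ G.edges ∧ ∀ e ∈ M, ∀ f ∈ M, e ≠ f → e.1 ≠ f.1 ∧ e.2 ≠ f.2

/-- A matching is perfect when it has as many edges as the smaller side has nodes. -/
def IsPerfectMatching (G : BipGraph α β) (M : Finset (α × β)) : Prop :=
  G.IsMatching M ∧ M.card = min G.left.card G.right.card

/-- A perfect matching of least total cost. -/
def IsMinCostPerfectMatching (G : BipGraph α β) (c : α × β → ℕ) (M : Finset (α × β)) : Prop :=
  G.IsPerfectMatching M ∧
    ∀ M', G.IsPerfectMatching M' → ∑ e ∈ M, c e ≤ ∑ e ∈ M', c e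

/-- The graph `G ⊙ M`: all nodes that are met by `M` are deleted, with their edges. -/
def diff [DecidableEq α] [DecidableEq β] (G : BipGraph α β) (M : Finset (α × β)) :
    BipGraph α β where
  left := G.left \ M.image Prod.fst
  right := G.right \ M.image Prod.snd
  edges := G.edges.filter fun e => e.1 ∉ M.image Prod.fst ∧ e.2 ∉ M.image Prod.snd
  edges_subset := by
    intro e he
    rw [Finset.mem_filter] at he
    have h := Finset.mem_product.1 (G.edges_subset he.1)
    exact Finset.mem_product.2
      ⟨Finset.mem_sdiff.2 ⟨h.1, he.2.1⟩, Finset.mem_sdiff.2 ⟨h.2, he.2.2⟩⟩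

end BipGraph

/-! ## Structural controllability (single input) -/

/-- Controllability of `x' = A x + b u`: the columns `b, A b, …, A ^ (n - 1) b` of the
controllability matrix span the state space. -/
def IsControllable {ι : Type*} [Fintype ι] [DecidableEq ι] (A : Matrix ι ι ℝ) (b : ι → ℝ) : Prop :=
  Submodule.span ℝ (Set.range fun j : Fin (Fintype.card ι) => (A ^ (j : ℕ)).mulVec b) = ⊤

/-- In a structured matrix `true` stands for a free entry and `false` for a fixed zero. A
structured system is structurally controllable when some numerical realization of it is
controllable. -/
def IsStructurallyControllable {ι : Type*} [Fintype ι] [DecidableEq ι]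
    (A : Matrix ι ι Bool) (b : ι → Bool) : Prop :=
  ∃ (A' : Matrix ι ι ℝ) (b' : ι → ℝ), (∀ i j, A i j = false → A' i j = 0) ∧
    (∀ i, b i = false → b' i = 0) ∧ IsControllable A' b'

/-! ## Structurally identical subsystems -/

/-- `(i, p)` is the `p`-th state of the `i`-th subsystem. -/
abbrev StateNode (k n : ℕ) : Type := Fin k × Fin n

/-- The position of a state in the composite state vector. -/
def StateNode.index {k n : ℕ} (v : StateNode k n) : ℕ := v.1.val * n + v.2.val

/-- `k` subsystems with the common structured state matrix `A`, and a structured single-input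
matrix `B` of the composite system. -/
structure CompositeSystem (k n : ℕ) where
  A : Matrix (Fin n) (Fin n) Bool
  B : StateNode k n → Bool

/-- The nodes on the right-hand side of the bipartite graphs: states, the input, and (condensed)
strongly connected components. -/
inductive RightNode (k n : ℕ) where
  | state (v : StateNode k n)
  | input
  | scc (S : Finset (StateNode k n))
deriving DecidableEq

/-- Edges of the bipartite graphs; the left-hand node `v` is the primed copy of the state `v`. -/
abbrev BipEdge (k n : ℕ) : Type := StateNode k n × RightNode k n

namespace CompositeSystem

variable {k n : ℕ} (I : CompositeSystem k n)

/-- The structured state matrix of the composite system with all interconnections present. -/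
def fullMatrix : Matrix (StateNode k n) (StateNode k n) Bool :=
  fun v w => if v.1 = w.1 then I.A v.2 w.2 else true

/-- The edges `v → w` of the disjoint union of the state digraphs of the subsystems. -/
def Inner (v w : StateNode k n) : Prop := v.1 = w.1 ∧ I.A w.2 v.2 = true

/-- `S` is a strongly connected component of the state digraph of some subsystem. -/
def IsSCC (S : Finset (StateNode k n)) : Prop :=
  ∃ v, ∀ w, w ∈ S ↔ Relation.ReflTransGen I.Inner v w ∧ Relation.ReflTransGen I.Inner w v

/-- `S` is a non-top linked strongly connected component: no edge enters it from outside. -/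
def IsNonTopLinkedSCC (S : Finset (StateNode k n)) : Prop :=
  I.IsSCC S ∧ ∀ v w, v ∉ S → w ∈ S → ¬ I.Inner v w

/-- There is a path from the input to the state `v` in the digraph whose edges are those of the
subsystems, those of the input, and the interconnections `F` (pairs (source, target)). -/
def Accessible (F : Set (StateNode k n × StateNode k n)) (v : StateNode k n) : Prop :=
  ∃ w, I.B w = true ∧ Relation.ReflTransGen (fun a b => I.Inner a b ∨ (a, b) ∈ F) w v

/-- All states of `S` are accessible. -/
def AccessibleSet (F : Set (StateNode k n × StateNode k n)) (S : Finset (StateNode k n)) : Prop :=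
  ∀ v ∈ S, I.Accessible F v

open Classical in
/-- The set `𝒩` of the non-top linked components that are not accessible when there are no
interconnections. -/
noncomputable def comps : Finset (Finset (StateNode k n)) :=
  Finset.univ.filter fun S => I.IsNonTopLinkedSCC S ∧ ¬ I.AccessibleSet ∅ S

/-- The adjacency of the bipartite graphs. -/
def BipAdj : StateNode k n → RightNode k n → Prop
  | v, .state w => v.1 ≠ w.1 ∨ I.A v.2 w.2 = true
  | v, .input => I.B v = true
  | v, .scc S => S ∈ I.comps ∧ v ∈ S

open Classical in
/-- The system bipartite graph `ℬ(A, B)` of the fully interconnected composite system. -/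
noncomputable def graph : BipGraph (StateNode k n) (RightNode k n) where
  left := Finset.univ
  right := Finset.univ.image RightNode.state ∪ {RightNode.input}
  edges := (Finset.univ ×ˢ (Finset.univ.image RightNode.state ∪ {RightNode.input})).filter
    fun e => I.BipAdj e.1 e.2
  edges_subset := Finset.filter_subset _ _

open Classical in
/-- The bipartite graph `ℬ(A, B, 𝒩)`. -/
noncomputable def graphN : BipGraph (StateNode k n) (RightNode k n) where
  left := Finset.univ
  right := Finset.univ.image RightNode.state ∪ {RightNode.input} ∪ I.comps.image RightNode.scc
  edges := (Finset.univ ×ˢ (Finset.univ.image RightNode.state ∪ {RightNode.input} ∪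
    I.comps.image RightNode.scc)).filter fun e => I.BipAdj e.1 e.2
  edges_subset := Finset.filter_subset _ _

/-- The cost function: `0` on input edges, `1` inside a subsystem, `2` on component edges and `3`
on interconnections. -/
def cost : BipEdge k n → ℕ
  | (v, .state w) => if v.1 = w.1 then 1 else 3
  | (_, .input) => 0
  | (_, .scc _) => 2

/-- Keep the edges inside a subsystem and the input edges: `M' = M ∩ (⋃ ℰ_{X_i} ∪ ℰ_U)`. -/
def restrict (M : Finset (BipEdge k n)) : Finset (BipEdge k n) :=
  M.filter fun e => cost e ≤ 1

/-- The interconnections `w → v` that are used by a matching. -/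
def inter (M : Finset (BipEdge k n)) : Set (StateNode k n × StateNode k n) :=
  {f | f.1.1 ≠ f.2.1 ∧ (f.2, RightNode.state f.1) ∈ M}

/-- Membership in `V_{𝒩'}`: the left-hand nodes that are matched by an interconnection and belong
to a component in `𝒩` that is not accessible by means of the interconnections of the matching. -/
def Pending (M : Finset (BipEdge k n)) (v : StateNode k n) : Prop :=
  (∃ w, w.1 ≠ v.1 ∧ (v, RightNode.state w) ∈ M) ∧
    ∃ S ∈ I.comps, v ∈ S ∧ ¬ I.AccessibleSet (inter M) S

/-- `z` is an unmatched accessible right-hand state. -/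
def IsFree (M : Finset (BipEdge k n)) (z : StateNode k n) : Prop :=
  (∀ v, (v, RightNode.state z) ∉ M) ∧ I.Accessible (inter M) z

/-- One pass through the `while` loop: a pending node `x`, matched to `y`, is treated by means of
the unmatched accessible state `z`. If `x` and `z` are in different subsystems, `x` is rematched to
`z`. Otherwise an interconnection edge `(s, w)` of the matching with `s` in the subsystem of `y` is
found, and `s` is rematched to `z`, in such a way that the component of `x` becomes accessible. -/
def LoopStep (M M' : Finset (BipEdge k n)) : Prop :=
  ∃ x y z, I.Pending M x ∧ (x, RightNode.state y) ∈ M ∧ I.IsFree M z ∧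
    ((x.1 ≠ z.1 ∧ M' = insert (x, RightNode.state z) (M.erase (x, RightNode.state y))) ∨
     (x.1 = z.1 ∧ ∃ s w, s.1 = y.1 ∧ w.1 ≠ s.1 ∧ (s, RightNode.state w) ∈ M ∧
        M' = insert (s, RightNode.state z) (M.erase (s, RightNode.state w)) ∧
        ∀ S ∈ I.comps, x ∈ S → I.AccessibleSet (inter M') S))

/-- The interconnection `f = (source, target)` may be added to `F` for accessibility: its target is
in a component in `𝒩` that is not accessible yet, its source is accessible and in another
subsystem. -/
def ExtraEdge (F : Set (StateNode k n × StateNode k n)) (f : StateNode k n × StateNode k n) : Prop :=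
  f.1.1 ≠ f.2.1 ∧ I.Accessible F f.1 ∧ ∃ S ∈ I.comps, f.2 ∈ S ∧ ¬ I.AccessibleSet F S

end CompositeSystem

/-! ## The algorithm -/

/-- The record of an execution of the algorithm: the matching `M*` in `ℬ(A, B, 𝒩)`, the matching
`M''` in `ℬ(A, B) ⊙ M'`, the number of passes through the `while` loop, the matching `M̃` after
each number of passes, and the interconnections added for accessibility, in order. -/
structure Trace (k n : ℕ) where
  mStar : Finset (BipEdge k n)
  mTwo : Finset (BipEdge k n)
  passes : ℕ
  mTilde : ℕ → Finset (BipEdge k n)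
  extra : List (StateNode k n × StateNode k n)

namespace Trace

variable {k n : ℕ}

/-- The final matching `M̃`. -/
def final (τ : Trace k n) : Finset (BipEdge k n) := τ.mTilde τ.passes

/-- The interconnections present after the first `m` additions. -/
def edgesAfter (τ : Trace k n) (m : ℕ) : Set (StateNode k n × StateNode k n) :=
  CompositeSystem.inter τ.final ∪ {f | f ∈ τ.extra.take m}

/-- A possibly unfinished execution: every step performed so far obeys the algorithm. -/
def IsPartialRun (I : CompositeSystem k n) (τ : Trace k n) : Prop :=
  I.graphN.IsMinCostPerfectMatching CompositeSystem.cost τ.mStar ∧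
  (I.graph.diff (CompositeSystem.restrict τ.mStar)).IsPerfectMatching τ.mTwo ∧
  τ.mTilde 0 = CompositeSystem.restrict τ.mStar ∪ τ.mTwo ∧
  (∀ m < τ.passes, I.LoopStep (τ.mTilde m) (τ.mTilde (m + 1))) ∧
  (τ.extra ≠ [] → ∀ v, ¬ I.Pending τ.final v) ∧
  ∀ (m : ℕ) (h : m < τ.extra.length), I.ExtraEdge (τ.edgesAfter m) τ.extra[m]

/-- A finished execution. -/
def IsRun (I : CompositeSystem k n) (τ : Trace k n) : Prop :=
  τ.IsPartialRun I ∧ (∀ v, ¬ I.Pending τ.final v) ∧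
    ∀ S ∈ I.comps, I.AccessibleSet (τ.edgesAfter τ.extra.length) S

/-- The output `ℐ_A`, a set of pairs (source, target). -/
def output (τ : Trace k n) : Set (StateNode k n × StateNode k n) :=
  τ.edgesAfter τ.extra.length

end Trace

/-! ## Memory layout -/

/-- The column numbers of the right-hand nodes: states come first, then the input, then the
components, each numbered through its first state. -/
noncomputable def RightNode.code {k n : ℕ} : RightNode k n → ℕ
  | .state v => v.index
  | .input => k * n
  | .scc S => k * n + 1 + sInf {m | ∃ v ∈ S, m = StateNode.index v}

namespace CompositeSystem

variable {k n : ℕ} (I : CompositeSystem k n)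

/-- The initial memory: `k` and `n` in the variables 0 and 1, the matrix `A` row by row in array 0
and `B` in array 1; everything else is zero. -/
def IsInput (s : WordRAM.Store) : Prop :=
  s.var 0 = k ∧ s.var 1 = n ∧ (∀ x, 2 ≤ x → s.var x = 0) ∧
  (∀ p q : Fin n, s.arr 0 (p.val * n + q.val) = if I.A p q then 1 else 0) ∧
  (∀ m, n * n ≤ m → s.arr 0 m = 0) ∧
  (∀ v : StateNode k n, s.arr 1 v.index = if I.B v then 1 else 0) ∧
  (∀ m, k * n ≤ m → s.arr 1 m = 0) ∧
  ∀ a, 2 ≤ a → ∀ m, s.arr a m = 0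

open Classical in
/-- Array 2 holds the adjacency matrix of `ℬ(A, B)` and array 3 the cost matrix of `ℬ(A, B, 𝒩)`, in
which `0` means that there is no edge and `c + 1` that there is an edge of cost `c`. -/
def HoldsGraphs (s : WordRAM.Store) : Prop :=
  (∀ (v : StateNode k n), ∀ r ∈ I.graph.right,
    s.arr 2 (v.index * (k * n + 1) + r.code) = if (v, r) ∈ I.graph.edges then 1 else 0) ∧
  (∀ (v : StateNode k n), ∀ r ∈ I.graphN.right,
    s.arr 3 (v.index * (2 * (k * n) + 1) + r.code) =
      if (v, r) ∈ I.graphN.edges then cost (v, r) + 1 else 0) ∧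
  ∀ (v : StateNode k n) (m : ℕ), m < 2 * (k * n) + 1 → (∀ r ∈ I.graphN.right, r.code ≠ m) →
    s.arr 3 (v.index * (2 * (k * n) + 1) + m) = 0

end CompositeSystem

namespace Trace

variable {k n : ℕ}

/-- Array 4 holds `M*`: the partner of each left-hand node. -/
def HoldsMatching (τ : Trace k n) (s : WordRAM.Store) : Prop :=
  ∀ e ∈ τ.mStar, s.arr 4 e.1.index = e.2.code

open Classical in
/-- Variable 2 holds the number of passes, array 5 the successive matchings `M̃`, variable 3 the
number of extra interconnections, arrays 6 and 7 their sources and targets, and array 8 the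
adjacency matrix of the output. -/
def HoldsResult (τ : Trace k n) (s : WordRAM.Store) : Prop :=
  s.var 2 = τ.passes ∧
  (∀ m ≤ τ.passes, ∀ e ∈ τ.mTilde m, s.arr 5 (m * (k * n) + e.1.index) = e.2.code) ∧
  s.var 3 = τ.extra.length ∧
  (∀ (m : ℕ) (h : m < τ.extra.length),
    s.arr 6 m = (τ.extra[m]).1.index ∧ s.arr 7 m = (τ.extra[m]).2.index) ∧
  ∀ v w : StateNode k n,
    s.arr 8 (v.index * (k * n) + w.index) = if (v, w) ∈ τ.output then 1 else 0

end Trace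

namespace WordRAM

/-! ## Reasoning about word RAM programs -/

/-! The bound on the passes, valid for every execution, is a monotonicity argument. A pass redirects
an interconnection whose target is inaccessible, so no accessible state is lost, and at least one
state becomes accessible (`LoopStep.accessible`); an added interconnection gains a state as well.
There are only `k * n` states (`Trace.IsPartialRun.bounds`).

For the program, the point is that the algorithm leaves the choice of `M*` and `M''` open, and both
can be chosen such that the first loop makes no pass at all. An edge of cost `c` belongs to `3 - c`
of the three levels "cost at most 0, 1, 2"; hence a perfect matching is optimal as soon as it has
the largest possible number of edges on each level (`Greedy.isMinCostPerfectMatching`). All three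
maxima are attained at once by a matching with edges of cost at most 2 that is grown by augmenting
paths from the input, then the states, then the components: an augmentation never releases a
right-hand node, and a search that fails yields a Hall-type certificate of maximality
(`Kuhn.Stage`). This takes `2 * (k * n) + 1` searches of quadratic time.

Read in the digraph, this matching consists of paths and cycles inside the subsystems. The left-hand
nodes that still need an interconnection, the starts, are heads of paths, and the ends of the paths
are unmatched right-hand states. As the subsystems are identical, an exchange argument shows that
all have the same number of starts, except that the one where the input is used may have one less
(`Greedy.card_startsIn`). A round-robin order beginning with the path from the input therefore puts
consecutive paths into different subsystems, and every start can be linked to the end of the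
preceding path. The links complete `M*` and form `M''`; they join the paths to a single one from the
input, so no node is pending (`Plan.not_pending`). For `k = 1` structural controllability leaves no
start and no component in `𝒩`.

A component in `𝒩` without a start then receives an interconnection from `a`, the state matched to
the input, or, when it lies in the subsystem of `a`, from its copy in the next subsystem, which is
accessible by then (`Plan.extraList_append`). Everything after `M*` takes linear time. The programs
are verified with the Hoare-style judgement `Runs`, which bounds the time as well. -/

instance : Add Expr := ⟨.add⟩
instance : Sub Expr := ⟨.sub⟩
instance : Mul Expr := ⟨.mul⟩

@[simp] theorem Expr.eval_add (s : Store) (e f : Expr) :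
    (e + f).eval s = e.eval s + f.eval s := rfl
@[simp] theorem Expr.eval_sub (s : Store) (e f : Expr) :
    (e - f).eval s = e.eval s - f.eval s := rfl
@[simp] theorem Expr.eval_mul (s : Store) (e f : Expr) :
    (e * f).eval s = e.eval s * f.eval s := rfl
@[simp] theorem Expr.eval_const (s : Store) (m : ℕ) :
    (Expr.const m).eval s = m := rfl
@[simp] theorem Expr.eval_var (s : Store) (x : ℕ) : (Expr.var x).eval s = s.var x := rfl
@[simp] theorem Expr.eval_get (s : Store) (a : ℕ) (e : Expr) :
    (Expr.get a e).eval s = s.arr a (e.eval s) := rfl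
@[simp] theorem Expr.eval_lt (s : Store) (e f : Expr) :
    (Expr.lt e f).eval s = if e.eval s < f.eval s then 1 else 0 := rfl
@[simp] theorem Expr.eval_eq (s : Store) (e f : Expr) :
    (Expr.eq e f).eval s = if e.eval s = f.eval s then 1 else 0 := rfl

@[simp] theorem Store.setVar_var (s : Store) (x m y : ℕ) :
    (s.setVar x m).var y = if y = x then m else s.var y := by
  simp [Store.setVar, Function.update_apply]
@[simp] theorem Store.setVar_arr (s : Store) (x m : ℕ) : (s.setVar x m).arr = s.arr := rfl
@[simp] theorem Store.setArr_var (s : Store) (a i m : ℕ) : (s.setArr a i m).var = s.var := rfl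
@[simp] theorem Store.setArr_arr (s : Store) (a i m b j : ℕ) :
    (s.setArr a i m).arr b j = if b = a ∧ j = i then m else s.arr b j := by
  by_cases h : b = a
  · subst h; by_cases h' : j = i <;> simp [Store.setArr, h']
  · simp [Store.setArr, h]

/-- The variables that a program may write. -/
def Cmd.vars : Cmd → List ℕ
  | .skip => []
  | .assign x _ => [x]
  | .set _ _ _ => []
  | .seq c d => c.vars ++ d.vars
  | .ite _ c d => c.vars ++ d.vars
  | .loop _ c => c.vars

/-- The arrays that a program may write. -/
def Cmd.arrs : Cmd → List ℕ
  | .skip => []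
  | .assign _ _ => []
  | .set a _ _ => [a]
  | .seq c d => c.arrs ++ d.arrs
  | .ite _ c d => c.arrs ++ d.arrs
  | .loop _ c => c.arrs

/-- Two stores agree on everything that `c` does not write. -/
structure Frame (c : Cmd) (s s' : Store) : Prop where
  var : ∀ x, x ∉ c.vars → s'.var x = s.var x
  arr : ∀ a, a ∉ c.arrs → s'.arr a = s.arr a

theorem Frame.refl (c : Cmd) (s : Store) : Frame c s s := ⟨fun _ _ => rfl, fun _ _ => rfl⟩

theorem Frame.trans {c : Cmd} {s s' s'' : Store} (h : Frame c s s') (h' : Frame c s' s'') :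
    Frame c s s'' :=
  ⟨fun x hx => (h'.var x hx).trans (h.var x hx), fun a ha => (h'.arr a ha).trans (h.arr a ha)⟩

theorem Frame.mono {c d : Cmd} {s s' : Store} (h : Frame c s s') (hv : c.vars ⊆ d.vars)
    (ha : c.arrs ⊆ d.arrs) : Frame d s s' :=
  ⟨fun x hx => h.var x fun h => hx (hv h), fun a hx => h.arr a fun h => hx (ha h)⟩

/-- The write sets are computable lists, so that non-interference of two programs is settled by
`decide` wherever it is needed. -/
theorem Exec.frame {W : ℕ} {c : Cmd} {s s' : Store} {t : ℕ} (h : Exec W c s t s') :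
    Frame c s s' := by
  induction h with
  | skip => exact .refl _ _
  | assign s x e h =>
    refine ⟨fun y hy => ?_, fun _ _ => rfl⟩
    simp only [Cmd.vars, List.mem_singleton] at hy
    simp [hy]
  | set s a i e _ _ =>
    refine ⟨fun _ _ => rfl, fun b hb => ?_⟩
    simp only [Cmd.arrs, List.mem_singleton] at hb
    ext j; simp [hb]
  | seq _ _ h1 h2 =>
    exact (h1.mono (by simp [Cmd.vars]) (by simp [Cmd.arrs])).trans
      (h2.mono (by simp [Cmd.vars]) (by simp [Cmd.arrs]))
  | ite_true _ _ _ h1 => exact h1.mono (by simp [Cmd.vars]) (by simp [Cmd.arrs])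
  | ite_false _ _ _ h1 => exact h1.mono (by simp [Cmd.vars]) (by simp [Cmd.arrs])
  | loop_done => exact .refl _ _
  | loop_step _ _ _ h1 h2 =>
    exact (h1.mono (by simp [Cmd.vars]) (by simp [Cmd.arrs])).trans h2

/-- Started in `s`, the program `c` halts within `T` steps in a store that satisfies `Q`. -/
def Runs (W : ℕ) (c : Cmd) (s : Store) (T : ℕ) (Q : Store → Prop) : Prop :=
  ∃ t s', Exec W c s t s' ∧ t ≤ T ∧ Q s'

/-- The consequence rule. It hands the frame to the new postcondition, so a specification may
confine itself to what the program computes; facts about untouched memory are recovered afterwards.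
-/
theorem Runs.mono {W : ℕ} {c : Cmd} {s : Store} {T T' : ℕ} {Q Q' : Store → Prop}
    (h : Runs W c s T Q) (hT : T ≤ T') (hQ : ∀ s', Frame c s s' → Q s' → Q' s') :
    Runs W c s T' Q' := by
  obtain ⟨t, s', he, ht, hs⟩ := h
  exact ⟨t, s', he, ht.trans hT, hQ _ he.frame hs⟩

theorem Runs.seq {W : ℕ} {c d : Cmd} {s : Store} {T T' T'' : ℕ} {Q R : Store → Prop}
    (h : Runs W c s T R) (h' : ∀ s', Frame c s s' → R s' → Runs W d s' T' Q)
    (hT : T + T' ≤ T'') : Runs W (.seq c d) s T'' Q := by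
  obtain ⟨t, s', he, ht, hs⟩ := h
  obtain ⟨t', s'', he', ht', hs'⟩ := h' s' he.frame hs
  exact ⟨t + t', s'', .seq he he', by omega, hs'⟩

theorem Runs.ite {W : ℕ} {e : Expr} {c d : Cmd} {s : Store} {T T' : ℕ} {Q : Store → Prop}
    (h : e.eval s ≠ 0 → Runs W c s T Q) (h' : e.eval s = 0 → Runs W d s T Q)
    (hT : 1 + e.time + T ≤ T') : Runs W (.ite e c d) s T' Q := by
  by_cases he : e.eval s = 0
  · obtain ⟨t, s', hx, ht, hs⟩ := h' he
    exact ⟨1 + e.time + t, s', .ite_false _ he hx, by omega, hs⟩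
  · obtain ⟨t, s', hx, ht, hs⟩ := h he
    exact ⟨1 + e.time + t, s', .ite_true _ he hx, by omega, hs⟩

/-- The weakest precondition of a program without loops. -/
def Cmd.wp (W : ℕ) : Cmd → (Store → Prop) → Store → Prop
  | .skip, Q, s => Q s
  | .assign x e, Q, s => e.eval s < W ∧ Q (s.setVar x (e.eval s))
  | .set a i e, Q, s => (i.eval s < W ∧ e.eval s < W) ∧ Q (s.setArr a (i.eval s) (e.eval s))
  | .seq c d, Q, s => c.wp W (d.wp W Q) s
  | .ite e c d, Q, s => (e.eval s ≠ 0 → c.wp W Q s) ∧ (e.eval s = 0 → d.wp W Q s)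
  | .loop _ _, _, _ => False

/-- An upper bound for the running time of a program without loops. -/
def Cmd.cost : Cmd → ℕ
  | .skip => 1
  | .assign _ e => 1 + e.time
  | .set _ i e => 1 + i.time + e.time
  | .seq c d => c.cost + d.cost
  | .ite e c d => 1 + e.time + (c.cost + d.cost)
  | .loop _ _ => 0

/-- Since `wp` is `False` for a loop, the value `0` that `Cmd.cost` gives to loops does no harm. -/
theorem Runs.of_wp {W : ℕ} {c : Cmd} {s : Store} {T : ℕ} {Q : Store → Prop}
    (h : c.wp W Q s) (hT : c.cost ≤ T) : Runs W c s T Q := by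
  refine Runs.mono (T := c.cost) (Q := Q) ?_ hT fun _ _ h => h
  clear hT
  induction c generalizing s Q with
  | skip => exact ⟨_, _, .skip _, le_rfl, h⟩
  | assign x e => exact ⟨_, _, .assign _ _ _ h.1, le_rfl, h.2⟩
  | set a i e => exact ⟨_, _, .set _ _ _ _ h.1.1 h.1.2, le_rfl, h.2⟩
  | seq c d hc hd => exact Runs.seq (hc h) (fun s' _ h' => hd h') le_rfl
  | ite e c d hc hd =>
    exact Runs.ite (fun he => (hc (h.1 he)).mono (Nat.le_add_right _ _) fun _ _ h => h)
      (fun he => (hd (h.2 he)).mono (Nat.le_add_left _ _) fun _ _ h => h) le_rfl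
  | loop => exact h.elim

/-- A loop with an invariant and a decreasing measure. -/
theorem Runs.while {W : ℕ} {e : Expr} {c : Cmd} {T : ℕ} (Inv : Store → Prop) (μ : Store → ℕ)
    (hc : ∀ s, Inv s → e.eval s ≠ 0 → Runs W c s T fun s' => Inv s' ∧ μ s' < μ s)
    {s : Store} (hs : Inv s) :
    Runs W (.loop e c) s (μ s * (T + 1 + e.time) + 1 + e.time)
      fun s' => Inv s' ∧ e.eval s' = 0 := by
  induction hm : μ s using Nat.strong_induction_on generalizing s with
  | _ m ih =>
    subst hm
    by_cases he : e.eval s = 0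
    · exact ⟨_, _, .loop_done _ he, by omega, hs, he⟩
    · obtain ⟨t, s', hx, ht, hs', hlt⟩ := hc s hs he
      obtain ⟨t', s'', hx', ht', hQ⟩ := ih _ hlt hs' rfl
      refine ⟨_, _, .loop_step he hx hx', ?_, hQ⟩
      have : (μ s' + 1) * (T + 1 + e.time) ≤ μ s * (T + 1 + e.time) :=
        Nat.mul_le_mul_right _ hlt
      rw [Nat.add_mul] at this
      omega

/-- `for x = 0, …, b - 1` -/
def Cmd.for (x : ℕ) (b : Expr) (c : Cmd) : Cmd :=
  .seq (.assign x (.const 0)) (.loop (.lt (.var x) b) (.seq c (.assign x (.var x + .const 1))))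

/-- A pass costs `T` for the body, `4` for the increment and `b.time + 3` for the test; the initial
assignment and the last test make up `b.time + 5`. The counter reaches `m`, whence `m < W`. The
invariant is demanded after the counter has been updated, because it may refer to the whole store.
-/
theorem Runs.for {W : ℕ} {x : ℕ} {b : Expr} {c : Cmd} {s₀ : Store} (m T : ℕ)
    (Inv : ℕ → Store → Prop) {T' : ℕ} (hx : x ∉ c.vars)
    (hb : ∀ s, Frame (.for x b c) s₀ s → b.eval s = m) (hm : m < W)
    (h0 : Inv 0 (s₀.setVar x 0))
    (hc : ∀ i < m, ∀ s, s.var x = i → Frame (.for x b c) s₀ s → Inv i s →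
      Runs W c s T fun s' => Inv (i + 1) (s'.setVar x (i + 1)))
    (hT : m * (T + b.time + 7) + b.time + 5 ≤ T') :
    Runs W (.for x b c) s₀ T' fun s' => Inv m s' ∧ s'.var x = m := by
  have hF0 : Frame (.for x b c) s₀ (s₀.setVar x 0) := by
    refine ⟨fun y hy => ?_, fun _ _ => rfl⟩
    have : y ≠ x := by rintro rfl; simp [Cmd.for, Cmd.vars] at hy
    simp [this]
  have hloop := Runs.while (W := W) (e := .lt (.var x) b)
    (c := .seq c (.assign x (.var x + .const 1)))
    (T := T + 4)
    (fun s => s.var x ≤ m ∧ Inv (s.var x) s ∧ Frame (.for x b c) s₀ s)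
    (fun s => m - s.var x) (fun s hs he => by
      obtain ⟨h1, h2, h3⟩ := hs
      have hlt : s.var x < m := by
        by_contra hlt
        simp [hb s h3, hlt] at he
      refine Runs.seq (hc _ hlt s rfl h3 h2) (fun s' hF h' => ?_) (T' := 4) le_rfl
      have hxx : s'.var x = s.var x := hF.var _ hx
      refine Runs.of_wp ⟨?_, ⟨?_, ?_⟩, ?_⟩ ?_
      · change s'.var x + 1 < W; omega
      · change (s'.setVar x (s'.var x + 1)).var x ≤ m
        simp; omega
      · change Inv ((s'.setVar x (s'.var x + 1)).var x) (s'.setVar x (s'.var x + 1)) ∧ _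
        refine ⟨by simpa [hxx] using h', h3.trans ⟨fun y hy => ?_, fun a ha => ?_⟩⟩
        · have hyx : y ≠ x := by rintro rfl; simp [Cmd.for, Cmd.vars] at hy
          rw [Store.setVar_var, if_neg hyx]
          exact hF.var y fun h => hy (by simp [Cmd.for, Cmd.vars, h])
        · rw [Store.setVar_arr]
          exact hF.arr a fun h => ha (by simp [Cmd.for, Cmd.arrs, h])
      · change m - (s'.setVar x (s'.var x + 1)).var x < m - s.var x
        simp; omega
      · exact le_rfl) (s := s₀.setVar x 0) (by
        refine ⟨by simp, by simpa using h0, hF0⟩)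
  refine Runs.seq (T := 2) (R := fun s => s = s₀.setVar x 0)
    (Runs.of_wp ⟨by simpa using by omega, rfl⟩ le_rfl) (fun s' _ hs => ?_)
    (T' := m * (T + b.time + 7) + b.time + 3) (by omega)
  subst hs
  refine hloop.mono ?_ fun s' _ h => ?_
  · have : Expr.time (.lt (.var x) b) = 2 + b.time := by simp [Expr.time]
    simp only [this, Store.setVar_var, if_true, Nat.sub_zero]
    have e : T + 4 + 1 + (2 + b.time) = T + b.time + 7 := by ring
    rw [e]; omega
  · obtain ⟨⟨h1, h2, h3⟩, h4⟩ := h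
    have : s'.var x = m := by
      by_contra hne
      simp [hb s' h3, show s'.var x < m by omega] at h4
    exact ⟨this ▸ h2, this⟩

/-- Two nested loops, with an invariant indexed by the number of passes of the inner loop. -/
theorem Runs.for₂ {W : ℕ} {x y : ℕ} {a b : Expr} {c : Cmd} {s₀ : Store} (l m T : ℕ)
    (Inv : ℕ → Store → Prop) {T' : ℕ} (hxy : x ≠ y) (hx : x ∉ c.vars) (hy : y ∉ c.vars)
    (ha : ∀ s, Frame (.for x a (.for y b c)) s₀ s → a.eval s = l) (hl : l < W)
    (hb : ∀ s, Frame (.for x a (.for y b c)) s₀ s → b.eval s = m) (hm : m < W)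
    (hInv : ∀ i s u, Inv i s → Inv i (s.setVar x u) ∧ Inv i (s.setVar y u))
    (h0 : Inv 0 s₀)
    (hc : ∀ i < l, ∀ j < m, ∀ s, s.var x = i → s.var y = j →
      Frame (.for x a (.for y b c)) s₀ s → Inv (i * m + j) s →
      Runs W c s T (Inv (i * m + j + 1)))
    (hT : l * (m * (T + b.time + 7) + b.time + 5 + a.time + 7) + a.time + 5 ≤ T') :
    Runs W (.for x a (.for y b c)) s₀ T' (Inv (l * m)) := by
  have hF : ∀ {s s' : Store}, Frame (.for y b c) s s' →
      Frame (.for x a (.for y b c)) s s' := fun h =>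
    h.mono (fun z hz => by
      simp only [Cmd.for, Cmd.vars, List.mem_append] at hz ⊢; tauto) (fun z hz => by
      simp only [Cmd.for, Cmd.arrs, List.mem_append] at hz ⊢; tauto)
  refine (Runs.for (x := x) l (m * (T + b.time + 7) + b.time + 5)
    (fun i s => Inv (i * m) s) ?_ ha hl ?_ ?_ hT).mono le_rfl fun s _ h => h.1
  · simp [Cmd.for, Cmd.vars, hxy, hx]
  · simpa using (hInv _ _ _ h0).1
  · intro i hi s hsx hFs hInvs
    refine (Runs.for (x := y) m T (fun j s => Inv (i * m + j) s) hy
      (fun s' h => hb s' (hFs.trans (hF h))) hm ?_ ?_ le_rfl).mono le_rfl fun s' _ h => ?_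
    · exact (hInv _ _ _ hInvs).2
    · intro j hj s' hs'y hF' hI
      refine (hc i hi j hj s' ?_ hs'y (hFs.trans (hF hF')) hI).mono le_rfl fun s'' _ h => ?_
      · rw [hF'.var x (by simp [Cmd.for, Cmd.vars, hxy, hx]), hsx]
      · exact (hInv _ _ _ h).2
    · rw [Nat.add_mul, Nat.one_mul]
      exact (hInv _ _ _ h.1).1

end WordRAM

/-! ## Every execution makes few passes -/

namespace CompositeSystem

variable {k n : ℕ} (I : CompositeSystem k n)

theorem Accessible.mono {F F' : Set (StateNode k n × StateNode k n)} (h : F ⊆ F')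
    {v : StateNode k n} (hv : I.Accessible F v) : I.Accessible F' v := by
  obtain ⟨w, hw, hp⟩ := hv
  exact ⟨w, hw, Relation.ReflTransGen.mono (fun _ _ hab => hab.imp_right fun hab => h hab) _ _ hp⟩

theorem Accessible.inner {F : Set (StateNode k n × StateNode k n)} {v w : StateNode k n}
    (hv : I.Accessible F v) (h : I.Inner v w) : I.Accessible F w := by
  obtain ⟨u, hu, hp⟩ := hv
  exact ⟨u, hu, hp.tail (Or.inl h)⟩

theorem Accessible.inner_star {F : Set (StateNode k n × StateNode k n)} {v w : StateNode k n}
    (hv : I.Accessible F v) (h : Relation.ReflTransGen I.Inner v w) : I.Accessible F w := by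
  induction h with
  | refl => exact hv
  | tail _ h ih => exact ih.inner I h

theorem Accessible.edge {F : Set (StateNode k n × StateNode k n)} {v w : StateNode k n}
    (hv : I.Accessible F v) (h : (v, w) ∈ F) : I.Accessible F w := by
  obtain ⟨u, hu, hp⟩ := hv
  exact ⟨u, hu, hp.tail (Or.inr h)⟩

/-- A set of states that contains the input states and is closed under the edges contains all
accessible states. -/
theorem Accessible.induction {F : Set (StateNode k n × StateNode k n)} {p : StateNode k n → Prop}
    (hB : ∀ w, I.B w = true → p w) (hI : ∀ v w, I.Accessible F v → p v → I.Inner v w → p w)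
    (hF : ∀ v w, I.Accessible F v → p v → (v, w) ∈ F → p w)
    {v : StateNode k n} (hv : I.Accessible F v) : p v := by
  obtain ⟨u, hu, hp⟩ := hv
  induction hp with
  | refl => exact hB _ hu
  | tail hb h ih => exact h.elim (hI _ _ ⟨u, hu, hb⟩ ih) (hF _ _ ⟨u, hu, hb⟩ ih)

/-- Within a strongly connected component, one accessible state makes all states accessible. -/
theorem IsSCC.accessibleSet {S : Finset (StateNode k n)} (hS : I.IsSCC S)
    {F : Set (StateNode k n × StateNode k n)} {v : StateNode k n} (hv : v ∈ S)
    (h : I.Accessible F v) : I.AccessibleSet F S := by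
  obtain ⟨u, hu⟩ := hS
  intro w hw
  exact h.inner_star I (((hu v).1 hv).2.trans ((hu w).1 hw).1)

theorem mem_comps {S : Finset (StateNode k n)} :
    S ∈ I.comps ↔ I.IsNonTopLinkedSCC S ∧ ¬ I.AccessibleSet ∅ S := by
  simp [comps]

/-- Redirecting an edge whose target is inaccessible to an accessible source keeps all accessible
states accessible. -/
theorem Accessible.redirect {F F' : Set (StateNode k n × StateNode k n)} {s : StateNode k n}
    (hs : ¬ I.Accessible F s) (hF : ∀ f ∈ F, f.2 ≠ s → f ∈ F') {v : StateNode k n}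
    (hv : I.Accessible F v) : I.Accessible F' v :=
  Accessible.induction I (fun w hw => ⟨w, hw, .refl⟩) (fun _ _ _ h hi => h.inner I hi)
    (fun a b ha h hf => h.edge I (hF _ hf (by rintro rfl; exact hs (ha.edge I hf)))) hv

/-- Accessibility of one state spreads over a strongly connected component, so an inaccessible
component has no accessible state at all. -/
theorem Pending.not_accessible {M : Finset (BipEdge k n)} {x : StateNode k n}
    (h : I.Pending M x) : ¬ I.Accessible (inter M) x := by
  obtain ⟨_, S, hS, hx, hn⟩ := h
  exact fun h => hn (((I.mem_comps).1 hS).1.1.accessibleSet I hx h)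

/-- A pass through the loop makes at least one more state accessible. -/
theorem LoopStep.accessible {M M' : Finset (BipEdge k n)} (h : I.LoopStep M M') :
    (∀ v, I.Accessible (inter M) v → I.Accessible (inter M') v) ∧
      ∃ x, ¬ I.Accessible (inter M) x ∧ I.Accessible (inter M') x := by
  obtain ⟨x, y, z, hx, hxy, hz, h | h⟩ := h
  · obtain ⟨hne, rfl⟩ := h
    have hmono : ∀ v, I.Accessible (inter M) v →
        I.Accessible (inter (insert (x, RightNode.state z) (M.erase (x, RightNode.state y)))) v :=
      fun v hv => Accessible.redirect I (hx.not_accessible I) (fun f hf hfx => by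
        refine ⟨hf.1, ?_⟩
        have : (f.2, RightNode.state f.1) ≠ (x, RightNode.state y) := fun h => hfx (by
          simpa using congrArg Prod.fst h)
        exact Finset.mem_insert_of_mem (Finset.mem_erase.2 ⟨this, hf.2⟩)) hv
    refine ⟨hmono, x, hx.not_accessible I, (hmono z hz.2).edge I ?_⟩
    exact ⟨fun h => hne h.symm, Finset.mem_insert_self _ _⟩
  · obtain ⟨-, s, w, -, hws, hsw, rfl, hacc⟩ := h
    have hxn := hx.not_accessible I
    obtain ⟨-, S, hS, hxS, -⟩ := hx
    have hxa := hacc S hS hxS x hxS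
    -- The only new interconnection ends in `s`. Were `s` accessible before, the old accessible set
    -- would be closed under the new edges too, and `x` could not have become accessible.
    have hsn : ¬ I.Accessible (inter M) s := by
      intro hs
      refine hxn (Accessible.induction I (fun w hw => ⟨w, hw, .refl⟩)
        (fun _ _ _ h hi => h.inner I hi) (fun a b _ ha hf => ?_) hxa)
      obtain ⟨hf1, hf2⟩ := hf
      rcases Finset.mem_insert.1 hf2 with h | h
      · have : b = s := by simpa using congrArg Prod.fst h
        exact this ▸ hs
      · exact ha.edge I ⟨hf1, (Finset.mem_erase.1 h).2⟩
    refine ⟨fun v hv => Accessible.redirect I hsn (fun f hf hfx => ?_) hv, x, hxn, hxa⟩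
    refine ⟨hf.1, Finset.mem_insert_of_mem (Finset.mem_erase.2 ⟨fun h => hfx (by
      simpa using congrArg Prod.fst h), hf.2⟩)⟩

open Classical in
/-- The accessible states. -/
noncomputable def accessibleStates (F : Set (StateNode k n × StateNode k n)) :
    Finset (StateNode k n) := Finset.univ.filter (I.Accessible F)

theorem card_accessibleStates_lt {F F' : Set (StateNode k n × StateNode k n)}
    (h : ∀ v, I.Accessible F v → I.Accessible F' v) {x : StateNode k n}
    (hx : ¬ I.Accessible F x) (hx' : I.Accessible F' x) :
    (I.accessibleStates F).card < (I.accessibleStates F').card := by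
  refine Finset.card_lt_card (Finset.ssubset_iff_of_subset ?_ |>.2 ⟨x, ?_⟩)
  · intro v; simpa [accessibleStates] using h v
  · simp [accessibleStates, hx, hx']

theorem card_accessibleStates_le (F : Set (StateNode k n × StateNode k n)) :
    (I.accessibleStates F).card ≤ k * n := by
  simpa using Finset.card_le_univ (I.accessibleStates F)

theorem ExtraEdge.card_lt {F F' : Set (StateNode k n × StateNode k n)}
    {f : StateNode k n × StateNode k n} (h : I.ExtraEdge F f) (hF : F ⊆ F') (hf : f ∈ F') :
    (I.accessibleStates F).card < (I.accessibleStates F').card := by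
  obtain ⟨-, h1, S, hS, h2, h3⟩ := h
  exact card_accessibleStates_lt I (fun _ => Accessible.mono I hF)
    (fun h => h3 (((I.mem_comps).1 hS).1.1.accessibleSet I h2 h)) ((h1.mono I hF).edge I hf)

end CompositeSystem

/-- The number of accessible states is a potential: it grows strictly with every pass and with every
addition, and it is at most `k * n`. -/
theorem Trace.IsPartialRun.bounds {k n : ℕ} {I : CompositeSystem k n} {τ : Trace k n}
    (h : τ.IsPartialRun I) : τ.passes ≤ k * n ∧ τ.extra.length ≤ k * n := by
  obtain ⟨-, -, -, hloop, -, hextra⟩ := h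
  constructor
  · have : ∀ m ≤ τ.passes,
        m ≤ (I.accessibleStates (CompositeSystem.inter (τ.mTilde m))).card := by
      intro m
      induction m with
      | zero => simp
      | succ m ih =>
        intro hm
        obtain ⟨h1, x, hx, hx'⟩ := (hloop m hm).accessible I
        have := I.card_accessibleStates_lt h1 hx hx'
        have := ih (by omega)
        omega
    exact (this _ le_rfl).trans (I.card_accessibleStates_le _)
  · have : ∀ m ≤ τ.extra.length, m ≤ (I.accessibleStates (τ.edgesAfter m)).card := by
      intro m
      induction m with
      | zero => simp
      | succ m ih =>
        intro hm
        have := (hextra m hm).card_lt I (F' := τ.edgesAfter (m + 1)) (by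
          rintro f (hf | hf)
          · exact Or.inl hf
          · exact Or.inr (List.take_subset_take_left _ (Nat.le_succ m) hf)) (Or.inr (by
            simp only [Set.mem_ofPred_eq, List.take_add_one]
            simp))
        have := ih (by omega)
        omega
    exact (this _ le_rfl).trans (I.card_accessibleStates_le _)

/-! ## Consequences of structural controllability -/

namespace IsStructurallyControllable

variable {ι : Type*} [Fintype ι] [DecidableEq ι] {A : Matrix ι ι Bool} {b : ι → Bool}

/-- In a structurally controllable system every state can be reached from the input. -/
theorem reachable (h : IsStructurallyControllable A b) (v : ι) :
    ∃ w, b w = true ∧ Relation.ReflTransGen (fun i j => A j i = true) w v := by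
  obtain ⟨A', b', hA, hb, hc⟩ := h
  by_contra hv
  let R : ι → Prop := fun v => ∃ w, b w = true ∧
    Relation.ReflTransGen (fun i j => A j i = true) w v
  -- The vectors supported on the reachable states form an invariant subspace that contains `b'`;
  -- controllability makes it the whole space, whereas it lacks the unit vector of an unreachable
  -- state.
  let S : Submodule ℝ (ι → ℝ) :=
    { carrier := {x | ∀ v, ¬ R v → x v = 0}
      add_mem' := fun {x y} hx hy v hv => by simp [hx v hv, hy v hv]
      zero_mem' := fun _ _ => rfl
      smul_mem' := fun c x hx v hv => by simp [hx v hv] }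
  have hpow : ∀ j : ℕ, (A' ^ j).mulVec b' ∈ S := by
    intro j
    induction j with
    | zero =>
      intro v hv
      simp only [pow_zero, Matrix.one_mulVec]
      by_contra hne
      refine hv ⟨v, ?_, .refl⟩
      by_contra hbv
      exact hne (hb v (by simpa using hbv))
    | succ j ih =>
      intro v hv
      rw [pow_succ', ← Matrix.mulVec_mulVec]
      refine Finset.sum_eq_zero fun i _ => ?_
      by_cases hi : R i
      · have : A v i = false := by
          by_contra hA
          obtain ⟨w, hw, hp⟩ := hi
          exact hv ⟨w, hw, hp.tail (by simpa using hA)⟩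
        simp [hA _ _ this]
      · simp [ih i hi]
  have htop : S = ⊤ := by
    rw [eq_top_iff, ← hc, Submodule.span_le]
    rintro _ ⟨j, rfl⟩
    exact hpow j
  have : (Pi.single v 1 : ι → ℝ) ∈ S := htop ▸ Submodule.mem_top
  have := this v hv
  simp at this

/-- In a structurally controllable system every set of rows of `[A, b]` has at least as many
nonzero columns as it has rows. -/
theorem card_le (h : IsStructurallyControllable A b) (Q : Finset ι) (Γ : Finset (Option ι))
    (hA' : ∀ i ∈ Q, ∀ j, A i j = true → some j ∈ Γ) (hb' : ∀ i ∈ Q, b i = true → none ∈ Γ) :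
    Q.card ≤ Γ.card := by
  obtain ⟨A', b', hA, hb, hc⟩ := h
  by_contra! hlt
  -- The columns of `[A', b']`, with `none` for the input column. If `Q` had more rows than `Γ` has
  -- columns, some nonzero `w` would annihilate the rows in `Q`; extended by zero it is orthogonal
  -- to `b'` and to all columns of `A'`, hence to every column of the controllability matrix.
  let col : Option ι → ι → ℝ := fun o i => o.elim (b' i) (A' i)
  let f : (Q → ℝ) →ₗ[ℝ] (Γ → ℝ) :=
    { toFun := fun w o => ∑ i : Q, w i * col o i
      map_add' := fun w w' => by ext o; simp [add_mul, Finset.sum_add_distrib]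
      map_smul' := fun c w => by ext o; simp [Finset.mul_sum, mul_assoc] }
  have hker : f.ker ≠ ⊥ := LinearMap.ker_ne_bot_of_finrank_lt (by simpa using hlt)
  obtain ⟨w, hw, hw0⟩ := (Submodule.ne_bot_iff _).1 hker
  let w' : ι → ℝ := fun i => if h : i ∈ Q then w ⟨i, h⟩ else 0
  have hsum : ∀ g : ι → ℝ, ∑ i, w' i * g i = ∑ i : Q, w i * g i := by
    intro g
    rw [← Finset.sum_subset (Finset.subset_univ Q) (fun i _ hi => by simp [w', hi]),
      ← Finset.sum_coe_sort Q]
    exact Finset.sum_congr rfl fun i _ => by simp [w']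
  have hcol : ∀ o, ∑ i, w' i * col o i = 0 := by
    intro o
    by_cases ho : o ∈ Γ
    · rw [hsum]
      exact congrFun (LinearMap.mem_ker.1 hw) ⟨o, ho⟩
    · refine Finset.sum_eq_zero fun i _ => ?_
      by_cases hi : i ∈ Q
      · have : col o i = 0 := by
          cases o with
          | none => exact hb i (by simpa using fun h => ho (hb' i hi h))
          | some j => exact hA i j (by simpa using fun h => ho (hA' i hi j h))
        simp [this]
      · simp [w', hi]
  have hvec : Matrix.vecMul w' A' = 0 := by
    ext j
    exact hcol (some j)
  have hpow : ∀ j : ℕ, dotProduct w' ((A' ^ j).mulVec b') = 0 := by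
    intro j
    cases j with
    | zero =>
      rw [pow_zero, Matrix.one_mulVec]
      exact hcol none
    | succ j => rw [Matrix.dotProduct_mulVec, pow_succ', ← Matrix.vecMul_vecMul, hvec]; simp
  let S : Submodule ℝ (ι → ℝ) :=
    { carrier := {x | dotProduct w' x = 0}
      add_mem' := fun {x y} hx hy => by
        change dotProduct w' (x + y) = 0
        rw [dotProduct_add, show dotProduct w' x = 0 from hx, show dotProduct w' y = 0 from hy,
          add_zero]
      zero_mem' := dotProduct_zero _
      smul_mem' := fun c x hx => by
        change dotProduct w' (c • x) = 0
        rw [dotProduct_smul, show dotProduct w' x = 0 from hx, smul_zero] }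
  have htop : S = ⊤ := by
    rw [eq_top_iff, ← hc, Submodule.span_le]
    rintro _ ⟨j, rfl⟩
    exact hpow j
  refine hw0 (funext fun i => ?_)
  have : (Pi.single i.1 1 : ι → ℝ) ∈ S := htop ▸ Submodule.mem_top
  have : dotProduct w' (Pi.single i.1 1) = 0 := this
  simpa [w'] using this

end IsStructurallyControllable

/-! ## Greedy matchings with cheap edges -/

namespace CompositeSystem

variable {k n : ℕ} (I : CompositeSystem k n)

/-- The edges of the bipartite graph `ℬ(A, B, 𝒩)` that are not interconnections. -/
def Low : StateNode k n → RightNode k n → Prop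
  | v, .state w => v.1 = w.1 ∧ I.A v.2 w.2 = true
  | v, .input => I.B v = true
  | v, .scc S => S ∈ I.comps ∧ v ∈ S

theorem low_iff {v : StateNode k n} {r : RightNode k n} :
    I.Low v r ↔ I.BipAdj v r ∧ cost (v, r) ≤ 2 := by
  cases r with
  | state w =>
    simp only [Low, BipAdj, cost]
    by_cases h : v.1 = w.1 <;> simp [h]
  | input => simp [Low, BipAdj, cost]
  | scc S => simp [Low, BipAdj, cost]

@[simp] theorem state_mem_right (w : StateNode k n) : RightNode.state w ∈ I.graph.right := by
  simp [graph]
@[simp] theorem input_mem_right : RightNode.input ∈ I.graph.right := by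
  simp [graph]
@[simp] theorem scc_notMem_right (S : Finset (StateNode k n)) :
    RightNode.scc S ∉ I.graph.right := by
  simp [graph]
@[simp] theorem state_mem_rightN (w : StateNode k n) : RightNode.state w ∈ I.graphN.right := by
  simp [graphN]
@[simp] theorem input_mem_rightN : RightNode.input ∈ I.graphN.right := by
  simp [graphN]
@[simp] theorem scc_mem_rightN {S : Finset (StateNode k n)} :
    RightNode.scc S ∈ I.graphN.right ↔ S ∈ I.comps := by
  simp [graphN]
theorem mem_edges {v : StateNode k n} {r : RightNode k n} :
    (v, r) ∈ I.graph.edges ↔ r ∈ I.graph.right ∧ I.BipAdj v r := by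
  simp [graph]
theorem mem_edgesN {v : StateNode k n} {r : RightNode k n} :
    (v, r) ∈ I.graphN.edges ↔ r ∈ I.graphN.right ∧ I.BipAdj v r := by
  simp [graphN]

variable {I} in
theorem Low.mem_rightN {v : StateNode k n} {r : RightNode k n} (h : I.Low v r) :
    r ∈ I.graphN.right := by
  cases r with
  | state w => simp
  | input => simp
  | scc S => simpa using h.1

theorem card_right : I.graph.right.card = k * n + 1 := by
  have h : Disjoint (Finset.univ.image (RightNode.state (k := k) (n := n))) {RightNode.input} := by
    simp
  rw [graph, Finset.card_union_of_disjoint h, Finset.card_image_of_injective _ (fun _ _ h => by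
    simpa using h)]
  simp

theorem right_subset : I.graph.right ⊆ I.graphN.right := by
  rw [graph, graphN]
  exact Finset.subset_union_left

theorem cost_le_three (e : BipEdge k n) : cost e ≤ 3 := by
  obtain ⟨v, r⟩ := e
  cases r with
  | state w => simp only [cost]; split_ifs <;> simp
  | input => simp [cost]
  | scc S => simp [cost]

theorem cost_le_zero {e : BipEdge k n} : cost e ≤ 0 ↔ e.2 = .input := by
  obtain ⟨v, r⟩ := e
  cases r with
  | state w => simp only [cost]; split_ifs <;> simp
  | input => simp [cost]
  | scc S => simp [cost]

/-- An edge of cost `c` is counted `3 - c` times in the three cardinalities. For matchings of a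
fixed size, least cost thus follows from having the most edges on each of the three levels. -/
theorem sum_cost_add (M : Finset (BipEdge k n)) :
    ∑ e ∈ M, cost e + ((M.filter fun e => cost e ≤ 0).card + (M.filter fun e => cost e ≤ 1).card +
      (M.filter fun e => cost e ≤ 2).card) = 3 * M.card := by
  simp only [Finset.card_filter, ← Finset.sum_add_distrib]
  rw [Finset.sum_congr rfl (g := fun _ => 3), Finset.sum_const, smul_eq_mul, mul_comm]
  intro e _
  have := cost_le_three e
  interval_cases cost e <;> rfl

/-- `D` certifies that `m` matches as many of the nodes in `R` as possible. -/
def Certifies (m : StateNode k n → Option (RightNode k n)) (R D : Finset (RightNode k n)) : Prop :=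
  D ⊆ R ∧ (∀ r ∈ R, (∀ v, m v ≠ some r) → r ∈ D) ∧
    ∀ v, ∀ r ∈ D, I.Low v r → ∃ r' ∈ D, m v = some r'

/-- A matching with cheap edges, obtained by treating the input first, then the states, then the
components. -/
structure Greedy (m : StateNode k n → Option (RightNode k n)) : Prop where
  low : ∀ {v r}, m v = some r → I.Low v r
  inj : ∀ {v w r}, m v = some r → m w = some r → v = w
  -- This condition and the next two express maximality for the edges of cost at most 0, 1 and 2,
  -- respectively.
  input : ∃ a, m a = some .input
  cert : ∃ D, I.Certifies m I.graph.right D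
  certN : ∃ D, I.Certifies m I.graphN.right D

open Classical in
/-- The left-hand nodes that `m` matches into `R`. -/
noncomputable def matchedInto (m : StateNode k n → Option (RightNode k n))
    (R : Finset (RightNode k n)) : Finset (StateNode k n) :=
  Finset.univ.filter fun v => ∃ r ∈ R, m v = some r

theorem mem_matchedInto {m : StateNode k n → Option (RightNode k n)}
    {R : Finset (RightNode k n)} {v : StateNode k n} :
    v ∈ matchedInto m R ↔ ∃ r ∈ R, m v = some r := by simp [matchedInto]

section

variable {I} {m : StateNode k n → Option (RightNode k n)} {R D : Finset (RightNode k n)}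

/-- All nodes of `R` outside `D` are matched, and their partners are different from the nodes
matched into `D`. This is the half of the duality that concerns `m` itself. -/
theorem Certifies.card_le (hD : I.Certifies m R D) :
    (R \ D).card + (matchedInto m D).card ≤ (matchedInto m R).card := by
  have h1 : (R \ D).card ≤ (matchedInto m (R \ D)).card := by
    refine Finset.card_le_card_of_surjOn (fun v => (m v).getD .input) fun r hr => ?_
    have hr' := Finset.mem_sdiff.1 hr
    have : ∃ v, m v = some r := by
      by_contra! h
      exact hr'.2 (hD.2.1 r hr'.1 h)
    obtain ⟨v, hv⟩ := this
    exact ⟨v, mem_matchedInto.2 ⟨r, hr, hv⟩, by simp [hv]⟩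
  rw [show matchedInto m R = matchedInto m (R \ D) ∪ matchedInto m D by
    ext v
    simp only [Finset.mem_union, mem_matchedInto, Finset.mem_sdiff]
    constructor
    · rintro ⟨r, hr, hv⟩
      by_cases hrD : r ∈ D
      · exact Or.inr ⟨r, hrD, hv⟩
      · exact Or.inl ⟨r, ⟨hr, hrD⟩, hv⟩
    · rintro (⟨r, hr, hv⟩ | ⟨r, hr, hv⟩)
      · exact ⟨r, hr.1, hv⟩
      · exact ⟨r, hD.1 hr, hv⟩, Finset.card_union_of_disjoint]
  · omega
  · rw [Finset.disjoint_left]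
    intro v h h'
    obtain ⟨r, hr, hv⟩ := mem_matchedInto.1 h
    obtain ⟨r', hr', hv'⟩ := mem_matchedInto.1 h'
    rw [hv] at hv'
    cases hv'
    exact (Finset.mem_sdiff.1 hr).2 hr'

/-- A matching with cheap edges into `R` is not larger than the greedy one. -/
theorem Certifies.card_le_matchedInto (hD : I.Certifies m R D) {α : Type*} (T : Finset α)
    (l : α → StateNode k n) (ρ : α → Option (RightNode k n)) (hl : Set.InjOn l T)
    (hρ : ∀ e ∈ T, ∀ e' ∈ T, ∀ r, ρ e = some r → ρ e' = some r → e = e')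
    (h : ∀ e ∈ T, ∃ r ∈ R, ρ e = some r ∧ I.Low (l e) r) :
    T.card ≤ (matchedInto m R).card := by
  classical
  refine le_trans ?_ (hD.card_le)
  -- Weak duality: the members of `T` with right end outside `D` number at most `|R \ D|`; the
  -- others have their left ends among the neighbours of `D`, all of which `m` matches into `D`.
  rw [← Finset.card_filter_add_card_filter_not (s := T) (fun e => ∃ r ∈ D, ρ e = some r), add_comm]
  refine Nat.add_le_add ?_ ?_
  · refine Finset.card_le_card_of_injOn (fun e => (ρ e).getD .input) ?_ ?_
    · intro e he
      obtain ⟨he, hn⟩ := Finset.mem_filter.1 he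
      obtain ⟨r, hr, hre, -⟩ := h e he
      simp only [hre, Option.getD_some]
      exact Finset.mem_coe.2 (Finset.mem_sdiff.2 ⟨hr, fun hD => hn ⟨r, hD, hre⟩⟩)
    · intro e he e' he' heq
      have he := (Finset.mem_filter.1 he).1
      have he' := (Finset.mem_filter.1 he').1
      obtain ⟨r, hr, hre, -⟩ := h e he
      obtain ⟨r', hr', hre', -⟩ := h e' he'
      simp only [hre, hre', Option.getD_some] at heq
      subst heq
      exact hρ e he e' he' r hre hre'
  · refine Finset.card_le_card_of_injOn l ?_ (hl.mono fun e he => (Finset.mem_filter.1 he).1)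
    intro e he
    obtain ⟨he, r, hr, hre⟩ := Finset.mem_filter.1 he
    obtain ⟨r', -, hre', hlow⟩ := h e he
    rw [hre] at hre'
    cases hre'
    exact Finset.mem_coe.2 (mem_matchedInto.2 (hD.2.2 _ r hr hlow))

/-- A perfect matching that contains a greedy matching has least cost. -/
theorem Greedy.isMinCostPerfectMatching (hm : I.Greedy m) {M : Finset (BipEdge k n)}
    (hM : I.graphN.IsPerfectMatching M) (hmM : ∀ v r, m v = some r → (v, r) ∈ M) :
    I.graphN.IsMinCostPerfectMatching cost M := by
  refine ⟨hM, fun (M' : Finset (BipEdge k n)) hM' => ?_⟩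
  -- The edges of cost at most `c` in the competitor `M'` form a matching into `R`, which the
  -- certificate bounds by the greedy edges contained in `M`.
  have hle : ∀ (R : Finset (RightNode k n)) (c : ℕ), (∃ D, I.Certifies m R D) → c ≤ 2 →
      (∀ e ∈ I.graphN.edges, cost e ≤ c → e.2 ∈ R) →
      (∀ v r, I.Low v r → r ∈ R → cost (v, r) ≤ c) →
      (M'.filter fun e => cost e ≤ c).card ≤ (M.filter fun e => cost e ≤ c).card := by
    rintro R c ⟨D, hD⟩ hc hR hR'
    have hpair : ∀ e ∈ M', ∀ e' ∈ M', e.1 = e'.1 ∨ e.2 = e'.2 → e = e' := by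
      intro e he e' he' h
      by_contra hne
      have := hM'.1.2 e he e' he' hne
      tauto
    refine (hD.card_le_matchedInto _ Prod.fst (fun e => some e.2) ?_ ?_ ?_).trans ?_
    · intro e he e' he' h
      exact hpair _ (Finset.mem_filter.1 he).1 _ (Finset.mem_filter.1 he').1 (Or.inl h)
    · intro e he e' he' r h h'
      exact hpair _ (Finset.mem_filter.1 he).1 _ (Finset.mem_filter.1 he').1 (Or.inr (by
        simpa using h.trans h'.symm))
    · intro e he
      obtain ⟨he, hce⟩ := Finset.mem_filter.1 he
      have he := hM'.1.1 he
      exact ⟨e.2, hR e he hce, rfl, I.low_iff.2 ⟨(I.mem_edgesN.1 he).2, hce.trans hc⟩⟩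
    · refine Finset.card_le_card_of_injOn (fun v => (v, (m v).getD .input)) ?_ ?_
      · intro v hv
        obtain ⟨r, hr, hvr⟩ := mem_matchedInto.1 hv
        simp only [hvr, Option.getD_some]
        exact Finset.mem_coe.2 (Finset.mem_filter.2 ⟨hmM _ _ hvr, hR' _ _ (hm.low hvr) hr⟩)
      · intro v _ w _ h
        exact congrArg Prod.fst h
  have h2 := hle I.graphN.right 2 hm.certN le_rfl
    (fun e he _ => (I.mem_edgesN.1 he).1) fun v r h _ => (I.low_iff.1 h).2
  have h1 := hle I.graph.right 1 hm.cert one_le_two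
    (fun e _ hc => by
      obtain ⟨v, r⟩ := e
      cases r with
      | state => simp
      | input => simp
      | scc S => simp [cost] at hc)
    (fun v r h hr => by
      cases r with
      | state w => simp [cost, h.1]
      | input => simp [cost]
      | scc S => simp at hr)
  -- Cost 0 occurs only at the single input node, so one edge is the maximum.
  have h0 : (M'.filter fun e => cost e ≤ 0).card ≤ (M.filter fun e => cost e ≤ 0).card := by
    obtain ⟨a, ha⟩ := hm.input
    have : 0 < (M.filter fun e => cost e ≤ 0).card :=
      Finset.card_pos.2 ⟨(a, .input), Finset.mem_filter.2 ⟨hmM _ _ ha, by simp [cost]⟩⟩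
    refine le_trans ?_ this
    refine Finset.card_le_one.2 fun e he e' he' => ?_
    obtain ⟨he, hc⟩ := Finset.mem_filter.1 he
    obtain ⟨he', hc'⟩ := Finset.mem_filter.1 he'
    by_contra hne
    exact (hM'.1.2 e he e' he' hne).2 ((cost_le_zero.1 hc).trans (cost_le_zero.1 hc').symm)
  have := sum_cost_add M
  have := sum_cost_add M'
  have : M.card = M'.card := hM.2.trans hM'.2.symm
  refine Nat.le_of_not_lt fun hlt => ?_
  have hlt : ∑ e ∈ M', cost e < ∑ e ∈ M, cost e := hlt
  omega

/-! ### Starts and their number in each subsystem -/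

/-- The left-hand nodes that are matched neither inside their subsystem nor with the input. -/
def IsStart (m : StateNode k n → Option (RightNode k n)) (v : StateNode k n) : Prop :=
  m v = none ∨ ∃ S, m v = some (.scc S)

theorem isStart_iff {v : StateNode k n} :
    IsStart m v ↔ v ∉ matchedInto m I.graph.right := by
  rw [mem_matchedInto, IsStart]
  cases h : m v with
  | none => simp
  | some r => cases r <;> simp

open Classical in
/-- The starts in the subsystem `i`. -/
noncomputable def startsIn (m : StateNode k n → Option (RightNode k n)) (i : Fin k) :
    Finset (Fin n) := Finset.univ.filter fun p => IsStart m (i, p)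

theorem mem_startsIn {i : Fin k} {p : Fin n} : p ∈ startsIn m i ↔ IsStart m (i, p) := by
  simp [startsIn]

open Classical in
/-- The nodes in the subsystem `i` that are matched inside of it. -/
noncomputable def innerIn (m : StateNode k n → Option (RightNode k n)) (i : Fin k) :
    Finset (Fin n) := Finset.univ.filter fun p => ∃ w, m (i, p) = some (.state w)

/-- Exchange between identical subsystems: drop the edges of `m` at the subsystem `j` and put there
a copy of the edges inside the subsystem `i`. The result is again a cheap matching into the states
and the input, hence not larger than `m`, so that `m` already matches at least that many nodes of
`j`; the remaining nodes of `j` are its starts. -/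
theorem Greedy.card_innerIn_le (hm : I.Greedy m) (i j : Fin k) :
    (innerIn m i).card + (startsIn m j).card ≤ n := by
  classical
  obtain ⟨D, hD⟩ := hm.cert
  let T₁ := (matchedInto m I.graph.right).filter fun v => v.1 ≠ j
  let T₂ := (innerIn m i).image fun p => (j, p)
  let ρ : StateNode k n → Option (RightNode k n) := fun v =>
    if v.1 = j then match m (i, v.2) with
      | some (.state w) => some (.state (j, w.2))
      | _ => none
    else m v
  have hmem : ∀ v ∈ T₁ ∪ T₂, ∃ r ∈ I.graph.right, ρ v = some r ∧ I.Low v r := by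
    intro v hv
    rcases Finset.mem_union.1 hv with hv | hv
    · obtain ⟨hv, hvj⟩ := Finset.mem_filter.1 hv
      obtain ⟨r, hr, hvr⟩ := mem_matchedInto.1 hv
      exact ⟨r, hr, by simp [ρ, hvj, hvr], hm.low hvr⟩
    · obtain ⟨p, hp, rfl⟩ := Finset.mem_image.1 hv
      obtain ⟨w, hw⟩ := (Finset.mem_filter.1 hp).2
      exact ⟨.state (j, w.2), by simp, by simp [ρ, hw], rfl, (hm.low hw).2⟩
  have hsub : ∀ {v w}, m v = some (.state w) → v.1 = w.1 := fun h => (hm.low h).1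
  have hρ : ∀ v, v.1 = j → ∀ r, ρ v = some r →
      ∃ q, m (i, v.2) = some (.state (i, q)) ∧ r = .state (j, q) := by
    intro v hv r hr
    simp only [ρ, hv, if_true] at hr
    split at hr
    · rename_i w hw
      have := hsub hw
      refine ⟨w.2, ?_, by simpa using hr.symm⟩
      rw [hw]
      congr 2
      exact Prod.ext this.symm rfl
    · simp at hr
  have hρ' : ∀ v, v.1 ≠ j → ρ v = m v := fun v hv => by simp [ρ, hv]
  have hinj : ∀ e ∈ T₁ ∪ T₂, ∀ e' ∈ T₁ ∪ T₂, ∀ r, ρ e = some r → ρ e' = some r → e = e' := by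
    intro v _ w _ r hv hw
    by_cases h : v.1 = j <;> by_cases h' : w.1 = j
    · obtain ⟨q, h1, h2⟩ := hρ v h r hv
      obtain ⟨q', h1', h2'⟩ := hρ w h' r hw
      rw [h2] at h2'
      obtain rfl : q = q' := by simpa using h2'
      have := hm.inj h1 h1'
      exact Prod.ext (h.trans h'.symm) (by simpa using this)
    · obtain ⟨q, h1, rfl⟩ := hρ v h r hv
      rw [hρ' w h'] at hw
      exact absurd (hsub hw) h'
    · obtain ⟨q, h1, rfl⟩ := hρ w h' r hw
      rw [hρ' v h] at hv
      exact absurd (hsub hv) h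
    · rw [hρ' v h] at hv
      rw [hρ' w h'] at hw
      exact hm.inj hv hw
  have hle := hD.card_le_matchedInto (T₁ ∪ T₂) id ρ Function.injective_id.injOn hinj hmem
  have hdisj : Disjoint T₁ T₂ := by
    rw [Finset.disjoint_left]
    intro v h h'
    obtain ⟨p, -, rfl⟩ := Finset.mem_image.1 h'
    exact (Finset.mem_filter.1 h).2 rfl
  rw [Finset.card_union_of_disjoint hdisj, Finset.card_image_of_injective _ (fun p q h => by
    simpa using h), ← Finset.card_filter_add_card_filter_not (s := matchedInto m I.graph.right)
      (fun v => v.1 ≠ j)] at hle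
  have hle' : (innerIn m i).card ≤
      ((matchedInto m I.graph.right).filter fun v => ¬ v.1 ≠ j).card := by
    simpa [T₁] using hle
  have : ((matchedInto m I.graph.right).filter fun v => ¬ v.1 ≠ j).card ≤
      (Finset.univ.filter fun p => p ∉ startsIn m j).card := by
    refine Finset.card_le_card_of_injOn Prod.snd ?_ ?_
    · rintro ⟨i', p⟩ hv
      obtain ⟨hv, hvj⟩ := Finset.mem_filter.1 hv
      obtain rfl : i' = j := by simpa using hvj
      simpa [mem_startsIn, isStart_iff (I := I)] using hv
    · rintro v hv w hw h
      have h1 := (Finset.mem_filter.1 hv).2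
      have h2 := (Finset.mem_filter.1 hw).2
      push Not at h1 h2
      exact Prod.ext (h1.trans h2.symm) h
  have hcomp := Finset.card_filter_add_card_filter_not (s := (Finset.univ : Finset (Fin n)))
    (fun p => p ∈ startsIn m j)
  simp only [Finset.filter_univ_mem, Finset.card_univ, Fintype.card_fin] at hcomp
  omega

/-- All subsystems have the same number of starts, except that there may be one less in the
subsystem in which the input is used. -/
theorem Greedy.card_startsIn (hm : I.Greedy m) {a : StateNode k n} (ha : m a = some .input) :
    ∃ d, (∀ i ≠ a.1, (startsIn m i).card = d) ∧
      ((startsIn m a.1).card = d ∨ (startsIn m a.1).card + 1 = d) := by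
  classical
  -- Away from the input every node is either matched inside or a start. In the subsystem of `a`
  -- there is one further node, `a` itself, which causes the possible defect of one.
  have h1 : ∀ i ≠ a.1, (innerIn m i).card + (startsIn m i).card = n := by
    intro i hi
    have h := Finset.card_filter_add_card_filter_not (s := (Finset.univ : Finset (Fin n)))
      (fun p => ∃ w, m (i, p) = some (.state w))
    rw [Finset.card_univ, Fintype.card_fin] at h
    refine Eq.trans ?_ h
    rw [innerIn, startsIn]
    congr 2
    ext p
    rw [Finset.mem_filter, Finset.mem_filter]
    simp only [Finset.mem_univ, true_and, IsStart]
    cases hp : m (i, p) with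
    | none => simp
    | some r =>
      cases r with
      | state w => simp
      | input => exact absurd (congrArg Prod.fst (hm.inj hp ha)) hi
      | scc S => simp
  have h2 : (innerIn m a.1).card + (startsIn m a.1).card + 1 = n := by
    have h := Finset.card_filter_add_card_filter_not (s := (Finset.univ : Finset (Fin n)))
      (fun p => ∃ w, m (a.1, p) = some (.state w))
    rw [Finset.card_univ, Fintype.card_fin] at h
    have hset : (Finset.univ.filter fun p => ¬ ∃ w, m (a.1, p) = some (.state w)) =
        insert a.2 (startsIn m a.1) := by
      ext p
      simp only [Finset.mem_filter, Finset.mem_univ, true_and, Finset.mem_insert, mem_startsIn,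
        IsStart]
      by_cases hpa : p = a.2
      · subst hpa; simp [ha]
      · cases hp : m (a.1, p) with
        | none => simp
        | some r =>
          cases r with
          | state w => simp [hpa]
          | input => exact absurd (congrArg Prod.snd (hm.inj hp ha)) hpa
          | scc S => simp
    rw [hset, Finset.card_insert_of_notMem (by simp [mem_startsIn, IsStart, ha])] at h
    refine Eq.trans ?_ h
    rw [innerIn, add_assoc]
  by_cases hk : ∃ i, i ≠ a.1
  -- The exchange inequality in both directions gives equality for two subsystems without the input,
  -- and equality up to one when the subsystem of `a` is involved.
  · obtain ⟨i, hi⟩ := hk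
    refine ⟨(startsIn m i).card, fun j hj => ?_, ?_⟩
    · have := hm.card_innerIn_le i j
      have := hm.card_innerIn_le j i
      have := h1 i hi
      have := h1 j hj
      omega
    · have := hm.card_innerIn_le i a.1
      have := hm.card_innerIn_le a.1 i
      have := h1 i hi
      omega
  · push Not at hk
    exact ⟨_, fun i hi => absurd (hk i) hi, Or.inl rfl⟩

/-- A structurally controllable single subsystem is matched completely. -/
theorem Greedy.not_isStart (hm : I.Greedy m) (hk : k = 1)
    (hI : IsStructurallyControllable I.fullMatrix I.B) (v : StateNode k n) : ¬ IsStart m v := by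
  classical
  subst hk
  obtain ⟨D, hD⟩ := hm.cert
  let toR : Option (StateNode 1 n) → RightNode 1 n := fun o => o.elim .input .state
  have htoR : Function.Injective toR := by
    intro o o' h
    cases o <;> cases o' <;> simp_all [toR]
  -- The rows without a neighbour in `D` have nonzero columns only outside `D`, so controllability
  -- bounds their number by `|R \ D|`. The other rows are matched into `D`. Together these bounds
  -- show that `m` matches every node.
  have h1 := hI.card_le (Finset.univ.filter fun v => ¬ ∃ r ∈ D, I.Low v r)
    (Finset.univ.filter fun o => toR o ∉ D)
    (fun v hv w hvw => by
      simp only [Finset.mem_filter, Finset.mem_univ, true_and] at hv ⊢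
      intro h
      refine hv ⟨_, h, Subsingleton.elim _ _, ?_⟩
      simpa [fullMatrix, Subsingleton.elim v.1 w.1] using hvw)
    (fun v hv hvb => by
      simp only [Finset.mem_filter, Finset.mem_univ, true_and] at hv ⊢
      intro h
      exact hv ⟨_, h, hvb⟩)
  have h2 : (Finset.univ.filter fun o => toR o ∉ D).card ≤ (I.graph.right \ D).card := by
    refine Finset.card_le_card_of_injOn toR ?_ htoR.injOn
    intro o ho
    have ho := (Finset.mem_filter.1 ho).2
    refine Finset.mem_coe.2 (Finset.mem_sdiff.2 ⟨?_, ho⟩)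
    cases o <;> simp [toR]
  have h3 : (Finset.univ.filter fun v => ∃ r ∈ D, I.Low v r).card ≤ (matchedInto m D).card := by
    refine Finset.card_le_card fun v hv => ?_
    obtain ⟨r, hr, hl⟩ := (Finset.mem_filter.1 hv).2
    exact mem_matchedInto.2 (hD.2.2 v r hr hl)
  have h4 := hD.card_le
  have h5 := Finset.card_filter_add_card_filter_not (s := (Finset.univ : Finset (StateNode 1 n)))
    (fun v => ∃ r ∈ D, I.Low v r)
  have h6 : matchedInto m I.graph.right = Finset.univ := by
    rw [← Finset.card_eq_iff_eq_univ]
    refine le_antisymm (Finset.card_le_univ _) ?_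
    rw [← Finset.card_univ]
    omega
  rw [isStart_iff (I := I), h6]
  simp

end

/-- With a single subsystem there are no interconnections, so the paths from the input that
controllability provides are internal. -/
theorem comps_eq_empty (hk : k = 1) (hI : IsStructurallyControllable I.fullMatrix I.B) :
    I.comps = ∅ := by
  subst hk
  refine Finset.eq_empty_of_forall_notMem fun S hS => ((I.mem_comps).1 hS).2 fun v _ => ?_
  obtain ⟨w, hw, hp⟩ := hI.reachable v
  refine ⟨w, hw, Relation.ReflTransGen.mono (fun a b h => Or.inl ?_) _ _ hp⟩
  exact ⟨Subsingleton.elim _ _, by simpa [fullMatrix, Subsingleton.elim b.1 a.1] using h⟩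

end CompositeSystem

/-! ## The order in which the paths of a greedy matching are linked -/

namespace CompositeSystem

variable {k n : ℕ} {I : CompositeSystem k n} {m : StateNode k n → Option (RightNode k n)}

/-- The state that `m` matches to `w`. -/
noncomputable def next (m : StateNode k n → Option (RightNode k n)) (w : StateNode k n) :
    Option (StateNode k n) := by
  classical exact if h : ∃ v, m v = some (.state w) then some h.choose else none

theorem Greedy.next_eq_some (hm : I.Greedy m) {v w : StateNode k n} :
    next m w = some v ↔ m v = some (.state w) := by
  rw [next]
  by_cases h : ∃ v, m v = some (.state w)
  · rw [dif_pos h, Option.some_inj]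
    exact ⟨fun h' => h' ▸ h.choose_spec, fun h' => hm.inj h.choose_spec h'⟩
  · rw [dif_neg h]
    simpa using fun h' => h ⟨v, h'⟩

theorem next_eq_none {w : StateNode k n} : next m w = none ↔ ∀ v, m v ≠ some (.state w) := by
  rw [next]
  by_cases h : ∃ v, m v = some (.state w)
  · rw [dif_pos h]
    obtain ⟨v, hv⟩ := h
    exact ⟨fun h => by simp at h, fun h => absurd hv (h v)⟩
  · rw [dif_neg h]
    exact ⟨fun _ v hv => h ⟨v, hv⟩, fun _ => rfl⟩

/-- One step along a path of the matching. -/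
noncomputable def pathStep (m : StateNode k n → Option (RightNode k n)) (w : StateNode k n) :
    StateNode k n := (next m w).getD w

/-- The last state of the path of the matching through `w`. -/
noncomputable def pathEnd (m : StateNode k n → Option (RightNode k n)) (w : StateNode k n) :
    StateNode k n := (pathStep m)^[k * n] w

/-- The first states of the paths: they are not matched inside their subsystem. -/
def IsPathHead (m : StateNode k n → Option (RightNode k n)) (v : StateNode k n) : Prop :=
  ∀ w, m v ≠ some (.state w)

theorem IsStart.isPathHead {v : StateNode k n} (h : IsStart m v) : IsPathHead m v := by
  intro w hw
  rcases h with h | ⟨S, h⟩ <;> simp [h] at hw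

/-- Follow the two walks backwards from the place where they meet: the predecessor of a state on a
path is its partner under `m`, hence unique, and a head has none. So both walks reach their heads at
the same time. -/
theorem Greedy.pathStep_inj (hm : I.Greedy m) {s s' : StateNode k n} (hs : IsPathHead m s)
    (hs' : IsPathHead m s') (i j : ℕ) (hi : ∀ i' < i, next m ((pathStep m)^[i'] s) ≠ none)
    (hj : ∀ j' < j, next m ((pathStep m)^[j'] s') ≠ none)
    (h : (pathStep m)^[i] s = (pathStep m)^[j] s') : i = j ∧ s = s' := by
  have key : ∀ {s : StateNode k n} {i : ℕ}, next m ((pathStep m)^[i] s) ≠ none →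
      m ((pathStep m)^[i + 1] s) = some (.state ((pathStep m)^[i] s)) := by
    intro s i h
    rw [Function.iterate_succ_apply', pathStep]
    obtain ⟨v, hv⟩ := Option.ne_none_iff_exists'.1 h
    rw [hv]
    exact hm.next_eq_some.1 hv
  induction i generalizing j with
  | zero =>
    cases j with
    | zero => exact ⟨rfl, h⟩
    | succ j =>
      have := key (hj j (by omega))
      rw [← h] at this
      exact absurd this (hs _)
  | succ i ih =>
    have h1 := key (hi i (by omega))
    cases j with
    | zero =>
      rw [h] at h1
      exact absurd h1 (hs' _)
    | succ j =>
      have h2 := key (hj j (by omega))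
      rw [← h, h1] at h2
      have := ih j (fun i' hi' => hi i' (by omega)) (fun j' hj' => hj j' (by omega))
        (by simpa using h2)
      exact ⟨by omega, this.2⟩

/-- A walk from a head repeats no state and therefore stops within `k * n` steps; from then on
`pathStep` is stationary, which makes the fixed number of iterations in `pathEnd` harmless. -/
theorem Greedy.next_pathEnd (hm : I.Greedy m) {s : StateNode k n} (hs : IsPathHead m s) :
    ∃ i, (∀ i' < i, next m ((pathStep m)^[i'] s) ≠ none) ∧ pathEnd m s = (pathStep m)^[i] s ∧
      next m (pathEnd m s) = none := by
  classical
  have hex : ∃ i ≤ k * n, next m ((pathStep m)^[i] s) = none := by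
    by_contra! h
    have := Finset.card_le_card_of_injOn (s := Finset.range (k * n + 1))
      (t := (Finset.univ : Finset (StateNode k n))) (fun i => (pathStep m)^[i] s) (by simp)
      (fun i hi j hj hij => (hm.pathStep_inj hs hs i j
        (fun i' hi' => h i' (by have := Finset.mem_range.1 hi; omega))
        (fun i' hi' => h i' (by have := Finset.mem_range.1 hj; omega)) hij).1)
    simp at this
  have hex' : ∃ i, next m ((pathStep m)^[i] s) = none := hex.imp fun _ h => h.2
  obtain ⟨i₁, h1, h1'⟩ := hex
  have hle : Nat.find hex' ≤ k * n := (Nat.find_min' hex' h1').trans h1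
  have hstay : ∀ j, (pathStep m)^[Nat.find hex' + j] s = (pathStep m)^[Nat.find hex'] s := by
    intro j
    induction j with
    | zero => rfl
    | succ j ih =>
      rw [← Nat.add_assoc, Function.iterate_succ_apply', ih, pathStep, Nat.find_spec hex']
      rfl
  have hend : pathEnd m s = (pathStep m)^[Nat.find hex'] s := by
    rw [pathEnd, ← hstay (k * n - Nat.find hex'), Nat.add_sub_cancel' hle]
  exact ⟨_, fun i' hi' => Nat.find_min hex' hi', hend, hend ▸ Nat.find_spec hex'⟩

theorem Greedy.pathEnd_inj (hm : I.Greedy m) {s s' : StateNode k n} (hs : IsPathHead m s)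
    (hs' : IsPathHead m s') (h : pathEnd m s = pathEnd m s') : s = s' := by
  obtain ⟨i, hi, he, -⟩ := hm.next_pathEnd hs
  obtain ⟨j, hj, he', -⟩ := hm.next_pathEnd hs'
  exact (hm.pathStep_inj hs hs' i j hi hj (he ▸ he' ▸ h)).2

/-- A matched pair `(v, state w)` is an internal edge from `w` to `v`, so the walk follows the edges
of the digraph. -/
theorem Greedy.inner_pathEnd (hm : I.Greedy m) (s : StateNode k n) :
    Relation.ReflTransGen I.Inner s (pathEnd m s) := by
  rw [pathEnd]
  generalize k * n = i
  induction i with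
  | zero => exact .refl
  | succ i ih =>
    rw [Function.iterate_succ_apply']
    generalize (pathStep m)^[i] s = w at ih ⊢
    rw [pathStep]
    cases h : next m w with
    | none => exact ih
    | some v =>
      have := hm.low (hm.next_eq_some.1 h)
      exact ih.tail ⟨this.1.symm, this.2⟩

theorem inner_star_fst {v w : StateNode k n} (h : Relation.ReflTransGen I.Inner v w) :
    v.1 = w.1 := by
  induction h with
  | refl => rfl
  | tail _ h ih => exact ih.trans h.1

/-! ### The round-robin order of the path heads -/

/-- The subsystem with the offset `o` from the successor of `t`, in cyclic order. -/
def rot (k t o : ℕ) : ℕ := if t + 1 + o < k then t + 1 + o else t + 1 + o - k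

/-- The offset of the subsystem `i` from the successor of `t`, in cyclic order. -/
def off (k t i : ℕ) : ℕ := if t < i then i - (t + 1) else i + k - (t + 1)

theorem rot_lt {t o : ℕ} (ht : t < k) (ho : o < k) : rot k t o < k := by
  unfold rot; split_ifs <;> omega
theorem off_lt {t i : ℕ} (ht : t < k) (hi : i < k) : off k t i < k := by
  unfold off; split_ifs <;> omega
theorem off_rot {t o : ℕ} (ht : t < k) (ho : o < k) : off k t (rot k t o) = o := by
  unfold off rot; split_ifs <;> omega
theorem rot_off {t i : ℕ} (ht : t < k) (hi : i < k) : rot k t (off k t i) = i := by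
  unfold off rot; split_ifs <;> omega
-- The subsystem of the input comes last in every round; a start that it lacks thus only shortens
-- the last round and leaves no gap.
theorem off_self {t : ℕ} : off k t t = k - 1 := by
  unfold off; split_ifs <;> omega

/-- The number of starts before `v` in the subsystem of `v`. -/
noncomputable def startRank (m : StateNode k n → Option (RightNode k n)) (v : StateNode k n) : ℕ :=
  ((startsIn m v.1).filter fun p => p < v.2).card

theorem startRank_lt_card {v : StateNode k n} (hv : IsStart m v) :
    startRank m v < (startsIn m v.1).card :=
  Finset.card_lt_card (Finset.filter_ssubset.2 ⟨v.2, mem_startsIn.2 hv, lt_irrefl _⟩)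

theorem startRank_lt {i : Fin k} {p q : Fin n} (hp : IsStart m (i, p)) (h : p < q) :
    startRank m (i, p) < startRank m (i, q) := by
  refine Finset.card_lt_card (Finset.ssubset_iff_of_subset ?_ |>.2 ⟨p, ?_, ?_⟩)
  · intro r hr
    obtain ⟨hr, hlt⟩ := Finset.mem_filter.1 hr
    exact Finset.mem_filter.2 ⟨hr, lt_trans hlt h⟩
  · exact Finset.mem_filter.2 ⟨mem_startsIn.2 hp, h⟩
  · simp

/-- The position of a path head: `0` for the path from the input; the others follow round by
round, each round visiting the subsystems in cyclic order. -/
noncomputable def pos (m : StateNode k n → Option (RightNode k n)) (a v : StateNode k n) : ℕ := by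
  classical exact if v = a then 0 else 1 + (startRank m v * k + off k a.1 v.1)

theorem pos_self (a : StateNode k n) : pos m a a = 0 := by simp [pos]

theorem IsStart.ne {a v : StateNode k n} (ha : m a = some .input) (hv : IsStart m v) : v ≠ a := by
  rintro rfl
  rcases hv with h | ⟨S, h⟩ <;> simp [h] at ha

theorem IsStart.pos_eq {a v : StateNode k n} (ha : m a = some .input) (hv : IsStart m v) :
    pos m a v = 1 + (startRank m v * k + off k a.1 v.1) := by
  simp [pos, hv.ne ha]

theorem mul_add_inj {k a b c d : ℕ} (hb : b < k) (hd : d < k) (h : a * k + b = c * k + d) :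
    a = c ∧ b = d := by
  have h1 := congrArg (· / k) h
  have h2 := congrArg (· % k) h
  have hk : 0 < k := by omega
  simp only [Nat.mul_comm _ k, Nat.mul_add_div hk, Nat.mul_add_mod, Nat.div_eq_of_lt hb,
    Nat.div_eq_of_lt hd, Nat.mod_eq_of_lt hb, Nat.mod_eq_of_lt hd] at h1 h2
  omega

theorem off_inj {t : ℕ} (ht : t < k) {i j : Fin k} (h : off k t i = off k t j) : i = j := by
  have := congrArg (rot k t) h
  rw [rot_off ht i.2, rot_off ht j.2] at this
  exact Fin.ext this

theorem pos_injOn {a : StateNode k n} (ha : m a = some .input) {v w : StateNode k n}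
    (hv : IsStart m v) (hw : IsStart m w) (h : pos m a v = pos m a w) : v = w := by
  rw [hv.pos_eq ha, hw.pos_eq ha] at h
  obtain ⟨h1, h2⟩ := mul_add_inj (off_lt a.1.2 v.1.2) (off_lt a.1.2 w.1.2) (Nat.add_left_cancel h)
  have h2 := off_inj a.1.2 h2
  obtain ⟨i, p⟩ := v
  obtain ⟨j, q⟩ := w
  obtain rfl : i = j := h2
  rcases lt_trichotomy p q with hpq | rfl | hpq
  · have := startRank_lt hv hpq; omega
  · rfl
  · have := startRank_lt hw hpq; omega

open Classical in
/-- The number of starts. -/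
noncomputable def numStarts (m : StateNode k n → Option (RightNode k n)) : ℕ :=
  (Finset.univ.filter (IsStart m)).card

theorem numStarts_eq_sum : numStarts m = ∑ i, (startsIn m i).card := by
  classical
  rw [numStarts, Finset.card_eq_sum_card_fiberwise (f := Prod.fst) (t := Finset.univ) (by simp)]
  refine Finset.sum_congr rfl fun i _ => ?_
  rw [← Finset.card_image_of_injective (startsIn m i) (f := fun p => (i, p)) (fun p q h => by
    simpa using h)]
  congr 1
  ext ⟨j, p⟩
  simp only [Finset.mem_filter, Finset.mem_univ, true_and, Finset.mem_image, mem_startsIn,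
    Prod.mk.injEq]
  constructor
  · rintro ⟨h, rfl⟩; exact ⟨p, h, rfl, rfl⟩
  · rintro ⟨q, h, rfl, rfl⟩; exact ⟨h, rfl⟩

theorem Greedy.numStarts_eq (hm : I.Greedy m) {a : StateNode k n} (ha : m a = some .input) :
    ∃ d, (∀ i ≠ a.1, (startsIn m i).card = d) ∧
      ((startsIn m a.1).card = d ∨ (startsIn m a.1).card + 1 = d) ∧
      numStarts m = (k - 1) * d + (startsIn m a.1).card := by
  obtain ⟨d, h1, h2⟩ := hm.card_startsIn ha
  refine ⟨d, h1, h2, ?_⟩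
  rw [numStarts_eq_sum, ← Finset.sum_erase_add _ _ (Finset.mem_univ a.1),
    Finset.sum_congr rfl (g := fun _ => d) (fun i hi => h1 i (Finset.ne_of_mem_erase hi)),
    Finset.sum_const, Finset.card_erase_of_mem (Finset.mem_univ _)]
  simp

/-- All rounds are full, except that the last one may lack the subsystem of `a`, which would be its
final entry. Hence no position exceeds the number of starts. -/
theorem Greedy.pos_le (hm : I.Greedy m) {a : StateNode k n} (ha : m a = some .input)
    {v : StateNode k n} (hv : IsStart m v) : pos m a v ≤ numStarts m := by
  obtain ⟨d, h1, h2, h3⟩ := hm.numStarts_eq ha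
  have hr := startRank_lt_card hv
  have hk : 0 < k := a.1.pos
  rw [hv.pos_eq ha, h3]
  obtain ⟨k, rfl⟩ : ∃ k', k = k' + 1 := ⟨k - 1, by omega⟩
  simp only [Nat.add_sub_cancel]
  by_cases hva : v.1 = a.1
  · rw [hva, off_self, Nat.add_sub_cancel]
    rw [hva] at hr
    have hle : (startsIn m a.1).card ≤ d := by omega
    have : (startRank m v + 1) * (k + 1) ≤ (startsIn m a.1).card * (k + 1) :=
      Nat.mul_le_mul_right _ hr
    have : k * (startsIn m a.1).card ≤ k * d := Nat.mul_le_mul_left _ hle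
    nlinarith
  · rw [h1 _ hva] at hr
    have hlt : off (k + 1) a.1 v.1 < k := by
      have h := off_lt a.1.2 v.1.2
      have h' : off (k + 1) a.1 v.1 ≠ off (k + 1) a.1 a.1 := fun h => hva (off_inj a.1.2 h)
      rw [off_self] at h'
      omega
    have : (startRank m v + 1) * (k + 1) ≤ d * (k + 1) := Nat.mul_le_mul_right _ hr
    have : d ≤ (startsIn m a.1).card + 1 := by omega
    nlinarith

/-- Positions are injective on the starts and lie in an interval with as many elements, so every
position is taken. -/
theorem Greedy.exists_pos (hm : I.Greedy m) {a : StateNode k n} (ha : m a = some .input) {c : ℕ}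
    (hc : c < numStarts m) : ∃ v, IsStart m v ∧ pos m a v = c + 1 := by
  classical
  have himg : (Finset.univ.filter (IsStart m)).image (pos m a) = Finset.Icc 1 (numStarts m) := by
    refine Finset.eq_of_subset_of_card_le ?_ ?_
    · intro c hc
      obtain ⟨v, hv, rfl⟩ := Finset.mem_image.1 hc
      have hv := (Finset.mem_filter.1 hv).2
      refine Finset.mem_Icc.2 ⟨?_, hm.pos_le ha hv⟩
      rw [hv.pos_eq ha]
      omega
    · rw [Finset.card_image_of_injOn (fun v hv w hw h => pos_injOn ha (Finset.mem_filter.1 hv).2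
        (Finset.mem_filter.1 hw).2 h)]
      simp [numStarts]
  have : c + 1 ∈ Finset.Icc 1 (numStarts m) := Finset.mem_Icc.2 ⟨by omega, hc⟩
  rw [← himg] at this
  obtain ⟨v, hv, h⟩ := Finset.mem_image.1 this
  exact ⟨v, (Finset.mem_filter.1 hv).2, h⟩

/-- Every start is linked to the end of the path that precedes it. -/
def IsLinking (m : StateNode k n → Option (RightNode k n)) (a : StateNode k n)
    (link : StateNode k n → StateNode k n) : Prop :=
  ∀ v, IsStart m v → ∃ s, (s = a ∨ IsStart m s) ∧ pos m a s + 1 = pos m a v ∧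
    link v = pathEnd m s

/-- Consecutive paths are in different subsystems. -/
theorem fst_ne_of_pos {a s v : StateNode k n} (hk : k ≠ 1) (ha : m a = some .input)
    (hs : s = a ∨ IsStart m s) (hv : IsStart m v) (h : pos m a s + 1 = pos m a v) :
    s.1 ≠ v.1 := by
  intro hsv
  have hk0 : 0 < k := a.1.pos
  rw [hv.pos_eq ha] at h
  -- The input path is followed by the offset `0`, while its own subsystem has the offset `k - 1`,
  -- which is nonzero. For two starts, positions in one subsystem agree modulo `k`, so they are not
  -- consecutive.
  rcases hs with rfl | hs
  · rw [pos_self, ← hsv, off_self] at h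
    omega
  · rw [hs.pos_eq ha, hsv] at h
    have hlt := off_lt a.1.2 v.1.2
    rcases Nat.lt_or_ge (off k a.1 v.1 + 1) k with h' | h'
    · have := (mul_add_inj h' hlt (by omega : startRank m s * k + (off k a.1 v.1 + 1) =
        startRank m v * k + off k a.1 v.1)).2
      omega
    · have h0 : off k a.1 v.1 + 1 = k := by omega
      have := (mul_add_inj hk0 hlt (by rw [Nat.add_mul]; omega :
        (startRank m s + 1) * k + 0 = startRank m v * k + off k a.1 v.1)).2
      omega

end CompositeSystem

/-! ## Completing a greedy matching by the links -/

namespace CompositeSystem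

variable {k n : ℕ} {I : CompositeSystem k n} {m : StateNode k n → Option (RightNode k n)}
  {a : StateNode k n} {link : StateNode k n → StateNode k n}

/-- The right-hand partner in the completed matching `M*`. -/
def starMate (m : StateNode k n → Option (RightNode k n)) (link : StateNode k n → StateNode k n)
    (v : StateNode k n) : RightNode k n := (m v).getD (.state (link v))

open Classical in
/-- The right-hand partner in the matching `M̃`. -/
noncomputable def tildeMate (m : StateNode k n → Option (RightNode k n))
    (link : StateNode k n → StateNode k n) (v : StateNode k n) : RightNode k n :=
  if IsStart m v then .state (link v) else starMate m link v

/-- The set of edges given by a choice of partners. -/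
def graphOf (φ : StateNode k n → RightNode k n) : Finset (BipEdge k n) :=
  Finset.univ.image fun v => (v, φ v)

@[simp] theorem mem_graphOf {φ : StateNode k n → RightNode k n} {e : BipEdge k n} :
    e ∈ graphOf φ ↔ φ e.1 = e.2 := by
  obtain ⟨v, r⟩ := e
  simp only [graphOf, Finset.mem_image, Finset.mem_univ, true_and, Prod.mk.injEq]
  exact ⟨fun ⟨w, hw, h⟩ => hw ▸ h, fun h => ⟨v, rfl, h⟩⟩

theorem card_graphOf (φ : StateNode k n → RightNode k n) : (graphOf φ).card = k * n := by
  rw [graphOf, Finset.card_image_of_injective _ (fun v w h => congrArg Prod.fst h)]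
  simp

theorem starMate_of_some {v : StateNode k n} {r : RightNode k n} (h : m v = some r) :
    starMate m link v = r := by simp [starMate, h]

theorem starMate_of_none {v : StateNode k n} (h : m v = none) :
    starMate m link v = .state (link v) := by simp [starMate, h]

theorem tildeMate_of_isStart {v : StateNode k n} (h : IsStart m v) :
    tildeMate m link v = .state (link v) := by simp [tildeMate, h]

theorem tildeMate_of_not_isStart {v : StateNode k n} (h : ¬ IsStart m v) :
    tildeMate m link v = starMate m link v := by simp [tildeMate, h]

theorem Low.cost_le_one {v : StateNode k n} {r : RightNode k n} (h : I.Low v r)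
    (hr : r ∈ I.graph.right) : cost (v, r) ≤ 1 := by
  cases r with
  | state w => simp [cost, h.1]
  | input => simp [cost]
  | scc S => simp at hr

/-- A greedy matching in which the input is matched to `a`, together with a linking of its paths;
when there is only one subsystem, nothing has to be linked. -/
structure Plan (I : CompositeSystem k n) (m : StateNode k n → Option (RightNode k n))
    (a : StateNode k n) (link : StateNode k n → StateNode k n) : Prop where
  greedy : I.Greedy m
  input : m a = some .input
  linking : IsLinking m a link
  ne_one : ∀ v, IsStart m v → k ≠ 1

namespace Plan

/-- A path never leaves its subsystem, and the heads of consecutive paths are in different ones; a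
link is therefore an interconnection. -/
theorem link_fst_ne (P : I.Plan m a link) {v : StateNode k n} (hv : IsStart m v) :
    v.1 ≠ (link v).1 := by
  obtain ⟨s, hs, hp, h⟩ := P.linking v hv
  rw [h, ← inner_star_fst (P.greedy.inner_pathEnd s)]
  exact (fst_ne_of_pos (P.ne_one v hv) P.input hs hv hp).symm

theorem isPathHead (P : I.Plan m a link) {s : StateNode k n} (hs : s = a ∨ IsStart m s) :
    IsPathHead m s := by
  rcases hs with rfl | hs
  · intro w hw; simp [P.input] at hw
  · exact hs.isPathHead

/-- The end of a path has no successor, so its right-hand copy is unmatched and available. -/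
theorem link_free (P : I.Plan m a link) {v : StateNode k n} (hv : IsStart m v) (w : StateNode k n) :
    m w ≠ some (.state (link v)) := by
  obtain ⟨s, hs, -, h⟩ := P.linking v hv
  obtain ⟨-, -, -, h'⟩ := P.greedy.next_pathEnd (P.isPathHead hs)
  exact next_eq_none.1 (h ▸ h') w

theorem link_inj (P : I.Plan m a link) {v w : StateNode k n} (hv : IsStart m v) (hw : IsStart m w)
    (h : link v = link w) : v = w := by
  obtain ⟨s, hs, hp, hl⟩ := P.linking v hv
  obtain ⟨s', hs', hp', hl'⟩ := P.linking w hw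
  have := P.greedy.pathEnd_inj (P.isPathHead hs) (P.isPathHead hs') (hl ▸ hl' ▸ h)
  subst this
  exact pos_injOn P.input hv hw (hp ▸ hp')

theorem starMate_injective (P : I.Plan m a link) : Function.Injective (starMate m link) := by
  intro v w h
  cases hv : m v with
  | none =>
    rw [starMate_of_none hv] at h
    cases hw : m w with
    | none =>
      rw [starMate_of_none hw] at h
      exact P.link_inj (Or.inl hv) (Or.inl hw) (by simpa using h)
    | some r =>
      rw [starMate_of_some hw] at h
      exact absurd (h ▸ hw) (P.link_free (Or.inl hv) w)
  | some r =>
    rw [starMate_of_some hv] at h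
    cases hw : m w with
    | none =>
      rw [starMate_of_none hw] at h
      exact absurd (h ▸ hv) (P.link_free (Or.inl hw) v)
    | some r' =>
      rw [starMate_of_some hw] at h
      exact P.greedy.inj hv (h ▸ hw)

theorem exists_of_not_isStart (_ : I.Plan m a link) {v : StateNode k n} (hv : ¬ IsStart m v) :
    ∃ r ∈ I.graph.right, m v = some r := by
  simpa [isStart_iff (I := I), mem_matchedInto] using hv

theorem tildeMate_injective (P : I.Plan m a link) : Function.Injective (tildeMate m link) := by
  have key : ∀ {v w}, IsStart m v → ¬ IsStart m w → tildeMate m link v ≠ tildeMate m link w := by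
    intro v w hv hw h
    obtain ⟨r, -, hr⟩ := P.exists_of_not_isStart hw
    rw [tildeMate_of_isStart hv, tildeMate_of_not_isStart hw, starMate_of_some hr] at h
    exact P.link_free hv w (h ▸ hr)
  intro v w h
  by_cases hv : IsStart m v <;> by_cases hw : IsStart m w
  · rw [tildeMate_of_isStart hv, tildeMate_of_isStart hw] at h
    exact P.link_inj hv hw (by simpa using h)
  · exact absurd h (key hv hw)
  · exact absurd h.symm (key hw hv)
  · rw [tildeMate_of_not_isStart hv, tildeMate_of_not_isStart hw] at h
    exact P.starMate_injective h

theorem starMate_mem (P : I.Plan m a link) (v : StateNode k n) :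
    (v, starMate m link v) ∈ I.graphN.edges := by
  rw [mem_edgesN]
  cases hv : m v with
  | none => simp [starMate_of_none hv, BipAdj, P.link_fst_ne (Or.inl hv)]
  | some r =>
    rw [starMate_of_some hv]
    have := P.greedy.low hv
    exact ⟨this.mem_rightN, (I.low_iff.1 this).1⟩

theorem tildeMate_mem (P : I.Plan m a link) (v : StateNode k n) :
    (v, tildeMate m link v) ∈ I.graph.edges := by
  rw [mem_edges]
  by_cases hv : IsStart m v
  · simp [tildeMate_of_isStart hv, BipAdj, P.link_fst_ne hv]
  · obtain ⟨r, hr, hvr⟩ := P.exists_of_not_isStart hv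
    rw [tildeMate_of_not_isStart hv, starMate_of_some hvr]
    exact ⟨hr, (I.low_iff.1 (P.greedy.low hvr)).1⟩

theorem isMinCostPerfectMatching (P : I.Plan m a link) :
    I.graphN.IsMinCostPerfectMatching cost (graphOf (starMate m link)) := by
  refine P.greedy.isMinCostPerfectMatching ⟨⟨?_, ?_⟩, ?_⟩ fun v r h => ?_
  · rintro ⟨v, r⟩ he
    obtain rfl : starMate m link v = r := mem_graphOf.1 he
    exact P.starMate_mem v
  · intro e he f hf hne
    rw [mem_graphOf] at he hf
    refine ⟨fun h => hne (Prod.ext h ?_), fun h => hne (Prod.ext ?_ h)⟩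
    · rw [← he, ← hf, h]
    · rw [← he, ← hf] at h
      exact P.starMate_injective h
  · rw [card_graphOf]
    have h1 : I.graphN.left.card = k * n := by simp [graphN]
    have h2 := Finset.card_le_card I.right_subset
    rw [card_right] at h2
    -- The left-hand side is the smaller one, because the right-hand side contains the input in
    -- addition to all states.
    rw [h1, Nat.min_eq_left (by omega)]
  · rw [mem_graphOf]
    exact starMate_of_some h

/-- In `M*` a start has an edge of cost 2 or 3 and every other node one of cost 0 or 1. Hence `M'`
consists exactly of the edges at the nodes that are not starts. -/
theorem mem_restrict (P : I.Plan m a link) {e : BipEdge k n} :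
    e ∈ restrict (graphOf (starMate m link)) ↔ ¬ IsStart m e.1 ∧ tildeMate m link e.1 = e.2 := by
  obtain ⟨v, r⟩ := e
  simp only [restrict, Finset.mem_filter, mem_graphOf]
  constructor
  · rintro ⟨rfl, hc⟩
    have hv : ¬ IsStart m v := by
      rintro (h | ⟨S, h⟩)
      · rw [starMate_of_none h] at hc
        simp [cost, P.link_fst_ne (Or.inl h)] at hc
      · rw [starMate_of_some h] at hc
        simp [cost] at hc
    exact ⟨hv, tildeMate_of_not_isStart hv⟩
  · rintro ⟨hv, rfl⟩
    obtain ⟨r, hr, hvr⟩ := P.exists_of_not_isStart hv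
    rw [tildeMate_of_not_isStart hv]
    refine ⟨rfl, ?_⟩
    rw [starMate_of_some hvr]
    exact (P.greedy.low hvr).cost_le_one hr

open Classical in
/-- The matching `M''`. -/
noncomputable def linkEdges (m : StateNode k n → Option (RightNode k n))
    (link : StateNode k n → StateNode k n) : Finset (BipEdge k n) :=
  (graphOf (tildeMate m link)).filter fun e => IsStart m e.1

open Classical in
theorem restrict_union (P : I.Plan m a link) :
    restrict (graphOf (starMate m link)) ∪ linkEdges m link = graphOf (tildeMate m link) := by
  ext e
  rw [Finset.mem_union, P.mem_restrict, linkEdges, Finset.mem_filter, mem_graphOf]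
  by_cases h : IsStart m e.1 <;> simp [h]

/-- After the deletion of the nodes met by `M'` the left-hand side consists of the starts, and the
links match all of them, including those that `M*` matches with components. -/
theorem isPerfectMatching_linkEdges (P : I.Plan m a link) :
    (I.graph.diff (restrict (graphOf (starMate m link)))).IsPerfectMatching
      (linkEdges m link) := by
  classical
  have hdisj : Disjoint (restrict (graphOf (starMate m link))) (linkEdges m link) := by
    rw [Finset.disjoint_left]
    intro e he he'
    exact (P.mem_restrict.1 he).1 (Finset.mem_filter.1 he').2
  have hcard := congrArg Finset.card P.restrict_union
  rw [Finset.card_union_of_disjoint hdisj, card_graphOf] at hcard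
  have hedge : ∀ e ∈ linkEdges m link, IsStart m e.1 ∧ tildeMate m link e.1 = e.2 := fun e he =>
    ⟨(Finset.mem_filter.1 he).2, mem_graphOf.1 (Finset.mem_filter.1 he).1⟩
  refine ⟨⟨fun e he => ?_, fun e he f hf hne => ?_⟩, ?_⟩
  · obtain ⟨hs, ht⟩ := hedge e he
    refine Finset.mem_filter.2 ⟨?_, ?_, ?_⟩
    · obtain ⟨v, r⟩ := e
      obtain rfl : tildeMate m link v = r := ht
      exact P.tildeMate_mem v
    · intro h
      obtain ⟨f, hf, hfe⟩ := Finset.mem_image.1 h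
      exact (P.mem_restrict.1 hf).1 (hfe ▸ hs)
    · intro h
      obtain ⟨f, hf, hfe⟩ := Finset.mem_image.1 h
      obtain ⟨hf1, hf2⟩ := P.mem_restrict.1 hf
      rw [hfe, ← ht] at hf2
      exact hf1 (P.tildeMate_injective hf2 ▸ hs)
  · obtain ⟨hs, ht⟩ := hedge e he
    obtain ⟨hs', ht'⟩ := hedge f hf
    refine ⟨fun h => hne (Prod.ext h ?_), fun h => hne (Prod.ext ?_ h)⟩
    · rw [← ht, ← ht', h]
    · rw [← ht, ← ht'] at h
      exact P.tildeMate_injective h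
  · have hl : (I.graph.diff (restrict (graphOf (starMate m link)))).left.card =
        k * n - (restrict (graphOf (starMate m link))).card := by
      change (Finset.univ \ _).card = _
      rw [Finset.card_sdiff_of_subset (Finset.subset_univ _), Finset.card_image_of_injOn]
      · simp
      · intro e he f hf h
        have he := (P.mem_restrict.1 he).2
        have hf := (P.mem_restrict.1 hf).2
        exact Prod.ext h (by rw [← he, ← hf, h])
    -- The right-hand side loses at most one node for each edge of `M'`, so it stays larger than the
    -- left-hand side.
    have hr : k * n + 1 - (restrict (graphOf (starMate m link))).card ≤
        (I.graph.diff (restrict (graphOf (starMate m link)))).right.card := by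
      rw [← I.card_right]
      exact (Nat.sub_le_sub_left Finset.card_image_le _).trans (Finset.le_card_sdiff _ _)
    rw [Nat.min_eq_left (by omega), hl]
    omega

/-- Induction along the chain of paths: when the preceding head is accessible, so is the end of its
path, and the link leads from there to `s`. The set `F` is arbitrary above the links, so that added
interconnections are covered. -/
theorem accessible_pathHead (P : I.Plan m a link) {F : Set (StateNode k n × StateNode k n)}
    (hF : inter (graphOf (tildeMate m link)) ⊆ F) {s : StateNode k n}
    (hs : s = a ∨ IsStart m s) : I.Accessible F s := by
  induction hp : pos m a s using Nat.strong_induction_on generalizing s with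
  | _ p ih =>
    rcases hs with rfl | hs
    · exact ⟨s, P.greedy.low P.input, .refl⟩
    · obtain ⟨u, hu, hpu, hl⟩ := P.linking s hs
      have h := (ih _ (by omega) hu rfl).inner_star I (P.greedy.inner_pathEnd u)
      refine h.edge I (hF ⟨?_, ?_⟩)
      · rw [← hl]; exact (P.link_fst_ne hs).symm
      · rw [mem_graphOf, ← hl]
        exact tildeMate_of_isStart hs

theorem isStart_of_mem_inter (P : I.Plan m a link) {f : StateNode k n × StateNode k n}
    (hf : f ∈ inter (graphOf (tildeMate m link))) : IsStart m f.2 := by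
  by_contra hs
  obtain ⟨h1, h2⟩ := hf
  obtain ⟨r, -, hr⟩ := P.exists_of_not_isStart hs
  rw [mem_graphOf, tildeMate_of_not_isStart hs, starMate_of_some hr] at h2
  have := P.greedy.low hr
  rw [show r = .state f.1 from h2] at this
  exact h1 this.1.symm

/-- Only starts are matched by interconnections, and all starts are accessible. Thus the `while`
loop is over before its first pass. -/
theorem not_pending (P : I.Plan m a link) (v : StateNode k n) :
    ¬ I.Pending (graphOf (tildeMate m link)) v := by
  intro h
  have h' := h.not_accessible I
  obtain ⟨⟨w, hw, hvw⟩, -⟩ := h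
  exact h' (P.accessible_pathHead le_rfl (Or.inr
    (P.isStart_of_mem_inter (f := (w, v)) ⟨hw, hvw⟩)))

end Plan

/-! ## The interconnections added for accessibility -/

variable (I) in
open Classical in
/-- The strongly connected component of a state in its subsystem. -/
noncomputable def component (v : StateNode k n) : Finset (StateNode k n) :=
  Finset.univ.filter fun w => Relation.ReflTransGen I.Inner v w ∧ Relation.ReflTransGen I.Inner w v

theorem mem_component {v w : StateNode k n} : w ∈ I.component v ↔
    Relation.ReflTransGen I.Inner v w ∧ Relation.ReflTransGen I.Inner w v := by
  simp [component]

theorem self_mem_component (v : StateNode k n) : v ∈ I.component v :=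
  mem_component.2 ⟨.refl, .refl⟩

theorem isSCC_component (v : StateNode k n) : I.IsSCC (I.component v) :=
  ⟨v, fun _ => mem_component⟩

theorem component_eq {v w : StateNode k n} (h : w ∈ I.component v) :
    I.component w = I.component v := by
  obtain ⟨h1, h2⟩ := mem_component.1 h
  ext u
  simp only [mem_component]
  exact ⟨fun h => ⟨h1.trans h.1, h.2.trans h2⟩, fun h => ⟨h2.trans h.1, h.2.trans h1⟩⟩

theorem IsSCC.eq_component {S : Finset (StateNode k n)} (hS : I.IsSCC S) {v : StateNode k n}
    (hv : v ∈ S) : S = I.component v := by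
  obtain ⟨u, hu⟩ := hS
  have : S = I.component u := by
    ext w
    rw [hu, mem_component]
  rw [this] at hv ⊢
  exact (component_eq hv).symm

theorem index_inj {v w : StateNode k n} (h : v.index = w.index) : v = w := by
  obtain ⟨h1, h2⟩ := mul_add_inj v.2.2 w.2.2 h
  exact Prod.ext (Fin.ext h1) (Fin.ext h2)

theorem index_lt (v : StateNode k n) : v.index < k * n := by
  have h1 := v.1.2
  have h2 := v.2.2
  have : (v.1.1 + 1) * n ≤ k * n := Nat.mul_le_mul_right _ h1
  rw [Nat.add_mul] at this
  rw [StateNode.index]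
  omega

theorem exists_index {i : ℕ} (hi : i < k * n) : ∃ v : StateNode k n, v.index = i := by
  have hn : 0 < n := Nat.pos_of_mul_pos_left (Nat.zero_lt_of_lt hi)
  refine ⟨(⟨i / n, (Nat.div_lt_iff_lt_mul hn).2 hi⟩, ⟨i % n, Nat.mod_lt _ hn⟩), ?_⟩
  simpa [StateNode.index, Nat.mul_comm] using Nat.div_add_mod i n

variable (I) in
/-- `v` is the first state of a component in `𝒩` that contains no start. -/
def NeedsEdge (m : StateNode k n → Option (RightNode k n)) (v : StateNode k n) : Prop :=
  I.component v ∈ I.comps ∧ (∀ w ∈ I.component v, v.index ≤ w.index) ∧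
    ∀ w ∈ I.component v, ¬ IsStart m w

/-- The source of the interconnection that is added for the component of `v`. -/
def extraSource (a v : StateNode k n) : StateNode k n :=
  if v.1 = a.1 then (⟨rot k a.1 0, rot_lt a.1.2 a.1.pos⟩, v.2) else a

/-- The place of a state when the subsystem of `a` comes last. -/
def place (a v : StateNode k n) : ℕ := off k a.1 v.1 * n + v.2

theorem place_inj {a v w : StateNode k n} (h : place a v = place a w) : v = w := by
  obtain ⟨h1, h2⟩ := mul_add_inj v.2.2 w.2.2 h
  exact Prod.ext (off_inj a.1.2 h1) (Fin.ext h2)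

variable (I) in
/-- The list `L` of extra interconnections is correct for all states with places below `q`. -/
structure ExtraList (m : StateNode k n → Option (RightNode k n)) (a : StateNode k n)
    (F : Set (StateNode k n × StateNode k n)) (q : ℕ)
    (L : List (StateNode k n × StateNode k n)) : Prop where
  step : ∀ (j : ℕ) (h : j < L.length), I.ExtraEdge (F ∪ {f | f ∈ L.take j}) L[j]
  mem : ∀ f ∈ L, ∃ v, I.NeedsEdge m v ∧ place a v < q ∧ f = (extraSource a v, v)
  all : ∀ v, I.NeedsEdge m v → place a v < q → (extraSource a v, v) ∈ L

theorem ExtraList.nil {F : Set (StateNode k n × StateNode k n)} : I.ExtraList m a F 0 [] :=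
  ⟨by simp, by simp, by simp⟩

theorem ExtraList.skip {F : Set (StateNode k n × StateNode k n)} {q : ℕ}
    {L : List (StateNode k n × StateNode k n)} (h : I.ExtraList m a F q L)
    (hq : ∀ v, place a v = q → ¬ I.NeedsEdge m v) : I.ExtraList m a F (q + 1) L := by
  refine ⟨h.step, fun f hf => ?_, fun v hv hlt => h.all v hv ?_⟩
  · obtain ⟨v, h1, h2, h3⟩ := h.mem f hf
    exact ⟨v, h1, by omega, h3⟩
  · have : place a v ≠ q := fun h => hq v h hv
    omega

/-- A component in `𝒩` that no interconnection enters is not accessible. -/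
theorem not_accessible_of_comps {S : Finset (StateNode k n)} (hS : S ∈ I.comps)
    {F : Set (StateNode k n × StateNode k n)} (hF : ∀ f ∈ F, f.2 ∉ S) {v : StateNode k n}
    (hv : v ∈ S) : ¬ I.Accessible F v := by
  obtain ⟨⟨h1, h2⟩, h3⟩ := I.mem_comps.1 hS
  intro h
  -- The complement of `S` contains the input states, since otherwise `S` would be accessible
  -- without interconnections, and no edge leads out of the complement into `S`.
  refine Accessible.induction I (p := fun v => v ∉ S) (fun w hw hwS => ?_)
    (fun v w _ hv hvw hw => h2 v w hv hw hvw) (fun v w _ _ hvw => hF _ hvw) h hv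
  exact h3 (h1.accessibleSet I hwS ⟨w, hw, .refl⟩)

variable (I) in
/-- The part of a state digraph that is carried from one subsystem to another. -/
theorem inner_star_translate {i j : Fin k} {p q : Fin n}
    (h : Relation.ReflTransGen I.Inner (i, p) (i, q)) :
    Relation.ReflTransGen I.Inner (j, p) (j, q) :=
  Relation.ReflTransGen.lift (fun v : StateNode k n => ((j, v.2) : StateNode k n))
    (fun _ _ h => ⟨rfl, h.2⟩) (i, p) (i, q) h

/-- The state digraphs are copies of one another, and the property depends on the internal edges
only; membership in `𝒩`, in contrast, is not translated, as the input edges may differ. -/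
theorem IsNonTopLinkedSCC.translate {i j : Fin k} {p : Fin n}
    (h : I.IsNonTopLinkedSCC (I.component (i, p))) : I.IsNonTopLinkedSCC (I.component (j, p)) := by
  refine ⟨isSCC_component _, ?_⟩
  rintro ⟨j₁, q₁⟩ ⟨j₂, q₂⟩ h1 h2 h3
  obtain ⟨h4, h5⟩ := mem_component.1 h2
  obtain rfl : j = j₂ := inner_star_fst h4
  obtain rfl : j₁ = j := h3.1
  refine h.2 (i, q₁) (i, q₂) (fun h' => h1 ?_) ?_ ⟨rfl, h3.2⟩
  · obtain ⟨h6, h7⟩ := mem_component.1 h'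
    exact mem_component.2 ⟨inner_star_translate I h6, inner_star_translate I h7⟩
  · exact mem_component.2 ⟨inner_star_translate I h4, inner_star_translate I h5⟩

theorem exists_first (v : StateNode k n) :
    ∃ u, I.component u = I.component v ∧ ∀ w ∈ I.component u, u.index ≤ w.index := by
  obtain ⟨u, hu, hmin⟩ := Finset.exists_min_image (I.component v) StateNode.index
    ⟨v, self_mem_component v⟩
  exact ⟨u, component_eq hu, component_eq hu ▸ hmin⟩

namespace Plan

/-- The source must be accessible and in another subsystem. Outside the subsystem of `a`, the state
`a` itself serves. Inside it, the copy of `v` in the next subsystem is used; as the subsystem of `a`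
is treated last, the component of that copy has already been dealt with. -/
theorem extraList_append (P : I.Plan m a link) (hk : I.comps.Nonempty → k ≠ 1) {q : ℕ}
    {L : List (StateNode k n × StateNode k n)}
    (h : I.ExtraList m a (inter (graphOf (tildeMate m link))) q L) {v : StateNode k n}
    (hv : I.NeedsEdge m v) (hq : place a v = q) :
    I.ExtraList m a (inter (graphOf (tildeMate m link))) (q + 1)
      (L ++ [(extraSource a v, v)]) := by
  have hk1 := hk ⟨_, hv.1⟩
  have hk0 : 0 < k := a.1.pos
  -- The next subsystem has the offset `0` and that of `a` the offset `k - 1`; they differ because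
  -- `k ≠ 1`.
  have hrot : rot k a.1 0 ≠ a.1 := fun h => by
    have := off_rot a.1.2 hk0
    rw [h, off_self] at this
    omega
  have hacc : ∀ {s}, s = a ∨ IsStart m s →
      I.Accessible (inter (graphOf (tildeMate m link)) ∪ {f | f ∈ L}) s :=
    fun hs => P.accessible_pathHead Set.subset_union_left hs
  have hnew : I.ExtraEdge (inter (graphOf (tildeMate m link)) ∪ {f | f ∈ L})
      (extraSource a v, v) := by
    refine ⟨?_, ?_, I.component v, hv.1, self_mem_component v, fun h' => ?_⟩
    · rw [extraSource]
      split_ifs with hva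
      · exact fun h => hrot ((congrArg Fin.val h).trans (congrArg Fin.val hva))
      · exact fun h => hva h.symm
    · rw [extraSource]
      split_ifs with hva
      · set u : StateNode k n := (⟨rot k a.1 0, rot_lt a.1.2 hk0⟩, v.2) with hu
        have htop : I.IsNonTopLinkedSCC (I.component u) :=
          (I.mem_comps.1 hv.1).1.translate (i := v.1) (p := v.2)
        -- The component of the copy is accessible in each case: through a start; or, when it
        -- belongs to `𝒩`, through the interconnection from `a` added earlier; or without
        -- interconnections, because it is non-top linked and not in `𝒩`.
        by_cases hstart : ∃ w ∈ I.component u, IsStart m w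
        · obtain ⟨w, hw, hs⟩ := hstart
          exact htop.1.accessibleSet I hw (hacc (Or.inr hs)) u (self_mem_component u)
        · push Not at hstart
          by_cases hmem : I.component u ∈ I.comps
          · obtain ⟨w, hw, hmin⟩ := exists_first (I := I) u
            have hwneeds : I.NeedsEdge m w :=
              ⟨hw ▸ hmem, hmin, fun x hx => hstart x (hw ▸ hx)⟩
            have hwu : w ∈ I.component u := hw ▸ self_mem_component w
            have hw1 : w.1 = u.1 := (inner_star_fst (mem_component.1 hwu).1).symm
            have hplace : place a w < q := by
              rw [← hq, place, place, hw1, hva, hu, off_rot a.1.2 hk0, off_self]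
              have : 1 * n ≤ (k - 1) * n := Nat.mul_le_mul_right _ (by omega)
              have := w.2.2
              omega
            have hne : w.1 ≠ a.1 := fun h => hrot (by
              rw [hw1] at h; exact congrArg Fin.val h)
            have hedge := h.all w hwneeds hplace
            rw [extraSource, if_neg hne] at hedge
            exact htop.1.accessibleSet I hwu ((hacc (Or.inl rfl)).edge I (Or.inr hedge)) u
              (self_mem_component u)
          · rw [mem_comps] at hmem
            push Not at hmem
            exact (hmem htop u (self_mem_component u)).mono I (Set.empty_subset _)
      · exact hacc (Or.inl rfl)
    -- Nothing enters the component of `v` yet: links end in starts, and an earlier addition ends in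
    -- the first state of its component, which would have to be `v`, contrary to its smaller place.
    · refine not_accessible_of_comps hv.1 ?_ (self_mem_component v) (h' v (self_mem_component v))
      rintro f (hf | hf) hfv
      · exact hv.2.2 _ hfv (P.isStart_of_mem_inter hf)
      · obtain ⟨w, hw, hlt, rfl⟩ := h.mem f hf
        have heq := component_eq hfv
        have hle := hw.2.1 v (heq ▸ self_mem_component v)
        have hle' := hv.2.1 w hfv
        obtain rfl := index_inj (le_antisymm hle hle')
        omega
  refine ⟨fun j hj => ?_, fun f hf => ?_, fun w hw hlt => ?_⟩
  · rw [List.length_append, List.length_singleton] at hj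
    by_cases hjL : j < L.length
    · rw [List.getElem_append_left hjL, List.take_append_of_le_length hjL.le]
      exact h.step j hjL
    · obtain rfl : j = L.length := by omega
      simpa using hnew
  · rcases List.mem_append.1 hf with hf | hf
    · obtain ⟨w, h1, h2, h3⟩ := h.mem f hf
      exact ⟨w, h1, by omega, h3⟩
    · exact ⟨v, hv, by omega, by simpa using hf⟩
  · by_cases hwq : place a w < q
    · exact List.mem_append_left _ (h.all w hw hwq)
    · obtain rfl : w = v := place_inj (by rw [hq]; omega : place a w = place a v)
      simp

/-- The execution in which the paths of the greedy matching are linked to a single path from the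
input, so that no pass through the `while` loop is necessary. -/
theorem isRun (P : I.Plan m a link) {L : List (StateNode k n × StateNode k n)}
    (h : I.ExtraList m a (inter (graphOf (tildeMate m link))) (k * n) L) :
    Trace.IsRun I
      { mStar := graphOf (starMate m link)
        mTwo := linkEdges m link
        passes := 0
        mTilde := fun _ => graphOf (tildeMate m link)
        extra := L } := by
  refine ⟨⟨P.isMinCostPerfectMatching, P.isPerfectMatching_linkEdges, P.restrict_union.symm,
    by simp, fun _ => P.not_pending, h.step⟩, P.not_pending, fun S hS => ?_⟩
  have hedges : Trace.edgesAfter (k := k) (n := n)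
      { mStar := graphOf (starMate m link)
        mTwo := linkEdges m link
        passes := 0
        mTilde := fun _ => graphOf (tildeMate m link)
        extra := L } L.length = inter (graphOf (tildeMate m link)) ∪ {f | f ∈ L} := by
    simp [Trace.edgesAfter, Trace.final]
  change I.AccessibleSet (Trace.edgesAfter _ L.length) S
  rw [hedges]
  obtain ⟨⟨hscc, -⟩, -⟩ := I.mem_comps.1 hS
  obtain ⟨x, hx⟩ := hscc
  have hxS : x ∈ S := (hx x).2 ⟨.refl, .refl⟩
  have hscc : I.IsSCC S := ⟨x, hx⟩
  obtain ⟨u, hu, hmin⟩ := exists_first (I := I) x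
  rw [← hscc.eq_component hxS] at hu
  have huS : u ∈ S := hu ▸ self_mem_component u
  by_cases hstart : ∃ w ∈ S, IsStart m w
  · obtain ⟨w, hw, hs⟩ := hstart
    exact hscc.accessibleSet I hw (P.accessible_pathHead Set.subset_union_left (Or.inr hs))
  · push Not at hstart
    have hmem := h.all u ⟨hu ▸ hS, hmin, hu ▸ hstart⟩ (by
      have h1 := off_lt a.1.2 u.1.2
      have h2 := u.2.2
      have : (off k a.1 u.1 + 1) * n ≤ k * n := Nat.mul_le_mul_right _ h1
      rw [Nat.add_mul] at this
      rw [place]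
      omega)
    -- The source was accessible when the interconnection was added, and it remains so with all
    -- additions present.
    obtain ⟨j, hj, hju⟩ := List.getElem_of_mem hmem
    have hsrc := (h.step j hj).2.1
    rw [hju] at hsrc
    refine hscc.accessibleSet I huS ((hsrc.mono I ?_).edge I (Or.inr hmem))
    exact Set.union_subset_union_right _ fun f hf => List.mem_of_mem_take hf

end Plan

end CompositeSystem

/-! ## Augmenting paths -/

namespace Kuhn

variable {N : ℕ} {E : ℕ → ℕ → Prop} {f g P Q : ℕ → ℕ} {root tail found : ℕ}

/-- `f` describes a matching of the left-hand nodes below `N` in the relation `E`: the partner of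
`v` is `f v - 1`, and `0` means that there is none. -/
structure Matching (N : ℕ) (E : ℕ → ℕ → Prop) (f : ℕ → ℕ) : Prop where
  adj : ∀ v < N, f v ≠ 0 → E v (f v - 1)
  inj : ∀ v < N, ∀ w < N, f v ≠ 0 → f v = f w → v = w

/-- `c` is matched by `f`. -/
def Hit (N : ℕ) (f : ℕ → ℕ) (c : ℕ) : Prop := ∃ w < N, f w = c + 1

/-- The right-hand node in the place `j` of the queue. -/
def label (f Q : ℕ → ℕ) (root j : ℕ) : ℕ := if j = 0 then root else f (Q j) - 1

/-- The state of a search for an augmenting path from the right-hand node `root`. The queue `Q`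
holds matched left-hand nodes that stand for their partners, `P v - 1` is the place in the queue
from which `v` was visited, and `found` is `0` or one more than a visited unmatched node. -/
structure Search (N : ℕ) (E : ℕ → ℕ → Prop) (f : ℕ → ℕ) (root : ℕ) (P Q : ℕ → ℕ)
    (tail found : ℕ) : Prop where
  par : ∀ v < N, P v ≠ 0 → P v ≤ tail ∧ E v (label f Q root (P v - 1))
  queue : ∀ j, 1 ≤ j → j < tail → Q j < N ∧ P (Q j) ≠ 0 ∧ P (Q j) ≤ j ∧ f (Q j) ≠ 0
  visited : ∀ v < N, P v ≠ 0 → f v ≠ 0 → ∃ j, 1 ≤ j ∧ j < tail ∧ Q j = v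
  free : ∀ v < N, P v ≠ 0 → f v = 0 → found ≠ 0
  pos : 1 ≤ tail
  card : tail ≤ 1 + ((Finset.range N).filter fun v => P v ≠ 0).card
  found : found ≠ 0 → found - 1 < N ∧ P (found - 1) ≠ 0 ∧ f (found - 1) = 0

/-- The place `0` is the root, and every other place belongs to a visited left-hand node. A scan of
`N + 1` places therefore exhausts the queue. -/
theorem Search.tail_le (h : Search N E f root P Q tail found) : tail ≤ N + 1 := by
  have h1 := h.card
  have h2 := Finset.card_filter_le (Finset.range N) fun v => P v ≠ 0
  rw [Finset.card_range] at h2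
  omega

theorem Search.init (hP : ∀ v < N, P v = 0) : Search N E f root P Q 1 0 where
  par v hv h := absurd (hP v hv) h
  queue j h h' := by omega
  visited v hv h := absurd (hP v hv) h
  free v hv h := absurd (hP v hv) h
  pos := le_rfl
  card := by omega
  found h := absurd rfl h

theorem label_update {v j : ℕ} (hj : j < tail) :
    label f (Function.update Q tail v) root j = label f Q root j := by
  simp [label, hj.ne]

theorem Search.visit_free (h : Search N E f root P Q tail found) {head v : ℕ} (hh : head < tail)
    (hv : v < N) (hE : E v (label f Q root head)) (hf : f v = 0) :
    Search N E f root (Function.update P v (head + 1)) Q tail (v + 1) where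
  par w hw hP := by
    by_cases hwv : w = v
    · subst hwv
      simpa using ⟨hh, hE⟩
    · simp only [Function.update_of_ne hwv] at hP ⊢
      exact h.par w hw hP
  queue j hj hj' := by
    obtain ⟨h1, h2, h3, h4⟩ := h.queue j hj hj'
    have : Q j ≠ v := fun h => h4 (h ▸ hf)
    simp only [Function.update_of_ne this]
    exact ⟨h1, h2, h3, h4⟩
  visited w hw hP hfw := by
    have : w ≠ v := fun h => hfw (h ▸ hf)
    rw [Function.update_of_ne this] at hP
    exact h.visited w hw hP hfw
  free _ _ _ _ := by omega
  pos := h.pos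
  card := by
    refine h.card.trans (Nat.add_le_add_left (Finset.card_le_card fun w hw => ?_) _)
    rw [Finset.mem_filter] at hw ⊢
    refine ⟨hw.1, ?_⟩
    by_cases hwv : w = v
    · simp [hwv]
    · rw [Function.update_of_ne hwv]; exact hw.2
  found _ := by simpa using ⟨hv, hf⟩

theorem Search.visit_matched (h : Search N E f root P Q tail found) {head v : ℕ}
    (hh : head < tail) (hv : v < N) (hP : P v = 0) (hE : E v (label f Q root head))
    (hf : f v ≠ 0) :
    Search N E f root (Function.update P v (head + 1)) (Function.update Q tail v) (tail + 1)
      found where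
  par w hw hPw := by
    by_cases hwv : w = v
    · subst hwv
      simp only [Function.update_self, Nat.add_sub_cancel, label_update hh]
      exact ⟨by omega, hE⟩
    · simp only [Function.update_of_ne hwv] at hPw ⊢
      obtain ⟨h1, h2⟩ := h.par w hw hPw
      rw [label_update (by omega)]
      exact ⟨by omega, h2⟩
  queue j hj hj' := by
    by_cases hjt : j = tail
    · subst hjt
      simp only [Function.update_self]
      exact ⟨hv, by omega, by omega, hf⟩
    · obtain ⟨h1, h2, h3, h4⟩ := h.queue j hj (by omega)
      have : Q j ≠ v := fun h => h2 (h ▸ hP)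
      simp only [Function.update_of_ne hjt, Function.update_of_ne this]
      exact ⟨h1, h2, h3, h4⟩
  visited w hw hPw hfw := by
    by_cases hwv : w = v
    · exact ⟨tail, h.pos, by omega, by simp [hwv]⟩
    · rw [Function.update_of_ne hwv] at hPw
      obtain ⟨j, h1, h2, h3⟩ := h.visited w hw hPw hfw
      exact ⟨j, h1, by omega, by rw [Function.update_of_ne h2.ne, h3]⟩
  free w hw hPw hfw := by
    have hwv : w ≠ v := fun h => hf (h ▸ hfw)
    rw [Function.update_of_ne hwv] at hPw
    exact h.free w hw hPw hfw
  pos := by omega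
  card := by
    have h1 := h.card
    have h2 : ((Finset.range N).filter fun v => P v ≠ 0).card <
        ((Finset.range N).filter fun w => Function.update P v (head + 1) w ≠ 0).card := by
      refine Finset.card_lt_card (Finset.ssubset_iff_of_subset (fun w hw => ?_) |>.2 ⟨v, ?_, ?_⟩)
      · rw [Finset.mem_filter] at hw ⊢
        refine ⟨hw.1, ?_⟩
        by_cases hwv : w = v
        · simp [hwv]
        · rw [Function.update_of_ne hwv]; exact hw.2
      · simp [hv]
      · simp [hP]
    omega
  found hfd := by
    obtain ⟨h1, h2, h3⟩ := h.found hfd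
    have : found - 1 ≠ v := fun h => hf (h ▸ h3)
    rw [Function.update_of_ne this]
    exact ⟨h1, h2, h3⟩

/-- The search from `root` fails: the left-hand nodes in `V` are matched, and they contain all
neighbours of `root` and of their partners. -/
def Stuck (N : ℕ) (E : ℕ → ℕ → Prop) (f : ℕ → ℕ) (root : ℕ) : Prop :=
  ∃ V : Set ℕ, (∀ v < N, E v root → v ∈ V) ∧ (∀ w ∈ V, w < N ∧ f w ≠ 0) ∧
    ∀ v < N, ∀ w ∈ V, E v (f w - 1) → v ∈ V

/-- The visited nodes serve as `V`: none is free, each stands in the queue with its partner, and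
each place of the queue has been expanded. -/
theorem Search.stuck (h : Search N E f root P Q tail 0)
    (hdone : ∀ j < tail, ∀ v < N, E v (label f Q root j) → P v ≠ 0) : Stuck N E f root := by
  refine ⟨{v | v < N ∧ P v ≠ 0}, fun v hv hE => ⟨hv, hdone 0 h.pos v hv (by simpa [label])⟩,
    fun w hw => ⟨hw.1, fun hf => h.free w hw.1 hw.2 hf rfl⟩, fun v hv w hw hE => ⟨hv, ?_⟩⟩
  obtain ⟨j, h1, h2, rfl⟩ := h.visited w hw.1 hw.2 fun hf => h.free w hw.1 hw.2 hf rfl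
  exact hdone j h2 v hv (by simpa [label, show j ≠ 0 by omega])

/-! ### Rematching along an augmenting path -/

/-- The state while the matching is changed along an augmenting path: the node `v`, which is left
to be matched, is exempt. -/
structure Shift (N : ℕ) (E : ℕ → ℕ → Prop) (f P g : ℕ → ℕ) (v : ℕ) : Prop where
  lt : v < N
  visited : P v ≠ 0
  same : ∀ w < N, P w ≠ 0 → P w ≤ P v → g w = f w
  adj : ∀ w < N, w ≠ v → g w ≠ 0 → E w (g w - 1)
  inj : ∀ w < N, w ≠ v → ∀ w' < N, w' ≠ v → g w ≠ 0 → g w = g w' → w = w'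
  image : ∀ c, (∃ w < N, w ≠ v ∧ g w = c + 1) ↔ Hit N f c

theorem Shift.init (hf : Matching N E f) (h : Search N E f root P Q tail found)
    (hfound : found ≠ 0) : Shift N E f P f (found - 1) := by
  obtain ⟨h1, h2, h3⟩ := h.found hfound
  refine ⟨h1, h2, fun _ _ _ _ => rfl, fun w hw _ => hf.adj w hw,
    fun w hw _ w' hw' _ => hf.inj w hw w' hw', fun c => ⟨fun ⟨w, hw, _, h⟩ => ⟨w, hw, h⟩, ?_⟩⟩
  rintro ⟨w, hw, h⟩
  exact ⟨w, hw, by rintro rfl; omega, h⟩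

/-- The node `v` was visited from the partner of `u = Q (P v - 1)`. It takes over this partner, and
`u` becomes the exempt node. The set of matched right-hand nodes stays the same, and `P` drops
strictly, which yields termination. -/
theorem Shift.step (hs : Search N E f root P Q tail found) {v : ℕ} (h : Shift N E f P g v)
    (hv : 1 < P v) : Shift N E f P (Function.update g v (g (Q (P v - 1)))) (Q (P v - 1)) ∧
      P (Q (P v - 1)) < P v := by
  obtain ⟨h1, h2⟩ := hs.par v h.lt h.visited
  obtain ⟨q1, q2, q3, q4⟩ := hs.queue (P v - 1) (by omega) (by omega)
  rw [label, if_neg (by omega)] at h2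
  generalize Q (P v - 1) = u at *
  have huv : u ≠ v := by rintro rfl; omega
  -- Only nodes with larger `P` have been altered so far, so `u` still has its original partner.
  have hgu : g u = f u := h.same u q1 q2 (by omega)
  refine ⟨⟨q1, q2, fun w hw hPw hle => ?_, fun w hw hwu hgw => ?_,
    fun w hw hwu w' hw' hwu' hgw heq => ?_, fun c => ?_⟩, by omega⟩
  · have : w ≠ v := by rintro rfl; omega
    rw [Function.update_of_ne this]
    exact h.same w hw hPw (by omega)
  · by_cases hwv : w = v
    · subst hwv
      rw [Function.update_self, hgu]
      exact h2
    · rw [Function.update_of_ne hwv] at hgw ⊢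
      exact h.adj w hw hwv hgw
  · by_cases hwv : w = v <;> by_cases hwv' : w' = v
    · rw [hwv, hwv']
    · subst hwv
      rw [Function.update_self] at hgw heq
      rw [Function.update_of_ne hwv'] at heq
      exact absurd (h.inj u q1 huv w' hw' hwv' hgw heq).symm hwu'
    · subst hwv'
      rw [Function.update_of_ne hwv] at hgw heq
      rw [Function.update_self] at heq
      exact absurd (h.inj w hw hwv u q1 huv hgw heq) hwu
    · rw [Function.update_of_ne hwv] at hgw heq
      rw [Function.update_of_ne hwv'] at heq
      exact h.inj w hw hwv w' hw' hwv' hgw heq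
  · rw [← h.image]
    constructor
    · rintro ⟨w, hw, hwu, hc⟩
      by_cases hwv : w = v
      · subst hwv
        rw [Function.update_self] at hc
        exact ⟨u, q1, huv, hc⟩
      · rw [Function.update_of_ne hwv] at hc
        exact ⟨w, hw, hwv, hc⟩
    · rintro ⟨w, hw, hwv, hc⟩
      by_cases hwu : w = u
      · subst hwu
        exact ⟨v, h.lt, huv.symm, by rw [Function.update_self, hc]⟩
      · exact ⟨w, hw, hwu, by rw [Function.update_of_ne hwv, hc]⟩

/-- `P v = 1` means that `v` was visited from the root in the place `0`. Matching `v` with the root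
completes the augmentation, and the root is the only right-hand node that becomes newly matched. -/
theorem Shift.finish (hs : Search N E f root P Q tail found) {v : ℕ} (h : Shift N E f P g v)
    (hv : P v = 1) (hroot : ¬ Hit N f root) :
    Matching N E (Function.update g v (root + 1)) ∧
      ∀ c, Hit N (Function.update g v (root + 1)) c ↔ Hit N f c ∨ c = root := by
  have h2 := (hs.par v h.lt h.visited).2
  rw [hv, label, if_pos rfl] at h2
  have hne : ∀ w < N, w ≠ v → g w ≠ root + 1 := fun w hw hwv hg =>
    hroot ((h.image root).1 ⟨w, hw, hwv, hg⟩)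
  refine ⟨⟨fun w hw hgw => ?_, fun w hw w' hw' hgw heq => ?_⟩, fun c => ?_⟩
  · by_cases hwv : w = v
    · subst hwv
      rwa [Function.update_self, Nat.add_sub_cancel]
    · rw [Function.update_of_ne hwv] at hgw ⊢
      exact h.adj w hw hwv hgw
  · by_cases hwv : w = v <;> by_cases hwv' : w' = v
    · rw [hwv, hwv']
    · subst hwv
      rw [Function.update_self, Function.update_of_ne hwv'] at heq
      exact absurd heq.symm (hne w' hw' hwv')
    · subst hwv'
      rw [Function.update_self, Function.update_of_ne hwv] at heq
      exact absurd heq (hne w hw hwv)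
    · rw [Function.update_of_ne hwv] at hgw heq
      rw [Function.update_of_ne hwv'] at heq
      exact h.inj w hw hwv w' hw' hwv' hgw heq
  · rw [← h.image]
    constructor
    · rintro ⟨w, hw, hc⟩
      by_cases hwv : w = v
      · subst hwv
        rw [Function.update_self] at hc
        exact Or.inr (by omega)
      · rw [Function.update_of_ne hwv] at hc
        exact Or.inl ⟨w, hw, hwv, hc⟩
    · rintro (⟨w, hw, hwv, hc⟩ | rfl)
      · exact ⟨w, hw, by rw [Function.update_of_ne hwv, hc]⟩
      · exact ⟨v, h.lt, by rw [Function.update_self]⟩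

/-! ### Certificates of maximality for all prefixes of the order -/

/-- All neighbours of `D` are matched into `D`. -/
def Closed (N : ℕ) (E : ℕ → ℕ → Prop) (f : ℕ → ℕ) (D : Finset ℕ) : Prop :=
  ∀ v < N, ∀ c ∈ D, E v c → ∃ c' ∈ D, f v = c' + 1

/-- Closedness depends only on the set of matched right-hand nodes. -/
theorem Closed.of_hit (hf : Matching N E f) (hg : Matching N E g) {D : Finset ℕ}
    (hD : Closed N E f D) (h : ∀ c ∈ D, Hit N g c ↔ Hit N f c) : Closed N E g D := by
  classical
  let K : (ℕ → ℕ) → Finset ℕ := fun f =>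
    (Finset.range N).filter fun v => f v ≠ 0 ∧ f v - 1 ∈ D
  have himg : ∀ f, (K f).image (fun v => f v - 1) = D.filter (Hit N f) := by
    intro f
    ext c
    simp only [K, Finset.mem_image, Finset.mem_filter, Finset.mem_range, Hit]
    constructor
    · rintro ⟨v, ⟨hv, hf, hD⟩, rfl⟩
      exact ⟨hD, v, hv, by omega⟩
    · rintro ⟨hc, v, hv, hfv⟩
      exact ⟨v, ⟨hv, by omega, by simpa [hfv] using hc⟩, by omega⟩
  have hcard : ∀ {f}, Matching N E f → (K f).card = (D.filter (Hit N f)).card := by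
    intro f hf
    rw [← himg, Finset.card_image_of_injOn]
    intro v hv w hw hvw
    obtain ⟨hv, hv0, -⟩ := Finset.mem_filter.1 hv
    obtain ⟨hw, hw0, -⟩ := Finset.mem_filter.1 hw
    exact hf.inj v (Finset.mem_range.1 hv) w (Finset.mem_range.1 hw) hv0 (by
      simp only at hvw
      omega)
  -- A node that `g` matches into `D` is a neighbour of `D`, hence matched into `D` by `f`. Both
  -- sets have as many elements as `D` has matched nodes, and these are the same for `f` and `g`; so
  -- the sets coincide, and closedness carries over.
  have hsub : K g ⊆ K f := by
    intro v hv
    obtain ⟨hv, hv0, hvD⟩ := Finset.mem_filter.1 hv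
    obtain ⟨c, hc, hfc⟩ := hD v (Finset.mem_range.1 hv) _ hvD (hg.adj v (Finset.mem_range.1 hv) hv0)
    exact Finset.mem_filter.2 ⟨hv, by omega, by simpa [hfc] using hc⟩
  have heq : K g = K f := by
    refine Finset.eq_of_subset_of_card_le hsub ?_
    rw [hcard hf, hcard hg, Finset.filter_congr h]
  intro v hv c hc hE
  obtain ⟨c', hc', hfc⟩ := hD v hv c hc hE
  have : v ∈ K g := by
    rw [heq]
    exact Finset.mem_filter.2 ⟨Finset.mem_range.2 hv, by omega, by simpa [hfc] using hc'⟩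
  obtain ⟨-, h1, h2⟩ := Finset.mem_filter.1 this
  exact ⟨_, h2, by omega⟩

/-- The order in which the right-hand nodes are treated: the input, the states, the components. -/
def order (N o : ℕ) : ℕ := if o = 0 then N else if o < N + 1 then o - 1 else o

theorem order_injective : Function.Injective (order N) := by
  intro o o' h
  unfold order at h
  split_ifs at h <;> omega

/-- The matching after the first `o` right-hand nodes, with certificates of maximality. -/
structure Stage (N : ℕ) (E : ℕ → ℕ → Prop) (f : ℕ → ℕ) (o : ℕ) : Prop where
  matching : Matching N E f
  hit : ∀ c, Hit N f c → ∃ o' < o, c = order N o'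
  cert : ∀ l ≤ o, ∃ D : Finset ℕ, (∀ c ∈ D, ∃ o' < l, c = order N o') ∧
    (∀ o' < l, ¬ Hit N f (order N o') → order N o' ∈ D) ∧ Closed N E f D

theorem Stage.init (hf : ∀ v < N, f v = 0) : Stage N E f 0 where
  matching := ⟨fun v hv h => absurd (hf v hv) h, fun v hv _ _ h => absurd (hf v hv) h⟩
  hit := by
    rintro c ⟨w, hw, h⟩
    rw [hf w hw] at h
    omega
  cert l hl := ⟨∅, by simp, fun o' h => by omega, fun v _ c hc => by simp at hc⟩

theorem Stage.not_hit {o : ℕ} (h : Stage N E f o) : ¬ Hit N f (order N o) := by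
  intro hh
  obtain ⟨o', ho', heq⟩ := h.hit _ hh
  have := order_injective heq
  omega

/-- The augmentation changes partners but leaves the matched nodes within each earlier prefix
unchanged, so the old certificates survive. The longer prefix reuses the certificate for `o`, as its
additional node is now matched. -/
theorem Stage.augment {o : ℕ} (h : Stage N E f o) (hg : Matching N E g)
    (hhit : ∀ c, Hit N g c ↔ Hit N f c ∨ c = order N o) : Stage N E g (o + 1) := by
  have key : ∀ l ≤ o, ∃ D : Finset ℕ, (∀ c ∈ D, ∃ o' < l, c = order N o') ∧
      (∀ o' < l, ¬ Hit N g (order N o') → order N o' ∈ D) ∧ Closed N E g D := by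
    intro l hl
    obtain ⟨D, h1, h2, h3⟩ := h.cert l hl
    refine ⟨D, h1, fun o' ho' hn => h2 o' ho' fun hh => hn ((hhit _).2 (Or.inl hh)),
      h3.of_hit h.matching hg fun c hc => ?_⟩
    rw [hhit]
    refine ⟨fun h' => h'.resolve_right fun heq => ?_, Or.inl⟩
    obtain ⟨o', ho', heq'⟩ := h1 c hc
    have := order_injective (heq'.symm.trans heq)
    omega
  refine ⟨hg, fun c hc => ?_, fun l hl => ?_⟩
  · rcases (hhit c).1 hc with hc | hc
    · obtain ⟨o', ho', h'⟩ := h.hit c hc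
      exact ⟨o', by omega, h'⟩
    · exact ⟨o, by omega, hc⟩
  · rcases Nat.lt_or_ge l (o + 1) with hlo | hlo
    · exact key l (by omega)
    · obtain rfl : l = o + 1 := by omega
      obtain ⟨D, h1, h2, h3⟩ := key o le_rfl
      refine ⟨D, fun c hc => ?_, fun o' ho' hn => ?_, h3⟩
      · obtain ⟨o', ho', h'⟩ := h1 c hc
        exact ⟨o', by omega, h'⟩
      · rcases Nat.lt_or_ge o' o with ho | ho
        · exact h2 o' ho hn
        · obtain rfl : o' = o := by omega
          exact absurd ((hhit _).2 (Or.inr rfl)) hn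

/-- The old certificate is enlarged by the root and by the partners of the nodes in `V`: all
neighbours of these lie in `V`, hence are matched with one of these partners. -/
theorem Stage.skip {o : ℕ} (h : Stage N E f o) (hstuck : Stuck N E f (order N o)) :
    Stage N E f (o + 1) := by
  classical
  obtain ⟨V, hV1, hV2, hV3⟩ := hstuck
  refine ⟨h.matching, fun c hc => ?_, fun l hl => ?_⟩
  · obtain ⟨o', ho', h'⟩ := h.hit c hc
    exact ⟨o', by omega, h'⟩
  · rcases Nat.lt_or_ge l (o + 1) with hlo | hlo
    · exact h.cert l (by omega)
    · obtain rfl : l = o + 1 := by omega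
      obtain ⟨D, h1, h2, h3⟩ := h.cert o le_rfl
      let D' : Finset ℕ := ((Finset.range N).filter (· ∈ V)).image fun w => f w - 1
      have hD' : ∀ w ∈ V, f w - 1 ∈ D' := fun w hw => Finset.mem_image.2 ⟨w,
        Finset.mem_filter.2 ⟨Finset.mem_range.2 (hV2 w hw).1, hw⟩, rfl⟩
      have hV : ∀ v ∈ V, ∃ c' ∈ D ∪ insert (order N o) D', f v = c' + 1 := fun v hv =>
        ⟨f v - 1, by simp [hD' v hv], by have := (hV2 v hv).2; omega⟩
      refine ⟨D ∪ insert (order N o) D', fun c hc => ?_, fun o' ho' hn => ?_,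
        fun v hv c hc hE => ?_⟩
      · rcases Finset.mem_union.1 hc with hc | hc
        · obtain ⟨o', ho', h'⟩ := h1 c hc
          exact ⟨o', by omega, h'⟩
        · rcases Finset.mem_insert.1 hc with hc | hc
          · exact ⟨o, by omega, hc⟩
          · obtain ⟨w, hw, rfl⟩ := Finset.mem_image.1 hc
            have hw := (Finset.mem_filter.1 hw).2
            obtain ⟨o', ho', h'⟩ := h.hit (f w - 1) ⟨w, (hV2 w hw).1, by
              have := (hV2 w hw).2; omega⟩
            exact ⟨o', by omega, h'⟩
      · rcases Nat.lt_or_ge o' o with ho | ho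
        · exact Finset.mem_union_left _ (h2 o' ho hn)
        · obtain rfl : o' = o := by omega
          simp
      · rcases Finset.mem_union.1 hc with hc | hc
        · obtain ⟨c', hc', h'⟩ := h3 v hv c hc hE
          exact ⟨c', Finset.mem_union_left _ hc', h'⟩
        · refine hV v ?_
          rcases Finset.mem_insert.1 hc with rfl | hc
          · exact hV1 v hv hE
          · obtain ⟨w, hw, rfl⟩ := Finset.mem_image.1 hc
            exact hV3 v hv w (Finset.mem_filter.1 hw).2 hE

end Kuhn

/-! ## The matching program -/

namespace WordRAM

infixr:55 " ⨾ " => Cmd.seq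

theorem Store.setArr_arr_self (s : Store) (a i m : ℕ) :
    (s.setArr a i m).arr a = Function.update (s.arr a) i m := by
  simp [Store.setArr]

theorem Store.setArr_arr_of_ne (s : Store) {a b : ℕ} (i m : ℕ) (h : b ≠ a) :
    (s.setArr a i m).arr b = s.arr b := by
  simp [Store.setArr, h]

end WordRAM

namespace Kuhn

open WordRAM

/-- The left-hand node in variable 14 is visited from the right-hand node in variable 13, which
has the place in variable 10 in the queue. -/
def scan : Cmd :=
  .ite (.eq (.get 13 (.var 14)) (.const 0) *
      (.lt (.const 0) (.get 3 (.var 14 * .var 5 + .var 13)) *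
        .lt (.get 3 (.var 14 * .var 5 + .var 13)) (.const 4)))
    (.set 13 (.var 14) (.var 10 + .const 1) ⨾
      .ite (.eq (.get 12 (.var 14)) (.const 0))
        (.assign 12 (.var 14 + .const 1))
        (.set 14 (.var 11) (.var 14) ⨾ .assign 11 (.var 11 + .const 1)))
    .skip

/-- All left-hand nodes are visited from the right-hand node in the place in variable 10. -/
def expand : Cmd :=
  .ite (.eq (.var 10) (.const 0)) (.assign 13 (.var 7))
    (.assign 13 (.get 12 (.get 14 (.var 10)) - .const 1)) ⨾
  .for 14 (.var 4) scan

/-- The search for an augmenting path from the right-hand node in variable 7. -/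
def search : Cmd :=
  .for 14 (.var 4) (.set 13 (.var 14) (.const 0)) ⨾ .assign 11 (.const 1) ⨾
  .assign 12 (.const 0) ⨾
  .for 10 (.var 4 + .const 1)
    (.ite (.lt (.var 10) (.var 11) * .eq (.var 12) (.const 0)) expand .skip)

/-- The change of the matching along the augmenting path that has been found. -/
def augment : Cmd :=
  .assign 14 (.var 12 - .const 1) ⨾
  .loop (.lt (.const 1) (.get 13 (.var 14)))
    (.assign 15 (.get 14 (.get 13 (.var 14) - .const 1)) ⨾
      .set 12 (.var 14) (.get 12 (.var 15)) ⨾ .assign 14 (.var 15)) ⨾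
  .set 12 (.var 14) (.var 7 + .const 1)

/-- The greedy matching program; the matching is held in array 12. -/
def program : Cmd :=
  .for 6 (.var 5)
    (.ite (.eq (.var 6) (.const 0)) (.assign 7 (.var 4))
        (.ite (.lt (.var 6) (.var 4 + .const 1)) (.assign 7 (.var 6 - .const 1))
          (.assign 7 (.var 6))) ⨾
      search ⨾ .ite (.var 12) augment .skip)

/-- The edges whose entry in the cost matrix `c` stands for a cost of at most `2`. -/
def Cheap (N : ℕ) (c : ℕ → ℕ) (v r : ℕ) : Prop :=
  0 < c (v * (2 * N + 1) + r) ∧ c (v * (2 * N + 1) + r) < 4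

variable {W N : ℕ} {E : ℕ → ℕ → Prop} {f c : ℕ → ℕ} {root head cur y : ℕ}

/-- The state of the search while the node in the place `head` is expanded and the left-hand nodes
below `cur` have been looked at; `y` is the node in this place. -/
structure Scanning (N : ℕ) (E : ℕ → ℕ → Prop) (f : ℕ → ℕ) (root head cur y : ℕ) (s : Store) :
    Prop where
  search : Search N E f root (s.arr 13) (s.arr 14) (s.var 11) (s.var 12)
  lt : head < s.var 11
  done : ∀ j < head, ∀ w < N, E w (label f (s.arr 14) root j) → s.arr 13 w ≠ 0
  label_eq : label f (s.arr 14) root head = y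
  scanned : ∀ w < cur, E w y → s.arr 13 w ≠ 0

theorem scan_runs {s : Store} (hW : N + 3 ≤ W) (h : Scanning N (Cheap N c) f root head cur y s)
    (h5 : s.var 5 = 2 * N + 1) (h10 : s.var 10 = head) (h14 : s.var 14 = cur) (hcur : cur < N)
    (h13 : s.var 13 = y) (hf : s.arr 12 = f) (hc : s.arr 3 = c) :
    Runs W scan s 60 (Scanning N (Cheap N c) f root head (cur + 1) y) := by
  have htail := h.search.tail_le
  have hlt := h.lt
  -- A place is stored increased by one, so visiting a node never clears a mark.
  have hup : ∀ w, s.arr 13 w ≠ 0 → Function.update (s.arr 13) cur (head + 1) w ≠ 0 := by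
    intro w hw
    by_cases hwc : w = cur
    · simp [hwc]
    · rwa [Function.update_of_ne hwc]
  have hself : Function.update (s.arr 13) cur (head + 1) cur ≠ 0 := by simp
  refine Runs.of_wp ⟨fun hne => ?_, fun heq => ?_⟩ (by decide)
  · have hcond : c (cur * (2 * N + 1) + s.var 13) < 4 ∧
        0 < c (cur * (2 * N + 1) + s.var 13) ∧ s.arr 13 cur = 0 := by
      simpa [h14, h5, hc] using hne
    obtain ⟨hE', hE, hP⟩ := hcond
    have hE : Cheap N c cur (s.var 13) := ⟨hE, hE'⟩
    rw [h13, ← h.label_eq] at hE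
    refine ⟨⟨by simp only [Expr.eval_var]; omega,
      by simp only [Expr.eval_add, Expr.eval_var, Expr.eval_const]; omega⟩, ?_, ?_⟩
    · intro hfree
      have hfree : f cur = 0 := by simpa [h14, hf] using hfree
      refine ⟨by simp [h14]; omega, ?_, ?_, ?_, ?_, ?_⟩
      · simpa [Store.setArr_arr_self, Store.setArr_arr_of_ne, h14, h10] using
          h.search.visit_free hlt hcur hE hfree
      · simpa using hlt
      · intro j hj w hw hEw
        simp only [Store.setVar_arr, Store.setArr_arr_self, Expr.eval_var, h14, h10, Expr.eval_add,
          Expr.eval_const]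
        refine hup w (h.done j hj w hw ?_)
        simpa [Store.setArr_arr_of_ne] using hEw
      · simpa [Store.setArr_arr_of_ne] using h.label_eq
      · intro w hw hEw
        simp only [Store.setVar_arr, Store.setArr_arr_self, Expr.eval_var, h14, h10, Expr.eval_add,
          Expr.eval_const]
        rcases Nat.lt_or_ge w cur with hwc | hwc
        · exact hup w (h.scanned w hwc hEw)
        · obtain rfl : w = cur := by omega
          exact hself
    · intro hmatched
      have hmatched : f cur ≠ 0 := by simpa [h14, hf] using hmatched
      refine ⟨⟨by simp; omega, by simp [h14]; omega⟩, by simp; omega, ?_, ?_, ?_, ?_, ?_⟩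
      · simpa [Store.setArr_arr_self, Store.setArr_arr_of_ne, h14, h10] using
          h.search.visit_matched hlt hcur hP hE hmatched
      · simp; omega
      · intro j hj w hw hEw
        simp only [Store.setVar_arr, Store.setArr_arr_self, Expr.eval_var, h14, h10, Expr.eval_add,
          Expr.eval_const, Store.setArr_arr_of_ne _ _ _ (show 13 ≠ 14 by decide),
          Store.setArr_var, Store.setArr_arr_of_ne _ _ _ (show 14 ≠ 13 by decide)] at hEw ⊢
        rw [label_update (by omega)] at hEw
        exact hup w (h.done j hj w hw hEw)
      · simp only [Store.setVar_arr, Store.setArr_arr_self, Expr.eval_var,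
          Store.setArr_var, Store.setArr_arr_of_ne _ _ _ (show 14 ≠ 13 by decide)]
        rw [label_update (by omega), h.label_eq]
      · intro w hw hEw
        simp only [Store.setVar_arr, Store.setArr_arr_self, Expr.eval_var, h14, h10, Expr.eval_add,
          Expr.eval_const, Store.setArr_arr_of_ne _ _ _ (show 13 ≠ 14 by decide)]
        rcases Nat.lt_or_ge w cur with hwc | hwc
        · exact hup w (h.scanned w hwc hEw)
        · obtain rfl : w = cur := by omega
          exact hself
  · refine ⟨h.search, h.lt, h.done, h.label_eq, fun w hw hEw => ?_⟩
    rcases Nat.lt_or_ge w cur with hwc | hwc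
    · exact h.scanned w hwc hEw
    · obtain rfl : w = cur := by omega
      intro hP
      have : ¬ Cheap N c w (s.var 13) := by
        intro hE
        have h1 := hE.1
        have h2 := hE.2
        simp [h14, h5, hc, hP] at heq
        omega
      exact this (h13 ▸ hEw)

theorem expand_runs {s : Store} (hW : 2 * N + 3 ≤ W)
    (hs : Search N (Cheap N c) f root (s.arr 13) (s.arr 14) (s.var 11) (s.var 12))
    (hlt : head < s.var 11)
    (hdone : ∀ j < head, ∀ w < N, Cheap N c w (label f (s.arr 14) root j) → s.arr 13 w ≠ 0)
    (h4 : s.var 4 = N) (h5 : s.var 5 = 2 * N + 1) (h7 : s.var 7 = root) (h10 : s.var 10 = head)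
    (hroot : root < 2 * N + 1) (hfle : ∀ v < N, f v ≤ 2 * N + 1)
    (hf : s.arr 12 = f) (hc : s.arr 3 = c) :
    Runs W expand s (68 * N + 40) fun s' =>
      ∃ y, Scanning N (Cheap N c) f root head N y s' := by
  refine Runs.seq (T := 20) (R := fun s' => s' = s.setVar 13 (label f (s.arr 14) root head))
    (Runs.of_wp ⟨fun he => ?_, fun he => ?_⟩ (by decide)) (fun s' _ hs' => ?_)
    (T' := 68 * N + 20) (by omega)
  · have he : head = 0 := by simpa [h10] using he
    refine ⟨by simp; omega, ?_⟩
    simp [label, he, h7]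
  · have he : head ≠ 0 := by simpa [h10] using he
    have hq := (hs.queue head (by omega) hlt).1
    have := hfle _ hq
    refine ⟨by simp [h10, hf]; omega, ?_⟩
    simp [label, he, h10, hf]
  · subst hs'
    generalize hy : label f (s.arr 14) root head = y
    refine (Runs.for (x := 14) N 60 (fun i s' => Scanning N (Cheap N c) f root head i y s')
      (by decide) (fun s' hF => ?_) (by omega) ?_ ?_
      (by simp [Expr.time]; omega)).mono le_rfl fun _ _ h => ⟨y, h.1⟩
    · have := hF.var 4 (by decide)
      simpa [h4] using this
    · exact ⟨by simpa using hs, by simpa using hlt, by simpa using hdone, by simpa using hy,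
        by simp⟩
    · intro i hi s' h14 hF hI
      have e5 := hF.var 5 (by decide)
      have e10 := hF.var 10 (by decide)
      have e12 := hF.arr 12 (by decide)
      have e3 := hF.arr 3 (by decide)
      have e13 := hF.var 13 (by decide)
      simp only [Store.setVar_var, Store.setVar_arr] at e5 e10 e12 e3 e13
      refine (scan_runs (by omega) hI (e5.trans h5) (e10.trans h10) h14 hi e13 (e12.trans hf)
        (e3.trans hc)).mono le_rfl fun s'' hF' h' => ?_
      exact ⟨by simpa using h'.search, by simpa using h'.lt, by simpa using h'.done,
        by simpa using h'.label_eq, by simpa using h'.scanned⟩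

/-- At most `N + 1` places are expanded, each in linear time. When no free node has been found, the
whole queue has been expanded and the search is stuck. -/
theorem search_runs {s : Store} (hW : 2 * N + 3 ≤ W) (hN : 1 ≤ N)
    (h4 : s.var 4 = N) (h5 : s.var 5 = 2 * N + 1) (h7 : s.var 7 = root)
    (hroot : root < 2 * N + 1) (hfle : ∀ v < N, f v ≤ 2 * N + 1)
    (hf : s.arr 12 = f) (hc : s.arr 3 = c) :
    Runs W search s (400 * N ^ 2) fun s' =>
      Search N (Cheap N c) f root (s'.arr 13) (s'.arr 14) (s'.var 11) (s'.var 12) ∧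
      (s'.var 12 = 0 → Stuck N (Cheap N c) f root) := by
  have hsq : N ≤ N ^ 2 := Nat.le_self_pow (by decide) N
  refine Runs.seq (T := 14 * N + 10) (R := fun s' => ∀ v < N, s'.arr 13 v = 0) ?_
    (fun s1 hF1 h1 => ?_)
    (T' := 360 * N ^ 2) (by nlinarith)
  · refine (Runs.for (x := 14) N 3 (fun i s' => ∀ v < i, s'.arr 13 v = 0) (by decide)
      (fun s' hF => ?_) (by omega) (by simp) ?_ (by simp [Expr.time]; omega)).mono le_rfl
      fun _ _ h => h.1
    · have := hF.var 4 (by decide)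
      simpa [h4] using this
    · intro i hi s' h14 hF hI
      refine Runs.of_wp ⟨⟨by simp [h14]; omega, by simp; omega⟩, ?_⟩ (by decide)
      intro v hv
      simp only [Store.setVar_arr, Store.setArr_arr, Expr.eval_var, h14, Expr.eval_const]
      split_ifs with hvi
      · rfl
      · exact hI v (by rw [true_and] at hvi; omega)
  · refine Runs.seq (T := 2) (R := fun s' => s' = s1.setVar 11 1)
      (Runs.of_wp ⟨by simp; omega, rfl⟩ (by decide)) (fun s2 _ h2 => ?_) (T' := 350 * N ^ 2)
      (by nlinarith)
    refine Runs.seq (T := 2) (R := fun s' => s' = s2.setVar 12 0)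
      (Runs.of_wp ⟨by simp; omega, rfl⟩ (by decide)) (fun s3 _ h3 => ?_) (T' := 340 * N ^ 2)
      (by nlinarith)
    have e4 : s3.var 4 = N := by
      rw [h3, h2]; simpa [h4] using hF1.var 4 (by decide)
    have e5 : s3.var 5 = 2 * N + 1 := by
      rw [h3, h2]; simpa [h5] using hF1.var 5 (by decide)
    have e7 : s3.var 7 = root := by
      rw [h3, h2]; simpa [h7] using hF1.var 7 (by decide)
    have e12 : s3.arr 12 = f := by
      rw [h3, h2]; simpa [hf] using hF1.arr 12 (by decide)
    have e3 : s3.arr 3 = c := by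
      rw [h3, h2]; simpa [hc] using hF1.arr 3 (by decide)
    have e13 : ∀ v < N, s3.arr 13 v = 0 := by
      rw [h3, h2]; simpa using h1
    have e11 : s3.var 11 = 1 := by rw [h3, h2]; simp
    have e12' : s3.var 12 = 0 := by rw [h3]; simp
    clear h1 h2 h3 hF1
    -- Expansion ceases once a free node is found; completeness of the expanded places is therefore
    -- claimed only while variable 12 is `0`.
    refine (Runs.for (x := 10) (N + 1) (68 * N + 60) (fun i s' =>
      Search N (Cheap N c) f root (s'.arr 13) (s'.arr 14) (s'.var 11) (s'.var 12) ∧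
      (s'.var 12 = 0 → ∀ j < i, j < s'.var 11 → ∀ w < N,
        Cheap N c w (label f (s'.arr 14) root j) → s'.arr 13 w ≠ 0)) (by decide)
      (fun s' hF => ?_) (by omega) ?_ ?_ (by simp [Expr.time]; nlinarith)).mono le_rfl ?_
    · have := hF.var 4 (by decide)
      simpa [e4] using this
    · refine ⟨?_, by simp⟩
      simp only [Store.setVar_var, Store.setVar_arr]
      simpa [e11, e12'] using Search.init e13
    · intro i hi s' h10 hF hI
      have e4' := (hF.var 4 (by decide)).trans e4
      have e5' := (hF.var 5 (by decide)).trans e5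
      have e7' := (hF.var 7 (by decide)).trans e7
      have e12' := (hF.arr 12 (by decide)).trans e12
      have e3' := (hF.arr 3 (by decide)).trans e3
      refine Runs.ite (T := 68 * N + 40) (fun he => ?_) (fun he => ?_) (by simp [Expr.time]; omega)
      · have he : i < s'.var 11 ∧ s'.var 12 = 0 := by
          simp [h10] at he
          exact ⟨he.1, by by_contra h; simp [h] at he⟩
        refine (expand_runs hW hI.1 he.1 (fun j hj => hI.2 he.2 j hj (by omega)) e4' e5' e7' h10
          hroot hfle e12' e3').mono le_rfl fun s'' _ h' => ?_
        obtain ⟨y, h'⟩ := h'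
        refine ⟨by simpa using h'.search, fun _ j hj _ w hw hE => ?_⟩
        simp only [Store.setVar_arr] at hE ⊢
        rcases Nat.lt_or_ge j i with hji | hji
        · exact h'.done j hji w hw hE
        · obtain rfl : j = i := by omega
          exact h'.scanned w hw (h'.label_eq ▸ hE)
      · refine Runs.of_wp ⟨by simpa using hI.1, fun h0 j hj hlt => ?_⟩ (by simp [Cmd.cost])
        simp only [Store.setVar_var, Store.setVar_arr] at h0 hlt ⊢
        rw [if_neg (by decide)] at h0 hlt
        refine hI.2 h0 j ?_ hlt
        by_contra hji
        obtain rfl : j = i := by omega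
        simp [h10, h0, hlt] at he
    · rintro s' - ⟨⟨h1, h2⟩, -⟩
      refine ⟨h1, fun h0 => ?_⟩
      rw [h0] at h1
      have := h1.tail_le
      exact h1.stuck fun j hj w hw => h2 h0 j (by omega) hj w hw

/-- The place from which the exempt node was visited decreases strictly and is at most `N`, so the
loop is linear. The bound on the entries keeps them within a word. -/
theorem augment_runs {s : Store} (hW : 2 * N + 3 ≤ W) (hN : 1 ≤ N) (h7 : s.var 7 = root)
    (hroot : root < 2 * N + 1) (hnot : ¬ Hit N f root) (hfle : ∀ v < N, f v ≤ 2 * N + 1)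
    (hf : s.arr 12 = f) (hmatch : Matching N E f)
    (hs : Search N E f root (s.arr 13) (s.arr 14) (s.var 11) (s.var 12)) (h12 : s.var 12 ≠ 0) :
    Runs W augment s (100 * N) fun s' => Matching N E (s'.arr 12) ∧
      (∀ c, Hit N (s'.arr 12) c ↔ Hit N f c ∨ c = root) ∧ ∀ v < N, s'.arr 12 v ≤ 2 * N + 1 := by
  have hinit := Shift.init hmatch hs h12
  refine Runs.seq (T := 4) (R := fun s' => s' = s.setVar 14 (s.var 12 - 1))
    (Runs.of_wp ⟨by have := hinit.lt; simp; omega, rfl⟩ (by decide)) (fun s1 _ h1 => ?_)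
    (T' := 90 * N) (by omega)
  have htail := hs.tail_le
  refine Runs.seq (T := N * 40 + 20) (R := fun s' => s'.var 7 = root ∧
      Shift N E f (s.arr 13) (s'.arr 12) (s'.var 14) ∧ s.arr 13 (s'.var 14) = 1) ?_
    (fun s2 _ h2 => ?_) (T' := 10) (by omega)
  · refine (Runs.while (T := 20) (fun s' => s'.var 7 = root ∧ s'.arr 13 = s.arr 13 ∧
      s'.arr 14 = s.arr 14 ∧ Shift N E f (s.arr 13) (s'.arr 12) (s'.var 14) ∧
      ∀ v < N, s'.arr 12 v ≤ 2 * N + 1)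
      (fun s' => s'.arr 13 (s'.var 14) - 1) ?_ (s := s1) ?_).mono ?_ ?_
    · rintro s' ⟨g7, g13, g14, hsh, hle⟩ he
      have he : 1 < s.arr 13 (s'.var 14) := by simpa [g13] using he
      obtain ⟨hsh', hlt⟩ := hsh.step hs he
      have hu := hsh'.lt
      have hgu := hle _ hu
      have hv := hsh.lt
      refine Runs.of_wp ⟨?_, ⟨?_, ?_⟩, ?_, ⟨?_, ?_, ?_, ?_, ?_⟩, ?_⟩ (by decide)
      · simp [g13, g14]; omega
      · simp; omega
      · simp [g13, g14]; omega
      · simp [g13, g14]; omega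
      · simpa using g7
      · simpa [Store.setArr_arr_of_ne] using g13
      · simpa [Store.setArr_arr_of_ne] using g14
      · simpa [Store.setArr_arr_self, g13, g14] using hsh'
      · intro w hw
        simp only [Store.setVar_arr, Store.setVar_var, Store.setArr_arr, Expr.eval_var,
          Expr.eval_get, Expr.eval_sub, Expr.eval_const, g13, g14]
        split_ifs <;> first | exact hgu | exact hle w hw
      · simp [g13, g14]; omega
    · rw [h1]
      refine ⟨by simpa using h7, rfl, rfl, ?_, ?_⟩
      · simpa [hf] using hinit
      · simpa [hf] using hfle
    · have h2 : s.arr 13 (s.var 12 - 1) ≤ s.var 11 := (hs.par _ hinit.lt hinit.visited).1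
      rw [h1]
      simp only [Store.setVar_arr, Store.setVar_var, if_true]
      have : (s.arr 13 (s.var 12 - 1) - 1) * 26 ≤ N * 26 := Nat.mul_le_mul_right _ (by omega)
      simp only [Expr.time]
      omega
    · rintro s' - ⟨⟨g7, g13, g14, hsh, hle⟩, he⟩
      refine ⟨g7, hsh, ?_⟩
      have := hsh.visited
      have : ¬ 1 < s.arr 13 (s'.var 14) := by simpa [g13] using he
      omega
  · obtain ⟨g7, hsh, hone⟩ := h2
    have hv := hsh.lt
    obtain ⟨k1, k2⟩ := hsh.finish hs hone hnot
    refine Runs.of_wp ⟨⟨by simp; omega, by simp; omega⟩, ?_⟩ (by decide)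
    simp only [Store.setArr_arr_self, Expr.eval_var, Expr.eval_add, Expr.eval_const, g7]
    refine ⟨k1, k2, fun v hv => ?_⟩
    -- A nonzero entry names a matched right-hand node, which is the root or was matched before; in
    -- both cases it is in range.
    by_cases h0 : Function.update (s2.arr 12) (s2.var 14) (root + 1) v = 0
    · omega
    · obtain ⟨c, hc⟩ := Nat.exists_eq_succ_of_ne_zero h0
      rcases (k2 c).1 ⟨v, hv, hc⟩ with ⟨w, hw, h⟩ | h
      · have := hfle w hw
        omega
      · omega

/-- One quadratic search and at most one linear augmentation for each of the `2 * N + 1` columns: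
this is one of the two places where cubic time is spent, the other being the transitive closure. -/
theorem program_runs {s : Store} (hW : 2 * N + 3 ≤ W) (hN : 1 ≤ N) (h4 : s.var 4 = N)
    (h5 : s.var 5 = 2 * N + 1) (h12 : ∀ v < N, s.arr 12 v = 0) (hc : s.arr 3 = c) :
    Runs W program s (2000 * N ^ 3) fun s' =>
      Stage N (Cheap N c) (s'.arr 12) (2 * N + 1) := by
  have hsq : N ≤ N ^ 2 := Nat.le_self_pow (by decide) N
  have hcb : N ^ 2 ≤ N ^ 3 := Nat.pow_le_pow_right hN (by decide)
  refine (Runs.for (x := 6) (2 * N + 1) (550 * N ^ 2) (fun o s' =>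
    Stage N (Cheap N c) (s'.arr 12) o ∧ ∀ v < N, s'.arr 12 v ≤ 2 * N + 1) (by decide)
    (fun s' hF => ?_) (by omega) ?_ ?_ ?_).mono le_rfl fun _ _ h => h.1.1
  · have := hF.var 5 (by decide)
    simpa [h5] using this
  · exact ⟨Stage.init (by simpa using h12), fun v hv => by simp [h12 v hv]⟩
  · intro o ho s' h6 hF hI
    have e4 := (hF.var 4 (by decide)).trans h4
    have e5 := (hF.var 5 (by decide)).trans h5
    have e3 := (hF.arr 3 (by decide)).trans hc
    have hord : order N o < 2 * N + 1 := by
      unfold order; split_ifs <;> omega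
    refine Runs.seq (T := 40) (R := fun s'' => s'' = s'.setVar 7 (order N o))
      (Runs.of_wp ⟨fun he => ?_, fun he => ⟨fun he' => ?_, fun he' => ?_⟩⟩ (by decide))
      (fun s1 _ h1 => ?_) (T' := 505 * N ^ 2) (by nlinarith)
    · have he : o = 0 := by simpa [h6] using he
      refine ⟨by simp; omega, by simp [order, he, e4]⟩
    · have he : o ≠ 0 := by simpa [h6] using he
      have he' : o < N + 1 := by simpa [h6, e4] using he'
      refine ⟨by simp; omega, by simp [order, he, he', h6]⟩
    · have he : o ≠ 0 := by simpa [h6] using he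
      have he' : ¬ o < N + 1 := by simpa [h6, e4] using he'
      refine ⟨by simp; omega, by simp [order, he, he', h6]⟩
    · refine Runs.seq (search_runs (f := s'.arr 12) (root := order N o) hW hN (by simpa [h1])
        (by simpa [h1]) (by simp [h1]) hord hI.2 (by simp [h1]) (by simpa [h1]))
        (fun s2 hF2 h2 => ?_) (T' := 105 * N ^ 2) (by omega)
      have g7 : s2.var 7 = order N o := by
        rw [hF2.var 7 (by decide), h1]; simp
      have g12 : s2.arr 12 = s'.arr 12 := by
        rw [hF2.arr 12 (by decide), h1]; simp
      refine Runs.ite (T := 100 * N) (fun he => ?_) (fun he => ?_) (by simp [Expr.time]; omega)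
      · refine (augment_runs hW hN g7 hord hI.1.not_hit hI.2 g12 hI.1.matching h2.1
          (by simpa using he)).mono le_rfl fun s3 _ h3 => ?_
        exact ⟨by simpa using hI.1.augment h3.1 h3.2.1, by simpa using h3.2.2⟩
      · refine Runs.of_wp ?_ (by simp [Cmd.cost]; omega)
        have := hI.1.skip (h2.2 (by simpa using he))
        exact ⟨by simpa [g12] using this, by simpa [g12] using hI.2⟩
  · simp [Expr.time]
    nlinarith

end Kuhn

/-! ## Filling arrays -/

namespace WordRAM

variable {W : ℕ}

theorem Runs.fill {x a : ℕ} {e : Expr} {c : Cmd} {s₀ : Store} (l T : ℕ) (G : ℕ → ℕ) {T' : ℕ}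
    (hx : x ∉ c.vars) (he : ∀ s, Frame (.for x e c) s₀ s → e.eval s = l) (hl : l < W)
    (hc : ∀ i < l, ∀ s, s.var x = i → Frame (.for x e c) s₀ s →
      Runs W c s T fun s' => s'.arr a = Function.update (s.arr a) i (G i))
    (hT : l * (T + e.time + 7) + e.time + 5 ≤ T') :
    Runs W (.for x e c) s₀ T' fun s' => ∀ i < l, s'.arr a i = G i := by
  refine (Runs.for (x := x) l T (fun i s => ∀ i' < i, s.arr a i' = G i') hx he hl (by simp) ?_
    hT).mono le_rfl fun _ _ h => h.1
  intro i hi s hsx hF hI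
  refine (hc i hi s hsx hF).mono le_rfl fun s' _ h i' hi' => ?_
  rw [Store.setVar_arr, h]
  by_cases hii : i' = i
  · simp [hii]
  · rw [Function.update_of_ne hii]
    exact hI i' (by omega)

theorem Runs.fill₂ {x y a : ℕ} {e e' : Expr} {c : Cmd} {s₀ : Store} (l m T : ℕ)
    (G : ℕ → ℕ → ℕ) {T' : ℕ} (hxy : x ≠ y) (hx : x ∉ c.vars) (hy : y ∉ c.vars)
    (he : ∀ s, Frame (.for x e (.for y e' c)) s₀ s → e.eval s = l) (hl : l < W)
    (he' : ∀ s, Frame (.for x e (.for y e' c)) s₀ s → e'.eval s = m) (hm : m < W)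
    (hc : ∀ i < l, ∀ j < m, ∀ s, s.var x = i → s.var y = j →
      Frame (.for x e (.for y e' c)) s₀ s →
      Runs W c s T fun s' => s'.arr a = Function.update (s.arr a) (i * m + j) (G i j))
    (hT : l * (m * (T + e'.time + 7) + e'.time + 5 + e.time + 7) + e.time + 5 ≤ T') :
    Runs W (.for x e (.for y e' c)) s₀ T' fun s' =>
      ∀ i < l, ∀ j < m, s'.arr a (i * m + j) = G i j := by
  refine (Runs.for₂ l m T (fun t s => ∀ i, ∀ j < m, i * m + j < t → s.arr a (i * m + j) = G i j)
    hxy hx hy he hl he' hm (fun i s u h => ⟨h, h⟩) (by simp) ?_ hT).mono le_rfl ?_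
  · intro i hi j hj s hsx hsy hF hI
    refine (hc i hi j hj s hsx hsy hF).mono le_rfl fun s' _ h i' j' hj' hlt => ?_
    rw [h]
    by_cases heq : i' * m + j' = i * m + j
    · obtain ⟨rfl, rfl⟩ := CompositeSystem.mul_add_inj hj' hj heq
      simp
    · rw [Function.update_of_ne heq]
      exact hI i' j' hj' (by omega)
  · intro s _ h i hi j hj
    refine h i j hj ?_
    have : (i + 1) * m ≤ l * m := Nat.mul_le_mul_right _ hi
    rw [Nat.add_mul] at this
    omega

end WordRAM

namespace CompositeSystem

open WordRAM

variable {k n : ℕ} (I : CompositeSystem k n)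

/-! ## Preparations -/

/-- The input, the numbers `k * n` and `2 * (k * n) + 1`, and the coordinates of the states. -/
structure Ready (s : Store) : Prop where
  var0 : s.var 0 = k
  var1 : s.var 1 = n
  var4 : s.var 4 = k * n
  var5 : s.var 5 = 2 * (k * n) + 1
  arr0 : ∀ p q : Fin n, s.arr 0 (p.val * n + q.val) = if I.A p q then 1 else 0
  arr1 : ∀ v : StateNode k n, s.arr 1 v.index = if I.B v then 1 else 0
  arr19 : ∀ v : StateNode k n, s.arr 19 v.index = v.1
  arr20 : ∀ v : StateNode k n, s.arr 20 v.index = v.2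

variable {I}

theorem Ready.frame {c : Cmd} {s s' : Store} (h : I.Ready s) (hF : Frame c s s')
    (hv : ∀ x ∈ [0, 1, 4, 5], x ∉ c.vars) (ha : ∀ a ∈ [0, 1, 19, 20], a ∉ c.arrs) :
    I.Ready s' := by
  constructor
  · rw [hF.var 0 (hv 0 (by decide)), h.var0]
  · rw [hF.var 1 (hv 1 (by decide)), h.var1]
  · rw [hF.var 4 (hv 4 (by decide)), h.var4]
  · rw [hF.var 5 (hv 5 (by decide)), h.var5]
  · rw [hF.arr 0 (ha 0 (by decide))]; exact h.arr0
  · rw [hF.arr 1 (ha 1 (by decide))]; exact h.arr1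
  · rw [hF.arr 19 (ha 19 (by decide))]; exact h.arr19
  · rw [hF.arr 20 (ha 20 (by decide))]; exact h.arr20

/-- The word bound that is used throughout. -/
structure Bounds (W k n : ℕ) : Prop where
  one_le_k : 1 ≤ k
  one_le_n : 1 ≤ n
  word : 2 * (k * n) ^ 2 + 4 * (k * n) + 10 ≤ W

variable {W : ℕ}

theorem Bounds.k_le (h : Bounds W k n) : k ≤ k * n := Nat.le_mul_of_pos_right _ h.one_le_n
theorem Bounds.n_le (h : Bounds W k n) : n ≤ k * n := Nat.le_mul_of_pos_left _ h.one_le_k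
theorem Bounds.one_le (h : Bounds W k n) : 1 ≤ k * n := h.one_le_k.trans h.k_le
theorem Bounds.lin (h : Bounds W k n) : 6 * (k * n) + 10 ≤ W := by
  have := h.word
  have : k * n ≤ (k * n) ^ 2 := Nat.le_self_pow (by decide) _
  omega
theorem Bounds.index_lt (h : Bounds W k n) {i c : ℕ} (hi : i < k * n) (hc : c < 2 * (k * n) + 1) :
    i * (2 * (k * n) + 1) + c < W := by
  have h1 := h.word
  have h2 : (i + 1) * (2 * (k * n) + 1) ≤ (k * n) * (2 * (k * n) + 1) := Nat.mul_le_mul_right _ hi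
  nlinarith
theorem Bounds.index_lt' (h : Bounds W k n) {i c : ℕ} (hi : i < k * n) (hc : c < k * n + 1) :
    i * (k * n + 1) + c < W := by
  have := h.index_lt hi (c := c) (by omega)
  nlinarith
theorem Bounds.index_lt'' (h : Bounds W k n) {i c : ℕ} (hi : i < k * n) (hc : c < k * n) :
    i * (k * n) + c < W := by
  have := h.index_lt hi (c := c) (by omega)
  nlinarith
theorem Bounds.index_lt_n (h : Bounds W k n) {i c : ℕ} (hi : i < k * n) (hc : c < n) :
    i * n + c < W := by
  have := h.index_lt hi (c := c) (by have := h.n_le; omega)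
  have := h.n_le
  have : i * n ≤ i * (k * n) := Nat.mul_le_mul_left _ h.n_le
  nlinarith

/-- Computes `k * n`, `2 * (k * n) + 1` and the coordinates of the states. -/
def prepare : Cmd :=
  .assign 4 (.var 0 * .var 1) ⨾ .assign 5 (.var 4 + .var 4 + .const 1) ⨾
  .for 6 (.var 0) (.for 7 (.var 1) (.set 19 (.var 6 * .var 1 + .var 7) (.var 6))) ⨾
  .for 6 (.var 0) (.for 7 (.var 1) (.set 20 (.var 6 * .var 1 + .var 7) (.var 7)))

theorem prepare_runs {s : Store} (hb : Bounds W k n) (hs : I.IsInput s) :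
    Runs W prepare s (200 * (k * n)) I.Ready := by
  obtain ⟨h0, h1, -, hA, -, hB, -, -⟩ := hs
  have hk := hb.k_le
  have hn := hb.n_le
  have h1N := hb.one_le
  have hlin := hb.lin
  refine Runs.seq (T := 4) (R := fun s' => s' = s.setVar 4 (k * n))
    (Runs.of_wp ⟨by simp [h0, h1]; omega, by simp [h0, h1]⟩ (by decide)) (fun s1 _ e1 => ?_)
    (T' := 190 * (k * n)) (by omega)
  refine Runs.seq (T := 6) (R := fun s' => s' = s1.setVar 5 (2 * (k * n) + 1))
    (Runs.of_wp ⟨by simp [e1]; omega, by simp [e1, two_mul]⟩ (by decide)) (fun s2 _ e2 => ?_)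
    (T' := 180 * (k * n)) (by omega)
  have g0 : s2.var 0 = k := by simp [e2, e1, h0]
  have g1 : s2.var 1 = n := by simp [e2, e1, h1]
  have g4 : s2.var 4 = k * n := by simp [e2, e1]
  have g5 : s2.var 5 = 2 * (k * n) + 1 := by simp [e2]
  have gA : s2.arr 0 = s.arr 0 := by simp [e2, e1]
  have gB : s2.arr 1 = s.arr 1 := by simp [e2, e1]
  clear e1 e2
  have htime : k * (n * (10 + 1 + 7) + 1 + 5 + 1 + 7) + 1 + 5 ≤ 40 * (k * n) := by
    have : k * (n * (10 + 1 + 7) + 1 + 5 + 1 + 7) + 1 + 5 = 18 * (k * n) + 14 * k + 6 := by ring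
    omega
  refine Runs.seq (T := 40 * (k * n)) (R := fun s' => ∀ i < k, ∀ j < n, s'.arr 19 (i * n + j) = i)
    (Runs.fill₂ k n 10 (fun i _ => i) (by decide) (by decide) (by decide)
      (fun s' hF => by simpa [g0] using hF.var 0 (by decide)) (by omega)
      (fun s' hF => by simpa [g1] using hF.var 1 (by decide)) (by omega) ?_ htime)
    (fun s3 hF3 e3 => ?_) (T' := 40 * (k * n)) (by omega)
  · intro i hi j hj s' h6 h7 hF
    have e1 := (hF.var 1 (by decide)).trans g1
    refine Runs.of_wp ⟨⟨?_, by simp; omega⟩, ?_⟩ (by decide)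
    · simpa [h6, h7, e1] using hb.index_lt_n (by omega) hj
    · simp [Store.setArr_arr_self, h6, h7, e1]
  have hloop : Runs W (.for 6 (.var 0) (.for 7 (.var 1)
      (.set 20 (.var 6 * .var 1 + .var 7) (.var 7)))) s3 (40 * (k * n))
      (fun s' => ∀ i < k, ∀ j < n, s'.arr 20 (i * n + j) = j) := by
    refine Runs.fill₂ k n 10 (fun _ j => j) (by decide) (by decide) (by decide)
      (fun s' hF => by simpa [g0] using (hF.var 0 (by decide)).trans (hF3.var 0 (by decide)))
      (by omega)
      (fun s' hF => by simpa [g1] using (hF.var 1 (by decide)).trans (hF3.var 1 (by decide)))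
      (by omega) ?_ htime
    intro i hi j hj s' h6 h7 hF
    have e1 := ((hF.var 1 (by decide)).trans (hF3.var 1 (by decide))).trans g1
    refine Runs.of_wp ⟨⟨?_, by simp; omega⟩, ?_⟩ (by decide)
    · simpa [h6, h7, e1] using hb.index_lt_n (by omega) hj
    · simp [Store.setArr_arr_self, h6, h7, e1]
  refine hloop.mono le_rfl fun s4 hF4 e4 => ?_
  · constructor
    · rw [hF4.var 0 (by decide), hF3.var 0 (by decide), g0]
    · rw [hF4.var 1 (by decide), hF3.var 1 (by decide), g1]
    · rw [hF4.var 4 (by decide), hF3.var 4 (by decide), g4]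
    · rw [hF4.var 5 (by decide), hF3.var 5 (by decide), g5]
    · rw [hF4.arr 0 (by decide), hF3.arr 0 (by decide), gA]; exact hA
    · rw [hF4.arr 1 (by decide), hF3.arr 1 (by decide), gB]; exact hB
    · intro v
      rw [hF4.arr 19 (by decide)]
      exact e3 v.1 v.1.2 v.2 v.2.2
    · intro v
      exact e4 v.1 v.1.2 v.2 v.2.2

/-! ## Reachability -/

variable (I) in
/-- Reachability in the state digraph of one subsystem. -/
def Reach : Fin n → Fin n → Prop := Relation.ReflTransGen fun p q => I.A q p = true

theorem inner_star_iff {v w : StateNode k n} :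
    Relation.ReflTransGen I.Inner v w ↔ v.1 = w.1 ∧ I.Reach v.2 w.2 := by
  constructor
  · intro h
    exact ⟨inner_star_fst h, Relation.ReflTransGen.lift Prod.snd (fun _ _ h => h.2) _ _ h⟩
  · rintro ⟨h1, h2⟩
    obtain ⟨i, p⟩ := v
    obtain ⟨j, q⟩ := w
    obtain rfl : i = j := h1
    exact Relation.ReflTransGen.lift (fun p => (i, p)) (fun _ _ h => ⟨rfl, h⟩) _ _ h2

/-- The transitive closure of the state digraph of a subsystem, in array 9. -/
def closure : Cmd :=
  .for 6 (.var 1) (.for 7 (.var 1) (.set 9 (.var 6 * .var 1 + .var 7)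
    (.lt (.const 0) (.eq (.var 6) (.var 7) + .get 0 (.var 7 * .var 1 + .var 6))))) ⨾
  .for 8 (.var 1) (.for 6 (.var 1) (.for 7 (.var 1)
    (.ite (.get 9 (.var 6 * .var 1 + .var 8) * .get 9 (.var 8 * .var 1 + .var 7))
      (.set 9 (.var 6 * .var 1 + .var 7) (.const 1)) .skip)))

open Classical in
/-- Array 9 holds the relation `R`. -/
def HoldsRel (R : Fin n → Fin n → Prop) (s : Store) : Prop :=
  ∀ p q : Fin n, s.arr 9 (p.val * n + q.val) = if R p q then 1 else 0

theorem ite_eq_of_iff {P Q : Prop} {_ : Decidable P} {_ : Decidable Q} (h : P ↔ Q) :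
    (if P then 1 else 0 : ℕ) = if Q then 1 else 0 := if_congr h rfl rfl

/-- Warshall's algorithm on a single subsystem, whose closure serves for all copies. -/
theorem closure_runs {s : Store} (hb : Bounds W k n) (hs : I.Ready s) :
    Runs W closure s (300 * (k * n) ^ 3) (HoldsRel I.Reach) := by
  classical
  have hn := hb.n_le
  have h1n := hb.one_le_n
  have h1N := hb.one_le
  have hlin := hb.lin
  have hsq : n ≤ n ^ 2 := Nat.le_self_pow (by decide) _
  have hcb : n ^ 2 ≤ n ^ 3 := Nat.pow_le_pow_right h1n (by decide)
  have hcb' : n ^ 3 ≤ (k * n) ^ 3 := Nat.pow_le_pow_left hn 3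
  have e1 : ∀ {c s'}, Frame c s s' → 1 ∉ c.vars → s'.var 1 = n := fun hF h =>
    (hF.var 1 h).trans hs.var1
  have hedge : ∀ p q : Fin n, ∀ x, (0 < (if p.val = q.val then 1 else 0) + x ↔ p = q ∨ x ≠ 0) := by
    intro p q x
    by_cases h : p = q
    · simp [h]
    · simp [h, Fin.val_inj, Nat.pos_iff_ne_zero]
  refine Runs.seq (T := 60 * n ^ 3) (R := fun s' => HoldsRel (fun p q => p = q ∨ I.A q p = true) s')
    ((Runs.fill₂ (a := 9) n n 20 (fun i j => if 0 < (if i = j then 1 else 0) +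
        s.arr 0 (j * n + i) then 1 else 0) (by decide) (by decide) (by decide)
      (fun s' hF => by exact e1 hF (by decide)) (by omega)
      (fun s' hF => by exact e1 hF (by decide)) (by omega) ?_
      (by simp only [Expr.time]; nlinarith)).mono le_rfl ?_)
    (fun s1 hF1 h1 => ?_) (T' := 240 * n ^ 3) (by omega)
  · intro i hi j hj s' h6 h7 hF
    have e1 := e1 hF (by decide)
    have e0 := hF.arr 0 (by decide)
    refine Runs.of_wp ⟨⟨?_, ?_⟩, ?_⟩ (by decide)
    · simpa [h6, h7, e1] using hb.index_lt_n (by omega) hj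
    · simp only [Expr.eval_lt]; split_ifs <;> omega
    · simp [Store.setArr_arr_self, h6, h7, e1, e0]
  · intro s' _ h p q
    rw [h p p.2 q q.2]
    congr 1
    rw [hedge, hs.arr0]
    simp
  · have hval : ∀ s' {c}, Frame c s1 s' → 1 ∉ c.vars → s'.var 1 = n := fun s' c hF h =>
      (hF.var 1 h).trans (e1 hF1 (by decide))
    -- Instead of describing `R` by paths with restricted inner nodes, the invariant asks that it
    -- lie between the edges and reachability, be reflexive, and be transitive through all
    -- intermediate nodes below `m`; for `m = n` this forces equality with `Reach`.
    refine (Runs.for (x := 8) n (60 * n ^ 2) (fun m s' => ∃ R : Fin n → Fin n → Prop,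
      HoldsRel R s' ∧ (∀ p, R p p) ∧ (∀ p q, I.A q p = true → R p q) ∧
      (∀ p q, R p q → I.Reach p q) ∧ ∀ j : Fin n, j.val < m → ∀ p q, R p j → R j q → R p q)
      (by decide) (fun s' hF => by exact hval s' hF (by decide)) (by omega) ?_ ?_
      (by simp only [Expr.time]; nlinarith)).mono le_rfl ?_
    · refine ⟨_, h1, fun p => Or.inl rfl, fun p q h => Or.inr h, ?_, fun j hj => by omega⟩
      rintro p q (rfl | h)
      · exact .refl
      · exact .single h
    · rintro m hm s' h8 hF ⟨R, h1, h2, h3, h4, h5⟩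
      -- Row and column `m` do not change during round `m`, so the update can be made in place.
      have hmm : ∀ (p q : Fin n) (t : ℕ), p = ⟨m, hm⟩ ∨ q = ⟨m, hm⟩ →
          ((R p q ∨ (p.val * n + q.val < t ∧ R p ⟨m, hm⟩ ∧ R ⟨m, hm⟩ q)) ↔ R p q) := by
        rintro p q t (rfl | rfl) <;> tauto
      refine (Runs.for₂ n n 30 (fun t s' => HoldsRel (fun p q => R p q ∨
          (p.val * n + q.val < t ∧ R p ⟨m, hm⟩ ∧ R ⟨m, hm⟩ q)) s')
        (by decide) (by decide) (by decide)
        (fun s'' hF' => by exact (hF'.var 1 (by decide)).trans (hval s' hF (by decide)))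
        (by omega)
        (fun s'' hF' => by exact (hF'.var 1 (by decide)).trans (hval s' hF (by decide)))
        (by omega) (fun i s'' u h => ⟨h, h⟩) ?_ ?_
        (by simp only [Expr.time]; nlinarith)).mono le_rfl ?_
      · simpa using h1
      · intro i hi j hj s'' h6 h7 hF' hI
        have g1 := (hF'.var 1 (by decide)).trans (hval s' hF (by decide))
        have g8 := (hF'.var 8 (by decide)).trans h8
        have r1 := hI ⟨i, hi⟩ ⟨m, hm⟩
        have r2 := hI ⟨m, hm⟩ ⟨j, hj⟩
        simp only [hmm ⟨i, hi⟩ ⟨m, hm⟩ _ (Or.inr rfl)] at r1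
        simp only [hmm ⟨m, hm⟩ ⟨j, hj⟩ _ (Or.inl rfl)] at r2
        have hcond : (Expr.get 9 (.var 6 * .var 1 + .var 8) *
            .get 9 (.var 8 * .var 1 + .var 7)).eval s'' ≠ 0 ↔
            R ⟨i, hi⟩ ⟨m, hm⟩ ∧ R ⟨m, hm⟩ ⟨j, hj⟩ := by
          simp only [Expr.eval_mul, Expr.eval_get, Expr.eval_add, Expr.eval_var, h6, h7, g8, g1, r1,
            r2]
          by_cases a1 : R ⟨i, hi⟩ ⟨m, hm⟩ <;> by_cases a2 : R ⟨m, hm⟩ ⟨j, hj⟩ <;> simp [a1, a2]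
        have hkey : ∀ p q : Fin n, (p.val * n + q.val < i * n + j + 1 ↔
            p.val * n + q.val < i * n + j ∨ (p = ⟨i, hi⟩ ∧ q = ⟨j, hj⟩)) := by
          intro p q
          constructor
          · intro h
            rcases Nat.lt_or_ge (p.val * n + q.val) (i * n + j) with h' | h'
            · exact Or.inl h'
            · obtain ⟨h1, h2⟩ := mul_add_inj q.2 hj (by omega : p.val * n + q.val = i * n + j)
              exact Or.inr ⟨Fin.ext h1, Fin.ext h2⟩
          · rintro (h | ⟨rfl, rfl⟩)
            · omega
            · simp
        refine Runs.of_wp ⟨fun hne => ⟨⟨?_, by simp; omega⟩, ?_⟩, fun heq => ?_⟩ (by decide)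
        · simpa [h6, h7, g1] using hb.index_lt_n (by omega) hj
        · have hR := hcond.1 hne
          intro p q
          simp only [Store.setArr_arr, Expr.eval_add, Expr.eval_mul, Expr.eval_var, h6, h7, g1,
            Expr.eval_const, true_and]
          by_cases hpq : p = ⟨i, hi⟩ ∧ q = ⟨j, hj⟩
          · obtain ⟨rfl, rfl⟩ := hpq
            simp [hR]
          · rw [if_neg, hI p q]
            · refine ite_eq_of_iff ?_
              beta_reduce
              rw [hkey]
              tauto
            · intro h
              obtain ⟨h1, h2⟩ := mul_add_inj q.2 hj h
              exact hpq ⟨Fin.ext h1, Fin.ext h2⟩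
        · have hR : ¬ (R ⟨i, hi⟩ ⟨m, hm⟩ ∧ R ⟨m, hm⟩ ⟨j, hj⟩) := fun h => hcond.2 h heq
          intro p q
          rw [hI p q]
          refine ite_eq_of_iff ?_
          beta_reduce
          rw [hkey]
          constructor
          · tauto
          · rintro (h | ⟨h | ⟨rfl, rfl⟩, h'⟩)
            · exact Or.inl h
            · exact Or.inr ⟨h, h'⟩
            · exact absurd h' hR
      · intro s'' _ h
        have hlt : ∀ p q : Fin n, p.val * n + q.val < n * n := by
          intro p q
          have : (p.val + 1) * n ≤ n * n := Nat.mul_le_mul_right _ p.2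
          rw [Nat.add_mul] at this
          have := q.2
          omega
        refine ⟨fun p q => R p q ∨ (R p ⟨m, hm⟩ ∧ R ⟨m, hm⟩ q), fun p q => ?_,
          fun p => Or.inl (h2 p), fun p q h => Or.inl (h3 p q h), ?_, ?_⟩
        · rw [Store.setVar_arr, h p q]
          simp [hlt]
        · rintro p q (h | ⟨h, h'⟩)
          · exact h4 p q h
          · exact (h4 _ _ h).trans (h4 _ _ h')
        · intro j hj p q hpj hjq
          rcases Nat.lt_or_ge j.val m with hjm | hjm
          · have := h5 j hjm
            have a1 := this p q
            have a2 := this p ⟨m, hm⟩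
            have a3 := this ⟨m, hm⟩ q
            tauto
          · obtain rfl : j = ⟨m, hm⟩ := Fin.ext (by simp; omega)
            tauto
    · rintro s' - ⟨⟨R, h1, h2, h3, h4, h5⟩, -⟩
      have : R = I.Reach := by
        ext p q
        refine ⟨h4 p q, fun h => ?_⟩
        induction h with
        | refl => exact h2 p
        | tail _ hbc ih => exact h5 _ (Fin.is_lt _) _ _ ih (h3 _ _ hbc)
      exact this ▸ h1

end CompositeSystem

/-! ## The components in `𝒩` -/

namespace CompositeSystem

open WordRAM

variable {k n W : ℕ} {I : CompositeSystem k n}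

/-- No edge enters the component exactly when everything that reaches `v` is reached back from it;
such a component is inaccessible on its own exactly when it contains no input state. This is a test
by one pass over the subsystem. -/
theorem component_mem_comps {v : StateNode k n} : I.component v ∈ I.comps ↔
    ∀ q, I.Reach q v.2 → I.Reach v.2 q ∧ I.B (v.1, q) = false := by
  rw [mem_comps]
  constructor
  · rintro ⟨⟨h1, h2⟩, h3⟩ q hq
    have hmem : ∀ w, Relation.ReflTransGen I.Inner w v → w ∈ I.component v := by
      intro w hw
      induction hw using Relation.ReflTransGen.head_induction_on with
      | refl => exact self_mem_component v
      | head h _ ih => exact by_contra fun hn => h2 _ _ hn ih h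
    have hq' := hmem (v.1, q) (inner_star_iff.2 ⟨rfl, hq⟩)
    refine ⟨(inner_star_iff.1 (mem_component.1 hq').1).2, ?_⟩
    by_contra hB
    exact h3 (h1.accessibleSet I hq' ⟨_, by simpa using hB, .refl⟩)
  · intro h
    refine ⟨⟨isSCC_component v, fun w u hw hu hwu => hw ?_⟩, fun hacc => ?_⟩
    · have := (mem_component.1 hu).2.head hwu
      obtain ⟨h1, h2⟩ := inner_star_iff.1 this
      exact mem_component.2 ⟨inner_star_iff.2 ⟨h1.symm, (h _ h2).1⟩, this⟩
    · obtain ⟨w, hw, hp⟩ := hacc v (self_mem_component v)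
      have := Relation.ReflTransGen.mono (p := I.Inner)
        (fun a b (h : I.Inner a b ∨ (a, b) ∈ (∅ : Set _)) => by simpa using h) _ _ hp
      obtain ⟨h1, h2⟩ := inner_star_iff.1 this
      have := (h _ h2).2
      rw [← h1, Prod.mk.eta, hw] at this
      simp at this

theorem mem_component_iff {v w : StateNode k n} :
    w ∈ I.component v ↔ w.1 = v.1 ∧ I.Reach v.2 w.2 ∧ I.Reach w.2 v.2 := by
  rw [mem_component, inner_star_iff, inner_star_iff]
  tauto

variable (I) in
/-- The index of the first state of the component of `v`. -/
noncomputable def first (v : StateNode k n) : ℕ :=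
  sInf {m | ∃ w ∈ I.component v, m = w.index}

theorem first_eq_of_isLeast {v : StateNode k n} {c : ℕ}
    (h : ∃ w ∈ I.component v, c = w.index) (h' : ∀ w ∈ I.component v, c ≤ w.index) :
    I.first v = c := by
  refine IsLeast.csInf_eq ⟨h, ?_⟩
  rintro _ ⟨w, hw, rfl⟩
  exact h' w hw

theorem exists_first_eq (v : StateNode k n) : ∃ w ∈ I.component v, I.first v = w.index :=
  Nat.sInf_mem (s := {m | ∃ w ∈ I.component v, m = w.index})
    ⟨_, v, self_mem_component v, rfl⟩

theorem first_le {v w : StateNode k n} (h : w ∈ I.component v) : I.first v ≤ w.index :=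
  Nat.sInf_le ⟨w, h, rfl⟩

theorem first_lt (v : StateNode k n) : I.first v < k * n :=
  (first_le (self_mem_component v)).trans_lt (index_lt v)

theorem first_eq_index_iff {v : StateNode k n} :
    I.first v = v.index ↔ ∀ w ∈ I.component v, v.index ≤ w.index :=
  ⟨fun h _ hw => h ▸ first_le hw, first_eq_of_isLeast ⟨v, self_mem_component v, rfl⟩⟩

theorem component_eq_of_first_eq {v w : StateNode k n} (h : I.first v = I.first w) :
    I.component v = I.component w := by
  obtain ⟨x, hx, hx'⟩ := I.exists_first_eq v
  obtain ⟨y, hy, hy'⟩ := I.exists_first_eq w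
  have : x = y := index_inj (by rw [← hx', ← hy', h])
  rw [← component_eq hx, ← component_eq hy, this]

open Classical in
/-- Array 11 marks the states in a component in `𝒩`, array 10 holds the first states. -/
def HoldsComps (I : CompositeSystem k n) (s : Store) : Prop :=
  ∀ v, s.arr 11 v.index = (if I.component v ∈ I.comps then 1 else 0) ∧ s.arr 10 v.index = I.first v

/-- Computes, for every state, whether its component is in `𝒩`, and the first state of it. -/
def components : Cmd :=
  .for 6 (.var 4) (.assign 8 (.const 1) ⨾ .assign 9 (.var 6) ⨾
    .for 7 (.var 1)
      (.ite (.get 9 (.var 7 * .var 1 + .get 20 (.var 6)))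
        (.ite (.get 9 (.get 20 (.var 6) * .var 1 + .var 7))
          (.assign 10 (.get 19 (.var 6) * .var 1 + .var 7) ⨾
            .ite (.lt (.var 10) (.var 9)) (.assign 9 (.var 10)) .skip ⨾
            .ite (.get 1 (.var 10)) (.assign 8 (.const 0)) .skip)
          (.assign 8 (.const 0))) .skip) ⨾
    .set 11 (.var 6) (.var 8) ⨾ .set 10 (.var 6) (.var 9))

theorem components_runs {s : Store} (hb : Bounds W k n) (hs : I.Ready s)
    (hr : HoldsRel I.Reach s) : Runs W components s (200 * (k * n) ^ 2) I.HoldsComps := by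
  classical
  have hn := hb.n_le
  have h1N := hb.one_le
  have hlin := hb.lin
  have hsq : k * n ≤ (k * n) ^ 2 := Nat.le_self_pow (by decide) _
  refine (Runs.for (x := 6) (k * n) (100 * (k * n)) (fun t s' => ∀ v : StateNode k n, v.index < t →
    s'.arr 11 v.index = (if I.component v ∈ I.comps then 1 else 0) ∧ s'.arr 10 v.index = I.first v)
    (by decide) (fun s' hF => by exact (hF.var 4 (by decide)).trans hs.var4) (by omega)
    (by simp) ?_ (by simp only [Expr.time]; nlinarith)).mono le_rfl
    (fun s' _ h v => h.1 v (index_lt v))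
  intro i hi s1 h6 hF1 hI1
  obtain ⟨v, rfl⟩ := exists_index hi
  have hs1 : I.Ready s1 := hs.frame hF1 (by decide) (by decide)
  have hr1 : HoldsRel I.Reach s1 := by
    intro p q
    rw [hF1.arr 9 (by decide)]
    exact hr p q
  refine Runs.seq (T := 2) (R := fun s' => s' = s1.setVar 8 1)
    (Runs.of_wp ⟨by simp; omega, rfl⟩ (by decide)) (fun s2 hF2 e2 => ?_)
    (T' := 90 * (k * n)) (by omega)
  refine Runs.seq (T := 2) (R := fun s' => s' = s2.setVar 9 v.index)
    (Runs.of_wp ⟨by simp [e2, h6]; omega, by simp [e2, h6]⟩ (by decide)) (fun s3 hF3 e3 => ?_)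
    (T' := 80 * (k * n)) (by omega)
  have a3 : s3.arr = s1.arr := by simp [e3, e2]
  have v3 : ∀ x, x ≠ 8 → x ≠ 9 → s3.var x = s1.var x := by
    intro x h8 h9
    simp [e3, e2, h8, h9]
  have h38 : s3.var 8 = 1 := by simp [e3, e2]
  have h39 : s3.var 9 = v.index := by simp [e3]
  refine Runs.seq (T := 60 * (k * n)) (R := fun s' =>
      s'.var 8 = (if I.component v ∈ I.comps then 1 else 0) ∧ s'.var 9 = I.first v)
    -- Variable 8 records whether the criterion `component_mem_comps` holds so far. Variable 9 is
    -- the least index found; it starts with that of `v`, so it always belongs to the component.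
    ((Runs.for (x := 7) n 40 (fun j s' =>
      s'.var 8 = (if ∀ q : Fin n, q.val < j → I.Reach q v.2 →
        I.Reach v.2 q ∧ I.B (v.1, q) = false then 1 else 0) ∧
      (∃ w ∈ I.component v, s'.var 9 = w.index) ∧
      ∀ w ∈ I.component v, w.2.val < j → s'.var 9 ≤ w.index) (by decide)
      (fun s' hF => by
        exact (hF.var 1 (by decide)).trans
          ((v3 1 (by decide) (by decide)).trans hs1.var1))
      (by omega) ?_ ?_ (by simp only [Expr.time]; omega)).mono le_rfl ?_)
    (fun s4 hF4 h4 => ?_) (T' := 6) (by omega)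
  · refine ⟨by simp [h38], ⟨v, self_mem_component v, by simp [h39]⟩, by simp⟩
  · intro j hj s4 h7 hF4 hI4
    obtain ⟨h48, ⟨w, hw, h49⟩, hmin⟩ := hI4
    have g6 : s4.var 6 = v.index := by
      rw [hF4.var 6 (by decide), v3 6 (by decide) (by decide), h6]
    have g1 : s4.var 1 = n := by
      rw [hF4.var 1 (by decide), v3 1 (by decide) (by decide), hs1.var1]
    have g19 : s4.arr 19 v.index = v.1 := by
      rw [hF4.arr 19 (by decide), a3]; exact hs1.arr19 v
    have g20 : s4.arr 20 v.index = v.2 := by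
      rw [hF4.arr 20 (by decide), a3]; exact hs1.arr20 v
    have gB : s4.arr 1 (v.1.val * n + j) = if I.B (v.1, ⟨j, hj⟩) then 1 else 0 := by
      rw [hF4.arr 1 (by decide), a3]; exact hs1.arr1 (v.1, ⟨j, hj⟩)
    have r1 : s4.arr 9 (j * n + v.2.val) = if I.Reach ⟨j, hj⟩ v.2 then 1 else 0 := by
      rw [hF4.arr 9 (by decide), a3]; exact hr1 ⟨j, hj⟩ v.2
    have r2 : s4.arr 9 (v.2.val * n + j) = if I.Reach v.2 ⟨j, hj⟩ then 1 else 0 := by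
      rw [hF4.arr 9 (by decide), a3]; exact hr1 v.2 ⟨j, hj⟩
    have hlt : v.1.val * n + j < k * n := index_lt (v.1, (⟨j, hj⟩ : Fin n))
    have hsplit : ∀ p : Fin n → Prop, ((∀ q : Fin n, q.val < j + 1 → p q) ↔
        (∀ q : Fin n, q.val < j → p q) ∧ p ⟨j, hj⟩) := by
      intro p
      refine ⟨fun h => ⟨fun q hq => h q (by omega), h _ (by simp)⟩, fun h q hq => ?_⟩
      rcases Nat.lt_or_ge q.val j with h' | h'
      · exact h.1 q h'
      · obtain rfl : q = ⟨j, hj⟩ := Fin.ext (by simp; omega)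
        exact h.2
    have hmin' : ∀ c ≤ s4.var 9, ((v.1, ⟨j, hj⟩) ∈ I.component v → c ≤ v.1.val * n + j) →
        ∀ w ∈ I.component v, w.2.val < j + 1 → c ≤ w.index := by
      intro c hc hcj w hw hlt
      rcases Nat.lt_or_ge w.2.val j with h' | h'
      · exact hc.trans (hmin w hw h')
      · obtain rfl : w = (v.1, ⟨j, hj⟩) :=
          Prod.ext (mem_component_iff.1 hw).1 (Fin.ext (by simp; omega))
        exact hcj hw
    have hmem : (v.1, ⟨j, hj⟩) ∈ I.component v ↔ I.Reach v.2 ⟨j, hj⟩ ∧ I.Reach ⟨j, hj⟩ v.2 := by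
      simp [mem_component_iff]
    refine Runs.of_wp ?_ (by decide)
    simp only [Cmd.wp, Expr.eval_get, Expr.eval_add, Expr.eval_mul, Expr.eval_var,
      Expr.eval_const, Expr.eval_lt, Store.setVar_var, Store.setVar_arr, g6, g1, g19, g20, gB, r1,
      r2, h7, ite_true, reduceIte, Nat.reduceEqDiff, h48, ne_eq, ite_eq_right_iff, one_ne_zero,
      imp_false, not_not, not_lt,
      Bool.not_eq_true, hsplit]
    have hkeep := hmin' (s4.var 9) le_rfl
    refine ⟨fun a1 => ⟨fun a2 => ⟨by omega, fun a4 => ⟨by omega, fun a3 => ⟨by omega, ?_, ?_, ?_⟩,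
      fun a3 => ⟨?_, ?_, ?_⟩⟩, fun a4 => ⟨fun a3 => ⟨by omega, ?_, ⟨w, hw, h49⟩, ?_⟩,
      fun a3 => ⟨?_, ⟨w, hw, h49⟩, ?_⟩⟩⟩, fun a2 => ⟨by omega, ?_, ⟨w, hw, h49⟩, ?_⟩⟩,
      fun a1 => ⟨?_, ⟨w, hw, h49⟩, ?_⟩⟩
    · simp [a1, a3]
    · exact ⟨_, hmem.2 ⟨a2, a1⟩, rfl⟩
    · exact hmin' _ (by omega) fun _ => le_rfl
    · simp [a1, a2, a3]
    · exact ⟨_, hmem.2 ⟨a2, a1⟩, rfl⟩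
    · exact hmin' _ (by omega) fun _ => le_rfl
    · simp [a1, a3]
    · exact hkeep fun _ => a4
    · simp [a1, a2, a3]
    · exact hkeep fun _ => a4
    · simp [a1, a2]
    · exact hkeep fun h => absurd (hmem.1 h).1 a2
    · simp [a1]
    · exact hkeep fun h => absurd (hmem.1 h).2 a1
  · rintro s4 - ⟨⟨h1, h2, h3⟩, -⟩
    refine ⟨?_, (first_eq_of_isLeast h2 fun w hw => h3 w hw w.2.2).symm⟩
    rw [h1]
    exact ite_eq_of_iff (by simp [component_mem_comps])
  · have g6 : s4.var 6 = v.index := by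
      rw [hF4.var 6 (by decide), v3 6 (by decide) (by decide), h6]
    have g10 : s4.arr 10 = s1.arr 10 := by rw [hF4.arr 10 (by decide), a3]
    have g11 : s4.arr 11 = s1.arr 11 := by rw [hF4.arr 11 (by decide), a3]
    have hfl := I.first_lt v
    refine Runs.of_wp ?_ (by decide)
    simp only [Cmd.wp, Expr.eval_var, Store.setVar_arr, Store.setArr_arr, Store.setArr_var, g6,
      h4.1, h4.2, g10, g11]
    refine ⟨⟨by omega, by split_ifs <;> omega⟩, ⟨by omega, by omega⟩, fun u hu => ?_⟩
    by_cases huv : u = v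
    · subst huv; simp
    · have hne : u.index ≠ v.index := fun h => huv (index_inj h)
      simpa [hne] using hI1 u (by omega)

end CompositeSystem

/-! ## The bipartite graphs -/

namespace CompositeSystem

open WordRAM

variable {k n W : ℕ} {I : CompositeSystem k n}

theorem exists_component_eq {S : Finset (StateNode k n)} (hS : S ∈ I.comps) :
    ∃ v ∈ S, S = I.component v := by
  have h := (I.mem_comps.1 hS).1.1
  obtain ⟨v, hv⟩ := h
  have hvS := (hv v).2 ⟨.refl, .refl⟩
  exact ⟨v, hvS, IsSCC.eq_component ⟨v, hv⟩ hvS⟩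

theorem code_state (v : StateNode k n) : (RightNode.state v).code = v.index := rfl
theorem code_input : (RightNode.input : RightNode k n).code = k * n := rfl
theorem code_component (v : StateNode k n) :
    (RightNode.scc (I.component v)).code = k * n + 1 + I.first v := rfl

theorem code_lt {r : RightNode k n} (hr : r ∈ I.graphN.right) : r.code < 2 * (k * n) + 1 := by
  cases r with
  | state v => rw [code_state]; have := index_lt v; omega
  | input => rw [code_input]; omega
  | scc S =>
    obtain ⟨v, -, rfl⟩ := exists_component_eq (scc_mem_rightN I |>.1 hr)
    rw [code_component]
    have := I.first_lt v
    omega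

/-- The components occupy the last columns, so the nodes of `ℬ(A, B)` are recognized by a
comparison. -/
theorem code_lt_iff {r : RightNode k n} (hr : r ∈ I.graphN.right) :
    r.code < k * n + 1 ↔ r ∈ I.graph.right := by
  cases r with
  | state v => rw [code_state]; have := index_lt v; simp; omega
  | input => simp [code_input]
  | scc S =>
    obtain ⟨v, -, rfl⟩ := exists_component_eq (scc_mem_rightN I |>.1 hr)
    simp [code_component, Nat.add_assoc]

theorem code_inj {r r' : RightNode k n} (hr : r ∈ I.graphN.right) (hr' : r' ∈ I.graphN.right)
    (h : r.code = r'.code) : r = r' := by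
  cases r with
  | state v =>
    have hv := index_lt v
    cases r' with
    | state w => rw [code_state, code_state] at h; rw [index_inj h]
    | input => rw [code_state, code_input] at h; omega
    | scc S =>
      obtain ⟨w, -, rfl⟩ := exists_component_eq (scc_mem_rightN I |>.1 hr')
      rw [code_state, code_component] at h; omega
  | input =>
    cases r' with
    | state w => have := index_lt w; rw [code_state, code_input] at h; omega
    | input => rfl
    | scc S =>
      obtain ⟨w, -, rfl⟩ := exists_component_eq (scc_mem_rightN I |>.1 hr')
      rw [code_input, code_component] at h; omega
  | scc S =>
    obtain ⟨v, -, rfl⟩ := exists_component_eq (scc_mem_rightN I |>.1 hr)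
    cases r' with
    | state w => have := index_lt w; rw [code_state, code_component] at h; omega
    | input => rw [code_input, code_component] at h; omega
    | scc S =>
      obtain ⟨w, -, rfl⟩ := exists_component_eq (scc_mem_rightN I |>.1 hr')
      rw [code_component, code_component] at h
      rw [component_eq_of_first_eq (by omega : I.first v = I.first w)]

/-- Writes the adjacency matrix of `ℬ(A, B)` and the cost matrix of `ℬ(A, B, 𝒩)`. -/
def graphs : Cmd :=
  .for 6 (.var 4) (.for 7 (.var 4 + .const 1)
    (.ite (.lt (.var 7) (.var 4))
      (.ite (.eq (.get 19 (.var 6)) (.get 19 (.var 7)))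
        (.set 2 (.var 6 * (.var 4 + .const 1) + .var 7)
          (.get 0 (.get 20 (.var 6) * .var 1 + .get 20 (.var 7))))
        (.set 2 (.var 6 * (.var 4 + .const 1) + .var 7) (.const 1)))
      (.set 2 (.var 6 * (.var 4 + .const 1) + .var 7) (.get 1 (.var 6))))) ⨾
  .for 6 (.var 4) (.for 7 (.var 5)
    (.ite (.lt (.var 7) (.var 4))
      (.ite (.eq (.get 19 (.var 6)) (.get 19 (.var 7)))
        (.set 3 (.var 6 * .var 5 + .var 7)
          (.const 2 * .get 0 (.get 20 (.var 6) * .var 1 + .get 20 (.var 7))))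
        (.set 3 (.var 6 * .var 5 + .var 7) (.const 4)))
      (.ite (.eq (.var 7) (.var 4)) (.set 3 (.var 6 * .var 5 + .var 7) (.get 1 (.var 6)))
        (.set 3 (.var 6 * .var 5 + .var 7)
          (.const 3 * (.get 11 (.var 6) *
            .eq (.var 7) (.var 4 + .const 1 + .get 10 (.var 6))))))))

theorem graphs_runs {s : Store} (hb : Bounds W k n) (hs : I.Ready s) (hc : I.HoldsComps s) :
    Runs W graphs s (1000 * (k * n) ^ 2) I.HoldsGraphs := by
  classical
  have hn := hb.n_le
  have h1N := hb.one_le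
  have hlin := hb.lin
  have hsq : k * n ≤ (k * n) ^ 2 := Nat.le_self_pow (by decide) _
  refine Runs.seq (T := 300 * (k * n) ^ 2) (R := fun s' =>
      ∀ i < k * n, ∀ j < k * n + 1, s'.arr 2 (i * (k * n + 1) + j) =
        if j < k * n then
          if s.arr 19 i = s.arr 19 j then s.arr 0 (s.arr 20 i * n + s.arr 20 j) else 1
        else s.arr 1 i)
    (Runs.fill₂ (a := 2) (k * n) (k * n + 1) 70 (fun i j =>
        if j < k * n then
          if s.arr 19 i = s.arr 19 j then s.arr 0 (s.arr 20 i * n + s.arr 20 j) else 1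
        else s.arr 1 i) (by decide) (by decide) (by decide)
      (fun s' hF => by exact (hF.var 4 (by decide)).trans hs.var4) (by omega)
      (fun s' hF => by
        have := (hF.var 4 (by decide)).trans hs.var4
        simpa using this) (by omega) ?_
      (by
        have : k * n * ((k * n + 1) * (70 + (1 + 1 + 1) + 7) + (1 + 1 + 1) + 5 + 1 + 7) + 1 + 5 =
          80 * (k * n) ^ 2 + 96 * (k * n) + 6 := by ring
        simp only [Expr.time]
        omega))
    (fun s1 hF1 h1 => ?_) (T' := 600 * (k * n) ^ 2) (by omega)
  · intro i hi j hj s' h6 h7 hF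
    have hs' : I.Ready s' := hs.frame hF (by decide) (by decide)
    have g19 : s'.arr 19 = s.arr 19 := hF.arr 19 (by decide)
    have g20 : s'.arr 20 = s.arr 20 := hF.arr 20 (by decide)
    have g0 : s'.arr 0 = s.arr 0 := hF.arr 0 (by decide)
    have g1 : s'.arr 1 = s.arr 1 := hF.arr 1 (by decide)
    have hlt := hb.index_lt' hi hj
    obtain ⟨v, rfl⟩ := exists_index hi
    have hB := hs.arr1 v
    have hA : ∀ w : StateNode k n, w.index = j →
        s.arr 0 (s.arr 20 v.index * n + s.arr 20 j) < W := by
      rintro w rfl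
      rw [hs.arr20, hs.arr20, hs.arr0]
      split_ifs <;> omega
    have hB' : s.arr 1 v.index < W := by rw [hB]; split_ifs <;> omega
    refine Runs.of_wp ?_ (by decide)
    simp only [Cmd.wp, Expr.eval_get, Expr.eval_add, Expr.eval_mul, Expr.eval_var,
      Expr.eval_const, Expr.eval_lt, Expr.eval_eq, h6, h7, g19, g20, g0, g1, hs'.var1, hs'.var4,
      ne_eq, ite_eq_right_iff, one_ne_zero, imp_false, not_not, Store.setArr_arr_self]
    refine ⟨fun c1 => ⟨fun c2 => ⟨⟨hlt, ?_⟩, ?_⟩, fun c2 => ⟨⟨hlt, by omega⟩, ?_⟩⟩,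
      fun c1 => ⟨⟨hlt, hB'⟩, ?_⟩⟩
    · obtain ⟨w, hw⟩ := exists_index c1
      exact hA w hw
    · simp [c1, c2]
    · simp [c1, c2]
    · simp [c1]
  -- Entries are costs increased by one: 2 inside a subsystem, 4 for interconnections, 1 for the
  -- input, 3 for components. In the component columns, row `i` has at most one entry, in the column
  -- numbered through the first state of its own component.
  refine (Runs.fill₂ (a := 3) (k * n) (2 * (k * n) + 1) 120 (fun i j =>
      if j < k * n then if s.arr 19 i = s.arr 19 j then 2 * s.arr 0 (s.arr 20 i * n + s.arr 20 j)
        else 4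
      else if j = k * n then s.arr 1 i else
        3 * (s.arr 11 i * if j = k * n + 1 + s.arr 10 i then 1 else 0))
    (by decide) (by decide) (by decide)
    (fun s' hF => by exact (hF.var 4 (by decide)).trans ((hF1.var 4 (by decide)).trans hs.var4))
    (by omega)
    (fun s' hF => by exact (hF.var 5 (by decide)).trans ((hF1.var 5 (by decide)).trans hs.var5))
    (by omega) ?_ (T' := 600 * (k * n) ^ 2) (by
      have : k * n * ((2 * (k * n) + 1) * (120 + 1 + 7) + 1 + 5 + 1 + 7) + 1 + 5 =
        256 * (k * n) ^ 2 + 142 * (k * n) + 6 := by ring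
      simp only [Expr.time]
      omega)).mono le_rfl
    (fun s2 hF2 h2 => ?_)
  · intro i hi j hj s' h6 h7 hF
    have hs' : I.Ready s' := (hs.frame hF1 (by decide) (by decide)).frame hF (by decide) (by decide)
    have g19 : s'.arr 19 = s.arr 19 := (hF.arr 19 (by decide)).trans (hF1.arr 19 (by decide))
    have g20 : s'.arr 20 = s.arr 20 := (hF.arr 20 (by decide)).trans (hF1.arr 20 (by decide))
    have g10 : s'.arr 10 = s.arr 10 := (hF.arr 10 (by decide)).trans (hF1.arr 10 (by decide))
    have g11 : s'.arr 11 = s.arr 11 := (hF.arr 11 (by decide)).trans (hF1.arr 11 (by decide))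
    have g0 : s'.arr 0 = s.arr 0 := (hF.arr 0 (by decide)).trans (hF1.arr 0 (by decide))
    have g1 : s'.arr 1 = s.arr 1 := (hF.arr 1 (by decide)).trans (hF1.arr 1 (by decide))
    have hlt := hb.index_lt hi hj
    obtain ⟨v, rfl⟩ := exists_index hi
    have hA : ∀ w : StateNode k n, w.index = j →
        2 * s.arr 0 (s.arr 20 v.index * n + s.arr 20 j) < W := by
      rintro w rfl
      rw [hs.arr20, hs.arr20, hs.arr0]
      split_ifs <;> omega
    have hB' : s.arr 1 v.index < W := by rw [hs.arr1 v]; split_ifs <;> omega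
    have hC : 3 * (s.arr 11 v.index * if j = k * n + 1 + s.arr 10 v.index then 1 else 0) < W := by
      rw [(hc v).1]
      split_ifs <;> omega
    refine Runs.of_wp ?_ (by decide)
    simp only [Cmd.wp, Expr.eval_get, Expr.eval_add, Expr.eval_mul, Expr.eval_var,
      Expr.eval_const, Expr.eval_lt, Expr.eval_eq, h6, h7, g19, g20, g10, g11, g0, g1, hs'.var1,
      hs'.var4, hs'.var5,
      ne_eq, ite_eq_right_iff, one_ne_zero, imp_false, not_not, Store.setArr_arr_self]
    refine ⟨fun c1 => ⟨fun c2 => ⟨⟨hlt, ?_⟩, ?_⟩, fun c2 => ⟨⟨hlt, by omega⟩, ?_⟩⟩,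
      fun c1 => ⟨fun c2 => ⟨⟨hlt, hB'⟩, ?_⟩, fun c2 => ⟨⟨hlt, hC⟩, ?_⟩⟩⟩
    · obtain ⟨w, hw⟩ := exists_index c1
      exact hA w hw
    · simp [c1, c2]
    · simp [c1, c2]
    · simp [c2]
    · simp [c1, c2]
  · refine ⟨fun v r hr => ?_, fun v r hr => ?_, fun v m hm hne => ?_⟩
    · rw [hF2.arr 2 (by decide), h1 _ (index_lt v) _ ((code_lt_iff (I.right_subset hr)).2 hr)]
      simp only [mem_edges, hr, true_and]
      cases r with
      | state w =>
        rw [code_state, if_pos (index_lt w), hs.arr19, hs.arr19, hs.arr20, hs.arr20, hs.arr0]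
        by_cases hvw : v.1 = w.1 <;> simp [BipAdj, hvw, Fin.val_inj]
      | input =>
        rw [code_input, if_neg (lt_irrefl _), hs.arr1]
        exact ite_eq_of_iff Iff.rfl
      | scc S => simp at hr
    · rw [h2 _ (index_lt v) _ (code_lt hr)]
      simp only [mem_edgesN, hr, true_and]
      cases r with
      | state w =>
        rw [code_state, if_pos (index_lt w), hs.arr19, hs.arr19, hs.arr20, hs.arr20, hs.arr0]
        by_cases hvw : v.1 = w.1 <;> simp [BipAdj, cost, hvw, Fin.val_inj]
      | input => simp [code_input, BipAdj, cost, hs.arr1 v]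
      | scc S =>
        have hS := (scc_mem_rightN I).1 hr
        obtain ⟨u, -, rfl⟩ := exists_component_eq hS
        rw [code_component, if_neg (by omega), if_neg (by omega), (hc v).1, (hc v).2]
        simp only [BipAdj, cost, hS, true_and]
        by_cases hvu : v ∈ I.component u
        · have hcomp := component_eq hvu
          have hf : I.first u = I.first v := by rw [first, first, hcomp]
          rw [hcomp, if_pos hS, if_pos (by omega), if_pos hvu]
        · rw [if_neg hvu]
          by_cases hf : k * n + 1 + I.first u = k * n + 1 + I.first v
          · exact absurd (component_eq_of_first_eq (by omega : I.first u = I.first v) ▸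
              self_mem_component v) hvu
          · rw [if_neg hf, mul_zero, mul_zero]
    · rw [h2 _ (index_lt v) _ hm]
      have h1 : ¬ m < k * n := fun h => by
        obtain ⟨w, hw⟩ := exists_index h
        exact hne (.state w) (by simp) hw
      have h2 : m ≠ k * n := fun h => hne .input (by simp) h.symm
      rw [if_neg h1, if_neg h2, (hc v).1, (hc v).2]
      by_cases hv : I.component v ∈ I.comps
      · have h3 : m ≠ k * n + 1 + I.first v := fun h =>
          hne (.scc (I.component v)) (by simpa using hv) h.symm
        rw [if_neg h3, mul_zero, mul_zero]
      · simp [hv]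

end CompositeSystem

/-! ## The matching that the matching program finds -/

namespace Kuhn

/-- The prefixes of lengths `1`, `N + 1` and `2 * N + 1` correspond to the three cost levels: the
input, then also the states, then also the components. -/
theorem order_lt {N o l : ℕ} (ho : o < l) (h : l = 1 ∨ l = N + 1 ∨ l = 2 * N + 1) :
    order N o < 2 * N + 1 ∧ (l = 1 → order N o = N) ∧
      (l = N + 1 → order N o < N + 1) := by
  unfold order
  split_ifs <;> omega

theorem exists_order {N c : ℕ} (hc : c < 2 * N + 1) :
    ∃ o < 2 * N + 1, c = order N o ∧ (c = N → o < 1) ∧ (c < N + 1 → o < N + 1) := by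
  unfold order
  rcases lt_trichotomy c N with h | rfl | h
  · exact ⟨c + 1, by omega, by rw [if_neg (by omega), if_pos (by omega)]; rfl, by omega, by omega⟩
  · exact ⟨0, by omega, by simp, by omega, by omega⟩
  · exact ⟨c, hc, by rw [if_neg (by omega), if_neg (by omega)], by omega, by omega⟩

end Kuhn

namespace CompositeSystem

open WordRAM

variable {k n W : ℕ} {I : CompositeSystem k n} {m : StateNode k n → Option (RightNode k n)}
  {f : ℕ → ℕ} {s : Store}

variable (I) in
/-- `f` holds the code numbers of the partners in `m`, increased by one. -/
structure Encodes (m : StateNode k n → Option (RightNode k n)) (f : ℕ → ℕ) : Prop where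
  some : ∀ {v r}, m v = some r → r ∈ I.graphN.right ∧ f v.index = r.code + 1
  none : ∀ {v}, m v = none → f v.index = 0

theorem Encodes.eq_some_iff (h : I.Encodes m f) {v : StateNode k n} {r : RightNode k n} :
    m v = .some r ↔ r ∈ I.graphN.right ∧ f v.index = r.code + 1 := by
  refine ⟨h.some, fun ⟨hr, hf⟩ => ?_⟩
  cases hm : m v with
  | none => have := h.none hm; omega
  | some r' =>
    obtain ⟨hr', hf'⟩ := h.some hm
    rw [code_inj hr hr' (by omega)]

theorem Encodes.state_iff (h : I.Encodes m f) {v w : StateNode k n} :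
    m v = .some (.state w) ↔ f v.index = w.index + 1 := by
  simp [h.eq_some_iff, code_state]

theorem Encodes.input_iff (h : I.Encodes m f) {v : StateNode k n} :
    m v = .some .input ↔ f v.index = k * n + 1 := by
  simp [h.eq_some_iff, code_input]

theorem Encodes.isStart_iff (h : I.Encodes m f) {v : StateNode k n} :
    IsStart m v ↔ f v.index = 0 ∨ k * n + 1 < f v.index := by
  cases hm : m v with
  | none => simp [IsStart, hm, h.none hm]
  | some r =>
    obtain ⟨hr, hf⟩ := h.some hm
    have := code_lt_iff hr
    cases r with
    | state w => simp at this; simp [IsStart, hm, hf, this]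
    | input => simp [IsStart, hm, hf, code_input]
    | scc S => simp at this; simp [IsStart, hm, hf, this]

theorem Encodes.lt (h : I.Encodes m f) (v : StateNode k n) : f v.index ≤ 2 * (k * n) + 1 := by
  cases hm : m v with
  | none => simp [h.none hm]
  | some r =>
    obtain ⟨hr, hf⟩ := h.some hm
    have := code_lt hr
    omega

theorem cheap_iff (h : I.HoldsGraphs s) {v : StateNode k n} {r : RightNode k n}
    (hr : r ∈ I.graphN.right) : Kuhn.Cheap (k * n) (s.arr 3) v.index r.code ↔ I.Low v r := by
  rw [Kuhn.Cheap, h.2.1 v r hr, low_iff]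
  have he : (v, r) ∈ I.graphN.edges ↔ I.BipAdj v r := by simp [mem_edgesN, hr]
  by_cases hadj : I.BipAdj v r
  · rw [if_pos (he.2 hadj)]
    simp only [hadj, true_and]
    omega
  · rw [if_neg fun h => hadj (he.1 h)]
    simp [hadj]

/-- Carries a certificate from column numbers to nodes. Columns that number no component may occur
in `D` and are discarded; no partner is lost, since partners are nodes. -/
theorem Encodes.certifies (h : I.Encodes m f) (hG : I.HoldsGraphs s)
    (hS : Kuhn.Stage (k * n) (Kuhn.Cheap (k * n) (s.arr 3)) f (2 * (k * n) + 1)) {l : ℕ}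
    (hl : l ≤ 2 * (k * n) + 1) {R : Finset (RightNode k n)}
    (hR : ∀ r, r ∈ R ↔ r ∈ I.graphN.right ∧ ∃ o < l, r.code = Kuhn.order (k * n) o) :
    ∃ D, I.Certifies m R D := by
  obtain ⟨D, hD1, hD2, hD3⟩ := hS.cert l hl
  refine ⟨R.filter fun r => r.code ∈ D, Finset.filter_subset _ _, fun r hr hm => ?_,
    fun v r hr hv => ?_⟩
  · obtain ⟨hrN, o, ho, hro⟩ := (hR r).1 hr
    refine Finset.mem_filter.2 ⟨hr, hro ▸ hD2 o ho ?_⟩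
    rintro ⟨w, hw, hf⟩
    obtain ⟨v, rfl⟩ := exists_index hw
    exact hm v (h.eq_some_iff.2 ⟨hrN, hro ▸ hf⟩)
  · obtain ⟨hr, hrD⟩ := Finset.mem_filter.1 hr
    have hrN := ((hR r).1 hr).1
    obtain ⟨c', hc', hf⟩ := hD3 _ (index_lt v) _ hrD ((cheap_iff hG hrN).2 hv)
    cases hm : m v with
    | none => have := h.none hm; omega
    | some r' =>
      obtain ⟨hr', hf'⟩ := h.some hm
      have : r'.code = c' := by omega
      exact ⟨r', Finset.mem_filter.2 ⟨(hR r').2 ⟨hr', this ▸ hD1 c' hc'⟩, this ▸ hc'⟩, rfl⟩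

theorem exists_greedy (hG : I.HoldsGraphs s)
    (hS : Kuhn.Stage (k * n) (Kuhn.Cheap (k * n) (s.arr 3)) f (2 * (k * n) + 1))
    (hB : ∃ v, I.B v = true) : ∃ m, I.Greedy m ∧ I.Encodes m f := by
  classical
  -- A column that belongs to no node is zero in the cost matrix, so the matching program never uses
  -- it.
  have hex : ∀ v : StateNode k n, f v.index ≠ 0 →
      ∃ r ∈ I.graphN.right, f v.index = r.code + 1 := by
    intro v hf
    obtain ⟨o, ho, hc⟩ := hS.hit (f v.index - 1) ⟨v.index, index_lt v, by omega⟩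
    have hlt := (Kuhn.order_lt ho (Or.inr (Or.inr rfl))).1
    by_contra! hne
    have h0 := hG.2.2 v (f v.index - 1) (by omega) (fun r hr h => hne r hr (by omega))
    have := (hS.matching.adj _ (index_lt v) hf).1
    omega
  let m : StateNode k n → Option (RightNode k n) := fun v =>
    if h : f v.index ≠ 0 then some (hex v h).choose else none
  have hm : I.Encodes m f := by
    constructor
    · intro v r h
      by_cases hf : f v.index ≠ 0
      · simp only [m, dif_pos hf, Option.some_inj] at h
        exact h ▸ (hex v hf).choose_spec
      · simp only [m, dif_neg hf, reduceCtorEq] at h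
    · intro v h
      by_contra hf
      exact absurd h (by simp [m, hf])
  refine ⟨m, ⟨fun {v r} h => ?_, fun {v w r} h h' => ?_, ?_, ?_, ?_⟩, hm⟩
  · obtain ⟨hr, hf⟩ := hm.some h
    have := hS.matching.adj _ (index_lt v) (by omega)
    rw [hf] at this
    exact (cheap_iff hG hr).1 this
  · have h1 := (hm.some h).2
    have h2 := (hm.some h').2
    exact index_inj (hS.matching.inj _ (index_lt v) _ (index_lt w) (by omega) (by omega))
  -- If the input were unmatched, it would belong to the certificate for the prefix of length one,
  -- and its neighbour `v` would have to be matched into that prefix, hence with the input.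
  · obtain ⟨D, hD1, hD2, hD3⟩ := hm.certifies hG hS (l := 1) (by omega) (R := {.input}) (fun r => by
      rw [Finset.mem_singleton]
      constructor
      · rintro rfl
        exact ⟨by simp, 0, by simp, by simp [code_input, Kuhn.order]⟩
      · rintro ⟨hr, o, ho, h⟩
        rw [(Kuhn.order_lt ho (Or.inl rfl)).2.1 rfl] at h
        exact code_inj hr (input_mem_rightN I) h)
    by_contra! hne
    obtain ⟨v, hv⟩ := hB
    obtain ⟨r, hr, hvr⟩ := hD3 v .input (hD2 _ (by simp) hne) hv
    rw [Finset.mem_singleton.1 (hD1 hr)] at hvr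
    exact hne v hvr
  · refine hm.certifies hG hS (l := k * n + 1) (by omega) fun r => ?_
    constructor
    · intro hr
      have hrN := I.right_subset hr
      obtain ⟨o, -, h1, -, h2⟩ := Kuhn.exists_order (code_lt hrN)
      exact ⟨hrN, o, h2 ((code_lt_iff hrN).2 hr), h1⟩
    · rintro ⟨hr, o, ho, h⟩
      rw [← code_lt_iff hr, h]
      exact (Kuhn.order_lt ho (Or.inr (Or.inl rfl))).2.2 rfl
  · refine hm.certifies hG hS le_rfl fun r => ?_
    constructor
    · intro hr
      obtain ⟨o, h1, h2, -⟩ := Kuhn.exists_order (code_lt hr)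
      exact ⟨hr, o, h1, h2⟩
    · exact fun h => h.1

end CompositeSystem

/-! ## The links between the paths of the matching -/

namespace CompositeSystem

open WordRAM

variable {k n W : ℕ} {I : CompositeSystem k n} {m : StateNode k n → Option (RightNode k n)}
  {a : StateNode k n} {s : Store}

/-- The memory after the search for the matching `m`, in which the input is matched to `a`. -/
structure Matched (I : CompositeSystem k n) (m : StateNode k n → Option (RightNode k n))
    (a : StateNode k n) (s : Store) : Prop where
  ready : I.Ready s
  greedy : I.Greedy m
  encodes : I.Encodes m (s.arr 12)
  input : m a = some .input

theorem Matched.frame {c : Cmd} {s s' : Store} (h : I.Matched m a s) (hF : Frame c s s')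
    (hv : ∀ x ∈ [0, 1, 4, 5], x ∉ c.vars) (ha : ∀ a ∈ [0, 1, 19, 20, 12], a ∉ c.arrs) :
    I.Matched m a s' :=
  ⟨h.ready.frame hF hv fun a h' => ha a (by revert h'; simp; tauto), h.greedy,
    (hF.arr 12 (ha 12 (by decide))).symm ▸ h.encodes, h.input⟩

/-- Array 15 holds the successors of the states on the paths of `m`, increased by one. -/
structure HoldsNext (m : StateNode k n → Option (RightNode k n)) (a : StateNode k n) (s : Store) :
    Prop where
  some : ∀ v w : StateNode k n, m v = some (.state w) → s.arr 15 w.index = v.index + 1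
  none : ∀ w : StateNode k n, (∀ v, m v ≠ Option.some (.state w)) → s.arr 15 w.index = 0
  var8 : s.var 8 = a.index
  var9 : s.var 9 = a.1

/-- Computes the successors of the states on the paths of the matching. -/
def successors : Cmd :=
  .for 6 (.var 4)
    (.ite (.get 12 (.var 6))
      (.ite (.lt (.get 12 (.var 6)) (.var 4 + .const 1))
        (.set 15 (.get 12 (.var 6) - .const 1) (.var 6 + .const 1))
        (.ite (.eq (.get 12 (.var 6)) (.var 4 + .const 1))
          (.assign 8 (.var 6) ⨾ .assign 9 (.get 19 (.var 6))) .skip))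
      .skip)

theorem successors_runs (hb : Bounds W k n) (hs : I.Matched m a s)
    (h15 : ∀ w : StateNode k n, s.arr 15 w.index = 0) :
    Runs W successors s (100 * (k * n)) (HoldsNext m a) := by
  have h1N := hb.one_le
  have hlin := hb.lin
  have hk := hb.k_le
  refine (Runs.for (x := 6) (k * n) 60 (fun t s' =>
    (∀ v w : StateNode k n, v.index < t → m v = some (.state w) → s'.arr 15 w.index = v.index + 1) ∧
    (∀ w : StateNode k n, (∀ v : StateNode k n, v.index < t → m v ≠ some (.state w)) →
      s'.arr 15 w.index = 0) ∧ (a.index < t → s'.var 8 = a.index ∧ s'.var 9 = a.1))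
    (by decide) (fun s' hF => by exact (hF.var 4 (by decide)).trans hs.ready.var4) (by omega)
    ⟨by simp, fun w _ => by simpa using h15 w, by simp⟩ ?_ (by simp only [Expr.time]; omega)).mono
    le_rfl (fun s' _ h => ?_)
  · intro i hi s1 h6 hF1 hI1
    obtain ⟨v, rfl⟩ := exists_index hi
    obtain ⟨i1, i2, i3⟩ := hI1
    have hs1 : I.Matched m a s1 := hs.frame hF1 (by decide) (by decide)
    have g4 := hs1.ready.var4
    have g19 := hs1.ready.arr19 v
    have hvlt := v.1.2
    have hle := hs1.encodes.lt v
    refine Runs.of_wp ?_ (by decide)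
    simp only [Cmd.wp, Expr.eval_get, Expr.eval_add, Expr.eval_sub, Expr.eval_var,
      Expr.eval_const, Expr.eval_lt, Expr.eval_eq, h6, g4, g19,
      ne_eq, ite_eq_right_iff, one_ne_zero, imp_false, not_not, Store.setArr_arr, Store.setVar_var,
      Store.setVar_arr, Store.setArr_var, true_and, Nat.reduceEqDiff, reduceIte]
    have hother : ∀ u : StateNode k n, u.index < v.index + 1 → u ≠ v → u.index < v.index := by
      intro u hu huv
      have : u.index ≠ v.index := fun h => huv (index_inj h)
      omega
    have hmono : ∀ w : StateNode k n, (∀ u : StateNode k n, u.index < v.index + 1 →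
        m u ≠ some (.state w)) → ∀ u : StateNode k n, u.index < v.index → m u ≠ some (.state w) :=
      fun w h u hu => h u (by omega)
    have hkeep : (∀ w, m v ≠ some (.state w)) →
        (∀ u w : StateNode k n, u.index < v.index + 1 → m u = some (.state w) →
          s1.arr 15 w.index = u.index + 1) ∧
        ∀ w : StateNode k n, (∀ u : StateNode k n, u.index < v.index + 1 →
          m u ≠ some (.state w)) → s1.arr 15 w.index = 0 := by
      refine fun hv => ⟨fun u w hu huw => i1 u w (hother u hu ?_) huw,
        fun w h => i2 w (hmono w h)⟩
      rintro rfl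
      exact hv w huw
    have hkeepa : v ≠ a → a.index < v.index + 1 → s1.var 8 = a.index ∧ s1.var 9 = a.1 :=
      fun hva h => i3 (hother a h hva.symm)
    have hst : (∀ w : StateNode k n, s1.arr 12 v.index ≠ w.index + 1) →
        ∀ w, m v ≠ some (.state w) := fun h w hw => h w (hs1.encodes.state_iff.1 hw)
    have hva : s1.arr 12 v.index ≠ k * n + 1 → v ≠ a := by
      rintro h rfl
      exact h (hs1.encodes.input_iff.1 hs.input)
    refine ⟨fun c1 => ⟨fun c2 => ⟨⟨by omega, by omega⟩, ?_⟩,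
      fun c2 => ⟨fun c3 => ⟨by omega, by omega, ?_⟩, fun c3 => ?_⟩⟩, fun c1 => ?_⟩
    · obtain ⟨x, hx⟩ := exists_index (show s1.arr 12 v.index - 1 < k * n by omega)
      rw [← hx]
      have hvx : m v = some (.state x) := hs1.encodes.state_iff.2 (by omega)
      refine ⟨fun u w hu huw => ?_, fun w hw => ?_, hkeepa (hva (by omega))⟩
      · by_cases huv : u = v
        · subst huv
          rw [hvx] at huw
          simp only [Option.some_inj, RightNode.state.injEq] at huw
          rw [huw, if_pos rfl]
        · rw [if_neg, i1 u w (hother u hu huv) huw]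
          intro h
          rw [index_inj h] at huw
          exact huv (hs.greedy.inj huw hvx)
      · rw [if_neg, i2 w (hmono w hw)]
        intro h
        rw [index_inj h] at hw
        exact hw v (by omega) hvx
    · have : a = v := hs.greedy.inj hs.input (hs1.encodes.input_iff.2 c3)
      subst this
      obtain ⟨h1, h2⟩ := hkeep (hst fun w h => by have := index_lt w; omega)
      exact ⟨h1, h2, fun _ => ⟨rfl, rfl⟩⟩
    · obtain ⟨h1, h2⟩ := hkeep (hst fun w h => by have := index_lt w; omega)
      exact ⟨h1, h2, hkeepa (hva c3)⟩
    · obtain ⟨h1, h2⟩ := hkeep (hst fun w h => by omega)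
      exact ⟨h1, h2, hkeepa (hva (by omega))⟩
  · exact ⟨fun v w => h.1.1 v w (index_lt v), fun w hw => h.1.2.1 w fun v _ => hw v,
      (h.1.2.2 (index_lt a)).1, (h.1.2.2 (index_lt a)).2⟩

/-- Tests whether the state in the variable `x` is matched neither inside its subsystem nor with
the input. -/
def startTest (x : ℕ) : Expr :=
  .eq (.get 12 (.var x)) (.const 0) + .lt (.var 4 + .const 1) (.get 12 (.var x))

theorem Matched.eval_startTest (hs : I.Matched m a s) {x : ℕ} {v : StateNode k n}
    (hx : s.var x = v.index) : (startTest x).eval s ≠ 0 ↔ IsStart m v := by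
  rw [hs.encodes.isStart_iff]
  simp only [startTest, Expr.eval_add, Expr.eval_eq, Expr.eval_lt, Expr.eval_get, Expr.eval_var,
    Expr.eval_const, hx, hs.ready.var4]
  split_ifs <;> omega

/-- Array 16 holds the starts of the paths of `m` in the order in which they are linked. -/
structure HoldsOrder (m : StateNode k n → Option (RightNode k n)) (a : StateNode k n)
    (s : Store) : Prop where
  zero : s.arr 16 0 = a.index
  pos : ∀ v, IsStart m v → s.arr 16 (pos m a v) = v.index
  var10 : s.var 10 = numStarts m

/-- Lists the starts of the paths in the order in which they are linked. -/
def collect : Cmd :=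
  .set 16 (.const 0) (.var 8) ⨾ .assign 10 (.const 0) ⨾
  .for 6 (.var 4)
    (.ite (startTest 6)
      (.assign 11 (.get 19 (.var 6)) ⨾
        .ite (.lt (.var 9) (.var 11)) (.assign 7 (.var 11 - (.var 9 + .const 1)))
          (.assign 7 (.var 11 + .var 0 - (.var 9 + .const 1))) ⨾
        .set 16 (.const 1 + (.get 21 (.var 11) * .var 0 + .var 7)) (.var 6) ⨾
        .set 21 (.var 11) (.get 21 (.var 11) + .const 1) ⨾
        .assign 10 (.var 10 + .const 1))
      .skip)

/-- States are visited by increasing index; in this form the rank is the number of starts of the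
subsystem seen before `v`, which is the content of array 21 at that time. -/
theorem startRank_eq (v : StateNode k n) : startRank m v =
    ((startsIn m v.1).filter fun p => v.1.val * n + p.val < v.index).card := by
  rw [startRank]
  congr 1
  ext p
  simp [StateNode.index]

theorem pos_lt (ha : m a = some .input) {v : StateNode k n} (hv : IsStart m v) :
    pos m a v < k * n + 1 := by
  rw [hv.pos_eq ha]
  have h1 := startRank_lt_card hv
  have h2 : (startsIn m v.1).card ≤ n := by simpa using Finset.card_le_univ (startsIn m v.1)
  have h3 := off_lt a.1.2 v.1.2
  have h4 : (startRank m v + 1) * k ≤ n * k := Nat.mul_le_mul_right _ (by omega)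
  rw [Nat.add_mul, Nat.mul_comm n] at h4
  omega

theorem collect_runs (hb : Bounds W k n) (hs : I.Matched m a s) (hn : HoldsNext m a s)
    (h21 : ∀ i : Fin k, s.arr 21 i = 0) :
    Runs W collect s (100 * (k * n)) (HoldsOrder m a) := by
  classical
  have h1N := hb.one_le
  have hlin := hb.lin
  have hk := hb.k_le
  have hnn := hb.n_le
  have halt := index_lt a
  refine Runs.seq (T := 3) (R := fun s' => s'.arr 16 0 = a.index)
    (Runs.of_wp ⟨by simp [hn.var8]; omega, by simp [hn.var8]⟩ (by decide)) (fun s1 hF1 e1 => ?_)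
    (T' := 97 * (k * n)) (by omega)
  refine Runs.seq (T := 2) (R := fun s' => s' = s1.setVar 10 0)
    (Runs.of_wp ⟨by simp; omega, rfl⟩ (by decide)) (fun s2 hF2 e2 => ?_)
    (T' := 95 * (k * n)) (by omega)
  have hs2 : I.Matched m a s2 :=
    (hs.frame hF1 (by decide) (by decide)).frame hF2 (by decide) (by decide)
  have e9 : s2.var 9 = a.1 := by rw [hF2.var 9 (by decide), hF1.var 9 (by decide), hn.var9]
  have e21 : s2.arr 21 = s.arr 21 := by rw [hF2.arr 21 (by decide), hF1.arr 21 (by decide)]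
  -- A bucket placement: the counters of the subsystems in array 21 give the round and hence the
  -- position of each start, so no sorting is needed.
  refine (Runs.for (x := 6) (k * n) 80 (fun t s' => s'.arr 16 0 = a.index ∧
    (∀ v : StateNode k n, v.index < t → IsStart m v → s'.arr 16 (pos m a v) = v.index) ∧
    (∀ i : Fin k, s'.arr 21 i =
      ((startsIn m i).filter fun p => i.val * n + p.val < t).card) ∧
    s'.var 10 = (Finset.univ.filter fun v : StateNode k n => IsStart m v ∧ v.index < t).card)
    (by decide) (fun s' hF => by exact (hF.var 4 (by decide)).trans hs2.ready.var4) (by omega)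
    ⟨by simp [e2, e1], by simp, by simp [e21, h21], by simp [e2]⟩ ?_
    (by simp only [Expr.time]; omega)).mono le_rfl (fun s' _ h => ?_)
  · intro i hi s3 h6 hF3 hI3
    obtain ⟨v, rfl⟩ := exists_index hi
    obtain ⟨i1, i2, i3, i4⟩ := hI3
    have hs3 : I.Matched m a s3 := hs2.frame hF3 (by decide) (by decide)
    have g9 := (hF3.var 9 (by decide)).trans e9
    have hother : ∀ u : StateNode k n, u.index < v.index + 1 ↔ u = v ∨ u.index < v.index := by
      intro u
      constructor
      · intro h
        by_cases huv : u = v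
        · exact Or.inl huv
        · have : u.index ≠ v.index := fun h => huv (index_inj h)
          omega
      · rintro (rfl | h) <;> omega
    refine Runs.ite (T := 60) (fun hne => ?_) (fun heq => ?_) (by decide)
    · have hv := (hs3.eval_startTest h6).1 hne
      have hpos := pos_lt hs.input hv
      have hrank := startRank_eq (m := m) v
      have hrk : startRank m v * k + off k a.1 v.1 < k * n := by
        rw [hv.pos_eq hs.input] at hpos
        omega
      have hvlt := v.1.2
      have halt' := a.1.2
      have g0 := hs3.ready.var0
      have g19 := hs3.ready.arr19 v
      have hcard : s3.var 10 < k * n := by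
        rw [i4]
        refine lt_of_lt_of_eq (Finset.card_lt_univ_of_notMem (x := v) (by simp)) (by simp)
      have hrank' : startRank m v < n := by
        have h1 := startRank_lt_card hv
        have h2 : (startsIn m v.1).card ≤ n := by
          simpa using Finset.card_le_univ (startsIn m v.1)
        omega
      have i3v := i3 v.1
      rw [← hrank] at i3v
      refine Runs.seq (T := 3) (R := fun s' => s' = s3.setVar 11 v.1)
        (Runs.of_wp ⟨by simp [h6, g19]; omega, by simp [h6, g19]⟩ (by decide))
        (fun s4 _ e4 => ?_) (T' := 57) (by omega)
      refine Runs.seq (T := 18) (R := fun s' => s' = s4.setVar 7 (off k a.1 v.1))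
        (Runs.of_wp ?_ (by decide)) (fun s5 _ e5 => ?_) (T' := 39) (by omega)
      · simp only [Cmd.wp, Expr.eval_lt, Expr.eval_add, Expr.eval_sub, Expr.eval_var,
          Expr.eval_const, e4, Store.setVar_var, Nat.reduceEqDiff, reduceIte, g9, g0, off]
        refine ⟨fun h => ⟨by omega, ?_⟩, fun h => ⟨by omega, ?_⟩⟩
        · rw [if_pos (by by_contra h'; simp [h'] at h)]
        · rw [if_neg (by intro h'; simp [h'] at h)]
      · have f6 : s5.var 6 = v.index := by simp [e5, e4, h6]
        have f7 : s5.var 7 = off k a.1 v.1 := by simp [e5]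
        have f10 : s5.var 10 = s3.var 10 := by simp [e5, e4]
        have f11 : s5.var 11 = v.1 := by simp [e5, e4]
        have f0 : s5.var 0 = k := by simp [e5, e4, g0]
        have fa : s5.arr = s3.arr := by simp [e5, e4]
        refine Runs.of_wp ?_ (by decide)
        simp only [Cmd.wp, Expr.eval_add, Expr.eval_mul, Expr.eval_var, Expr.eval_get,
          Expr.eval_const, Store.setVar_var, Store.setVar_arr, Store.setArr_arr, Store.setArr_var,
          Nat.reduceEqDiff, reduceIte, f6, f7, f10, f11, f0, fa, i3v, true_and, false_and,
          ← hv.pos_eq hs.input]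
        refine ⟨⟨by omega, by omega⟩, ⟨by omega, by omega⟩, by omega, ?_, fun u hu hus => ?_,
          fun i => ?_, ?_⟩
        · rw [if_neg (by rw [hv.pos_eq hs.input]; omega), i1]
        · by_cases huv : u = v
          · subst huv
            rw [if_pos rfl]
          · rw [if_neg fun h => huv (pos_injOn hs.input hus hv h)]
            exact i2 u (((hother u).1 hu).resolve_left huv) hus
        · by_cases hiv : i = v.1
          · subst hiv
            rw [if_pos rfl, hrank, ← Finset.card_insert_of_notMem (a := v.2) (by
              simp [StateNode.index])]
            congr 1
            ext p
            have : v.1.val * n + p.val < v.index + 1 ↔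
                (v.1, p) = v ∨ v.1.val * n + p.val < v.index := hother (v.1, p)
            simp only [Finset.mem_filter, Finset.mem_insert, mem_startsIn]
            rw [this]
            constructor
            · rintro (rfl | ⟨h1, h2⟩)
              · exact ⟨hv, Or.inl rfl⟩
              · exact ⟨h1, Or.inr h2⟩
            · rintro ⟨h1, h2 | h2⟩
              · exact Or.inl (congrArg Prod.snd h2)
              · exact Or.inr ⟨h1, h2⟩
          · rw [if_neg fun h => hiv (Fin.ext h), i3]
            congr 1
            refine Finset.filter_congr fun p hp => ⟨fun h => by omega, fun h => ?_⟩
            refine ((hother (i, p)).1 h).resolve_left fun h => hiv ?_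
            rw [← h]
        · rw [i4, ← Finset.card_insert_of_notMem (a := v) (by simp)]
          congr 1
          ext u
          simp only [Finset.mem_filter, Finset.mem_insert, Finset.mem_univ, true_and]
          rw [hother]
          constructor
          · rintro (rfl | ⟨h1, h2⟩)
            · exact ⟨hv, Or.inl rfl⟩
            · exact ⟨h1, Or.inr h2⟩
          · rintro ⟨h1, h2 | h2⟩
            · exact Or.inl h2
            · exact Or.inr ⟨h1, h2⟩
    · have hv : ¬ IsStart m v := fun h => (hs3.eval_startTest h6).2 h heq
      have hset : ∀ u, IsStart m u → u.index < v.index + 1 → u.index < v.index := by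
        intro u hu h
        rcases (hother u).1 h with rfl | h
        · exact absurd hu hv
        · exact h
      refine Runs.of_wp ⟨i1, fun u hu hus => i2 u (hset u hus hu) hus, fun i => ?_, ?_⟩ (by decide)
      · rw [Store.setVar_arr, i3]
        congr 1
        refine Finset.filter_congr fun p hp => ⟨fun h => by omega, fun h => ?_⟩
        exact hset (i, p) (mem_startsIn.1 hp) h
      · simp only [Store.setVar_var, Nat.reduceEqDiff, if_false, i4]
        congr 1
        refine Finset.filter_congr fun u _ => ⟨fun h => ⟨h.1, by omega⟩, fun h => ?_⟩
        exact ⟨h.1, hset u h.1 h.2⟩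
  · refine ⟨h.1.1, fun v hv => h.1.2.1 v (index_lt v) hv, ?_⟩
    rw [h.1.2.2.2, numStarts]
    congr 1
    ext v
    simp [index_lt v]

/-- Array 17 holds the state to which the start of a path is linked. -/
def HoldsLink (m : StateNode k n → Option (RightNode k n)) (link : StateNode k n → StateNode k n)
    (s : Store) : Prop :=
  ∀ v, IsStart m v → s.arr 17 v.index = (link v).index

/-- Links the start of every path to the end of the path that precedes it. -/
def linkUp : Cmd :=
  .for 6 (.var 10) (.assign 7 (.get 16 (.var 6)) ⨾
    .for 11 (.var 4) (.ite (.get 15 (.var 7)) (.assign 7 (.get 15 (.var 7) - .const 1)) .skip) ⨾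
    .set 17 (.get 16 (.var 6 + .const 1)) (.var 7))

theorem numStarts_le : numStarts m ≤ k * n := by
  classical
  exact (Finset.card_le_univ _).trans (by simp)

theorem exists_head (hm : I.Greedy m) (ha : m a = some .input) {c : ℕ} (hc : c < numStarts m) :
    ∃ u, (u = a ∨ IsStart m u) ∧ pos m a u = c := by
  cases c with
  | zero => exact ⟨a, Or.inl rfl, pos_self a⟩
  | succ c =>
    obtain ⟨v, hv, h⟩ := hm.exists_pos ha (by omega : c < numStarts m)
    exact ⟨v, Or.inr hv, h⟩

/-- Each path is followed for exactly `k * n` steps, waiting at its end, in accordance with the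
definition of `pathEnd`. With at most `k * n` starts this is quadratic. -/
theorem linkUp_runs (hb : Bounds W k n) (hs : I.Matched m a s) (hn : HoldsNext m a s)
    (ho : HoldsOrder m a s) : Runs W linkUp s (100 * (k * n) ^ 2)
      fun s' => ∃ link, IsLinking m a link ∧ HoldsLink m link s' := by
  classical
  have h1N := hb.one_le
  have hlin := hb.lin
  have hle := numStarts_le (m := m)
  have hsq : k * n ≤ (k * n) ^ 2 := Nat.le_self_pow (by decide) _
  refine (Runs.for (x := 6) (numStarts m) (50 * (k * n)) (fun t s' =>
    ∀ v, IsStart m v → pos m a v ≤ t → ∃ u, (u = a ∨ IsStart m u) ∧ pos m a u + 1 = pos m a v ∧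
      s'.arr 17 v.index = (pathEnd m u).index)
    (by decide) (fun s' hF => by exact (hF.var 10 (by decide)).trans ho.var10) (by omega)
    (fun v hv h => by rw [hv.pos_eq hs.input] at h; omega) ?_ ?_).mono le_rfl (fun s' _ h => ?_)
  · intro c hc s1 h6 hF1 hI1
    obtain ⟨u, hu, hpos⟩ := exists_head hs.greedy hs.input hc
    obtain ⟨v, hv, hvpos⟩ := hs.greedy.exists_pos hs.input hc
    have g16 : ∀ i, s1.arr 16 i = s.arr 16 i := fun i => by rw [hF1.arr 16 (by decide)]
    have hu16 : s1.arr 16 c = u.index := by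
      rw [g16, ← hpos]
      rcases hu with rfl | hu
      · rw [pos_self, ho.zero]
      · exact ho.pos u hu
    have hv16 : s1.arr 16 (c + 1) = v.index := by rw [g16, ← hvpos, ho.pos v hv]
    have hult := index_lt u
    refine Runs.seq (T := 3) (R := fun s' => s' = s1.setVar 7 u.index)
      (Runs.of_wp ⟨by simp [h6, hu16]; omega, by simp [h6, hu16]⟩ (by decide))
      (fun s2 hF2 e2 => ?_) (T' := 47 * (k * n)) (by omega)
    refine Runs.seq (T := 40 * (k * n)) (R := fun s' => s'.var 7 = (pathEnd m u).index)
      ((Runs.for (x := 11) (k * n) 20 (fun j s' => s'.var 7 = ((pathStep m)^[j] u).index)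
        (by decide) (fun s' hF => by
          exact (hF.var 4 (by decide)).trans ((hF2.var 4 (by decide)).trans
            ((hF1.var 4 (by decide)).trans hs.ready.var4))) (by omega) (by simp [e2]) ?_
        (by simp only [Expr.time]; omega)).mono le_rfl (fun s' _ h => h.1))
      (fun s3 hF3 e3 => ?_) (T' := 7) (by omega)
    · intro j hj s3 h11 hF3 h7
      have g15 : s3.arr 15 = s.arr 15 := by
        rw [hF3.arr 15 (by decide), hF2.arr 15 (by decide), hF1.arr 15 (by decide)]
      refine Runs.of_wp ?_ (by decide)
      simp only [Cmd.wp, Expr.eval_get, Expr.eval_sub, Expr.eval_var, Expr.eval_const,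
        Store.setVar_var, Nat.reduceEqDiff, reduceIte, g15, h7, Function.iterate_succ_apply']
      generalize (pathStep m)^[j] u = w
      by_cases hw : ∃ x, m x = some (.state w)
      · obtain ⟨x, hx⟩ := hw
        have := index_lt x
        rw [hn.some x w hx, pathStep, hs.greedy.next_eq_some.2 hx]
        exact ⟨fun _ => ⟨by omega, by simp⟩, fun h => by simp at h⟩
      · push Not at hw
        rw [hn.none w hw, pathStep, next_eq_none.2 hw]
        simp
    · have f6 : s3.var 6 = c := by rw [hF3.var 6 (by decide), hF2.var 6 (by decide), h6]
      have f16 : s3.arr 16 = s1.arr 16 := by rw [hF3.arr 16 (by decide), hF2.arr 16 (by decide)]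
      have f17 : s3.arr 17 = s1.arr 17 := by rw [hF3.arr 17 (by decide), hF2.arr 17 (by decide)]
      have hvlt := index_lt v
      have hplt := index_lt (pathEnd m u)
      refine Runs.of_wp ?_ (by decide)
      simp only [Cmd.wp, Expr.eval_get, Expr.eval_add, Expr.eval_var, Expr.eval_const,
        Store.setVar_arr, Store.setArr_arr, f6, f16, f17, e3, hv16, true_and]
      refine ⟨⟨by omega, by omega⟩, fun x hx hxp => ?_⟩
      by_cases hxv : x = v
      · subst hxv
        exact ⟨u, hu, by omega, by rw [if_pos rfl]⟩
      · have : pos m a x ≠ pos m a v := fun h => hxv (pos_injOn hs.input hx hv h)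
        rw [if_neg fun h => hxv (index_inj h)]
        exact hI1 x hx (by omega)
  · have h1 : numStarts m * (50 * (k * n) + 1 + 7) ≤ k * n * (50 * (k * n) + 1 + 7) :=
      Nat.mul_le_mul_right _ hle
    have h2 : k * n * (50 * (k * n) + 1 + 7) = 50 * (k * n) ^ 2 + 8 * (k * n) := by ring
    simp only [Expr.time]
    omega
  -- The link function is read off from array 17 at the end; its values outside the starts are
  -- immaterial.
  · have hex : ∀ v : StateNode k n, ∃ x : StateNode k n, IsStart m v →
        ∃ u, (u = a ∨ IsStart m u) ∧ pos m a u + 1 = pos m a v ∧ x = pathEnd m u ∧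
          s'.arr 17 v.index = x.index := by
      intro v
      by_cases hv : IsStart m v
      · obtain ⟨u, h1, h2, h3⟩ := h.1 v hv (hs.greedy.pos_le hs.input hv)
        exact ⟨pathEnd m u, fun _ => ⟨u, h1, h2, rfl, h3⟩⟩
      · exact ⟨v, fun h => absurd h hv⟩
    choose link hlink using hex
    refine ⟨link, fun v hv => ?_, fun v hv => ?_⟩
    · obtain ⟨u, h1, h2, h3, -⟩ := hlink v hv
      exact ⟨u, h1, h2, h3⟩
    · obtain ⟨u, -, -, -, h⟩ := hlink v hv
      exact h

/-- Writes the matching `M*`. -/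
def writeStar : Cmd :=
  .for 6 (.var 4) (.ite (.get 12 (.var 6)) (.set 4 (.var 6) (.get 12 (.var 6) - .const 1))
    (.set 4 (.var 6) (.get 17 (.var 6))))

theorem writeStar_runs {link : StateNode k n → StateNode k n} (hb : Bounds W k n)
    (hs : I.Matched m a s) (hl : HoldsLink m link s) :
    Runs W writeStar s (100 * (k * n))
      fun s' => ∀ v, s'.arr 4 v.index = (starMate m link v).code := by
  have h1N := hb.one_le
  have hlin := hb.lin
  refine (Runs.fill (a := 4) (k * n) 40 (fun i => if s.arr 12 i = 0 then s.arr 17 i else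
    s.arr 12 i - 1) (by decide)
    (fun s' hF => by exact (hF.var 4 (by decide)).trans hs.ready.var4) (by omega) ?_
    (by simp only [Expr.time]; omega)).mono le_rfl (fun s' _ h v => ?_)
  · intro i hi s1 h6 hF1
    obtain ⟨v, rfl⟩ := exists_index hi
    have g12 : s1.arr 12 = s.arr 12 := hF1.arr 12 (by decide)
    have g17 : s1.arr 17 = s.arr 17 := hF1.arr 17 (by decide)
    have hle := hs.encodes.lt v
    refine Runs.of_wp ?_ (by decide)
    simp only [Cmd.wp, Expr.eval_get, Expr.eval_sub, Expr.eval_var, Expr.eval_const, h6, g12, g17,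
      Store.setArr_arr_self]
    refine ⟨fun h => ⟨⟨by omega, by omega⟩, by rw [if_neg h]⟩, fun h => ⟨⟨by omega, ?_⟩,
      by rw [if_pos h]⟩⟩
    have := index_lt (link v)
    rw [hl v (hs.encodes.isStart_iff.2 (Or.inl h))]
    omega
  · rw [h _ (index_lt v)]
    cases hm : m v with
    | none =>
      rw [starMate_of_none hm, if_pos (hs.encodes.none hm), code_state]
      exact hl v (Or.inl hm)
    | some r =>
      rw [starMate_of_some hm, (hs.encodes.some hm).2, if_neg (by omega)]
      omega

end CompositeSystem

/-! ## The phase after `M*` has been obtained -/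

namespace CompositeSystem

open WordRAM

variable {k n W : ℕ} {I : CompositeSystem k n} {m : StateNode k n → Option (RightNode k n)}
  {a : StateNode k n} {link : StateNode k n → StateNode k n} {s : Store}

/-- The memory after the paths of the matching `m` have been linked. -/
structure Linked (I : CompositeSystem k n) (m : StateNode k n → Option (RightNode k n))
    (a : StateNode k n) (link : StateNode k n → StateNode k n) (s : Store) : Prop where
  matched : I.Matched m a s
  plan : I.Plan m a link
  comps : I.HoldsComps s
  holdsLink : HoldsLink m link s
  var8 : s.var 8 = a.index
  var9 : s.var 9 = a.1

theorem Linked.frame {c : Cmd} {s s' : Store} (h : I.Linked m a link s) (hF : Frame c s s')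
    (hv : ∀ x ∈ [0, 1, 4, 5, 8, 9], x ∉ c.vars)
    (ha : ∀ a ∈ [0, 1, 19, 20, 12, 10, 11, 17], a ∉ c.arrs) : I.Linked m a link s' where
  matched := h.matched.frame hF (fun x h' => hv x (by revert h'; simp; tauto))
    (fun x h' => ha x (by revert h'; simp; tauto))
  plan := h.plan
  comps v := by
    rw [hF.arr 11 (ha 11 (by decide)), hF.arr 10 (ha 10 (by decide))]
    exact h.comps v
  holdsLink v := by
    rw [hF.arr 17 (ha 17 (by decide))]
    exact h.holdsLink v
  var8 := (hF.var 8 (hv 8 (by decide))).trans h.var8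
  var9 := (hF.var 9 (hv 9 (by decide))).trans h.var9

open Classical in
/-- Array 8 holds the adjacency matrix of the set `F` of interconnections. -/
def HoldsEdges (F : Set (StateNode k n × StateNode k n)) (s : Store) : Prop :=
  ∀ v w : StateNode k n, s.arr 8 (v.index * (k * n) + w.index) = if (v, w) ∈ F then 1 else 0

open Classical in
/-- Array 18 marks the first states of the components that contain a start. -/
def HoldsMarks (I : CompositeSystem k n) (m : StateNode k n → Option (RightNode k n))
    (s : Store) : Prop :=
  ∀ v : StateNode k n,
    s.arr 18 v.index = if ∃ w, IsStart m w ∧ I.first w = v.index then 1 else 0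

theorem Plan.mem_inter (P : I.Plan m a link) {v w : StateNode k n} :
    (v, w) ∈ inter (graphOf (tildeMate m link)) ↔ IsStart m w ∧ link w = v := by
  constructor
  · intro h
    have hw := P.isStart_of_mem_inter h
    have := mem_graphOf.1 h.2
    rw [tildeMate_of_isStart hw] at this
    simp only [RightNode.state.injEq] at this
    exact ⟨hw, this⟩
  · rintro ⟨hw, rfl⟩
    exact ⟨(P.link_fst_ne hw).symm, mem_graphOf.2 (by simp [tildeMate_of_isStart hw])⟩

/-- Writes the matching after the second step, with its interconnections. -/
def writeTilde : Cmd :=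
  .for 6 (.var 4)
    (.ite (startTest 6)
      (.set 5 (.var 6) (.get 17 (.var 6)) ⨾
        .set 8 (.get 17 (.var 6) * .var 4 + .var 6) (.const 1) ⨾
        .set 18 (.get 10 (.var 6)) (.const 1))
      (.set 5 (.var 6) (.get 12 (.var 6) - .const 1)))

theorem writeTilde_runs (hb : Bounds W k n) (hs : I.Linked m a link s)
    (h8 : ∀ i, s.arr 8 i = 0) (h18 : ∀ i, s.arr 18 i = 0) :
    Runs W writeTilde s (100 * (k * n)) fun s' =>
      (∀ v, s'.arr 5 v.index = (tildeMate m link v).code) ∧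
      HoldsEdges (inter (graphOf (tildeMate m link))) s' ∧ HoldsMarks I m s' := by
  classical
  have h1N := hb.one_le
  have hlin := hb.lin
  refine (Runs.for (x := 6) (k * n) 60 (fun t s' =>
    (∀ v : StateNode k n, v.index < t → s'.arr 5 v.index = (tildeMate m link v).code) ∧
    (∀ v w : StateNode k n, s'.arr 8 (v.index * (k * n) + w.index) =
      if w.index < t ∧ IsStart m w ∧ link w = v then 1 else 0) ∧
    ∀ v : StateNode k n, s'.arr 18 v.index =
      if ∃ w : StateNode k n, w.index < t ∧ IsStart m w ∧ I.first w = v.index then 1 else 0)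
    (by decide) (fun s' hF => by exact (hF.var 4 (by decide)).trans hs.matched.ready.var4)
    (by omega) ⟨by simp, by simp [h8], by simp [h18]⟩ ?_
    (by simp only [Expr.time]; omega)).mono le_rfl (fun s' _ h => ?_)
  · intro i hi s1 h6 hF1 hI1
    obtain ⟨v, rfl⟩ := exists_index hi
    obtain ⟨i1, i2, i3⟩ := hI1
    have hs1 : I.Linked m a link s1 := hs.frame hF1 (by decide) (by decide)
    have g4 := hs1.matched.ready.var4
    have g10 := (hs1.comps v).2
    have hother : ∀ u : StateNode k n, u.index < v.index + 1 ↔ u = v ∨ u.index < v.index := by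
      intro u
      constructor
      · intro h
        by_cases huv : u = v
        · exact Or.inl huv
        · have : u.index ≠ v.index := fun h => huv (index_inj h)
          omega
      · rintro (rfl | h) <;> omega
    refine Runs.ite (T := 40) (fun hne => ?_) (fun heq => ?_) (by decide)
    · have hv := (hs1.matched.eval_startTest h6).1 hne
      have g17 := hs1.holdsLink v hv
      have hll := index_lt (link v)
      have hfl := I.first_lt v
      have hil := hb.index_lt'' hll hi
      refine Runs.of_wp ?_ (by decide)
      simp only [Cmd.wp, Expr.eval_add, Expr.eval_mul, Expr.eval_var, Expr.eval_get,
        Expr.eval_const, Store.setVar_arr, Store.setArr_arr, Store.setArr_var,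
        Nat.reduceEqDiff, h6, g4, g10, g17, true_and, false_and, if_false]
      refine ⟨⟨by omega, by omega⟩, ⟨by omega, by omega⟩, ⟨by omega, by omega⟩, fun u hu => ?_,
        fun x w => ?_, fun u => ?_⟩
      · by_cases huv : u = v
        · subst huv
          rw [if_pos rfl, tildeMate_of_isStart hv, code_state]
        · rw [if_neg fun h => huv (index_inj h)]
          exact i1 u (((hother u).1 hu).resolve_left huv)
      · by_cases hxw : x = link v ∧ w = v
        · obtain ⟨rfl, rfl⟩ := hxw
          rw [if_pos rfl, if_pos ⟨by omega, hv, rfl⟩]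
        · have hne : ¬ x.index * (k * n) + w.index = (link v).index * (k * n) + v.index := by
            intro h
            obtain ⟨h1, h2⟩ := mul_add_inj (index_lt w) (index_lt v) h
            exact hxw ⟨index_inj h1, index_inj h2⟩
          rw [if_neg hne, i2]
          refine ite_eq_of_iff ?_
          rw [hother]
          constructor
          · tauto
          · rintro ⟨rfl | h, h', h''⟩
            · exact absurd ⟨h''.symm, rfl⟩ hxw
            · exact ⟨h, h', h''⟩
      · by_cases huv : u.index = I.first v
        · rw [if_pos huv, if_pos ⟨v, by omega, hv, huv.symm⟩]
        · rw [if_neg huv, i3]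
          refine ite_eq_of_iff ⟨?_, ?_⟩
          · rintro ⟨w, h1, h2⟩
            exact ⟨w, by omega, h2⟩
          · rintro ⟨w, h1, h2, h3⟩
            rcases (hother w).1 h1 with rfl | h1
            · exact absurd h3.symm huv
            · exact ⟨w, h1, h2, h3⟩
    · have hv : ¬ IsStart m v := fun h => (hs1.matched.eval_startTest h6).2 h heq
      have hle := hs1.matched.encodes.lt v
      obtain ⟨r, hr⟩ := Option.ne_none_iff_exists'.1 (show m v ≠ none from fun h => hv (Or.inl h))
      have hcode : s1.arr 12 v.index - 1 = (tildeMate m link v).code := by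
        rw [tildeMate_of_not_isStart hv, starMate_of_some hr, (hs1.matched.encodes.some hr).2]
        omega
      refine Runs.of_wp ?_ (by decide)
      simp only [Cmd.wp, Expr.eval_sub, Expr.eval_var, Expr.eval_get,
        Expr.eval_const, Store.setVar_arr, Store.setArr_arr, Nat.reduceEqDiff, h6, true_and,
        false_and, if_false, i2, i3]
      refine ⟨⟨by omega, by omega⟩, fun u hu => ?_, fun x w => ?_, fun u => ?_⟩
      · by_cases huv : u = v
        · subst huv
          rw [if_pos rfl, hcode]
        · rw [if_neg fun h => huv (index_inj h)]
          exact i1 u (((hother u).1 hu).resolve_left huv)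
      · refine ite_eq_of_iff ?_
        rw [hother]
        constructor
        · tauto
        · rintro ⟨rfl | h, h'⟩
          · exact absurd h'.1 hv
          · exact ⟨h, h'⟩
      · refine ite_eq_of_iff ⟨?_, ?_⟩
        · rintro ⟨w, h1, h2⟩
          exact ⟨w, by omega, h2⟩
        · rintro ⟨w, h1, h2⟩
          rcases (hother w).1 h1 with rfl | h1
          · exact absurd h2.1 hv
          · exact ⟨w, h1, h2⟩
  · obtain ⟨⟨h1, h2, h3⟩, -⟩ := h
    refine ⟨fun v => h1 v (index_lt v), fun v w => ?_, fun v => ?_⟩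
    · rw [h2]
      refine ite_eq_of_iff ?_
      rw [hs.plan.mem_inter]
      simp [index_lt]
    · rw [h3]
      refine ite_eq_of_iff ?_
      simp [index_lt]

end CompositeSystem

/-! ## The extra interconnections -/

namespace CompositeSystem

open WordRAM

variable {k n W : ℕ} {I : CompositeSystem k n} {m : StateNode k n → Option (RightNode k n)}
  {a : StateNode k n} {link : StateNode k n → StateNode k n} {s : Store}

/-- Components are identified by their first states, so a mark at the first state tells whether the
component contains a start. The test in the program takes constant time. -/
theorem needsEdge_iff {v : StateNode k n} : I.NeedsEdge m v ↔ I.component v ∈ I.comps ∧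
    I.first v = v.index ∧ ¬ ∃ w, IsStart m w ∧ I.first w = v.index := by
  rw [NeedsEdge, first_eq_index_iff]
  refine and_congr_right fun _ => and_congr_right fun h => ⟨?_, fun h' w hw hs => h' ⟨w, hs, ?_⟩⟩
  · rintro h' ⟨w, hw, hf⟩
    refine h' w ?_ hw
    rw [← first_eq_index_iff.2 h] at hf
    exact component_eq_of_first_eq hf ▸ self_mem_component w
  · rw [first, component_eq hw]
    exact first_eq_index_iff.2 h

/-- Computes the subsystem with the offset in variable 6 from the successor of that of `a`, and
the state in it whose number is in variable 7. -/
def locate : Cmd :=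
  .ite (.lt (.var 9 + .const 1 + .var 6) (.var 0)) (.assign 11 (.var 9 + .const 1 + .var 6))
    (.assign 11 (.var 9 + .const 1 + .var 6 - .var 0)) ⨾
  .assign 12 (.var 11 * .var 1 + .var 7)

/-- Adds an interconnection to the state in variable 12. -/
def addEdge : Cmd :=
  .ite (.eq (.var 11) (.var 9))
    (.ite (.lt (.var 9 + .const 1) (.var 0))
      (.assign 13 ((.var 9 + .const 1) * .var 1 + .var 7))
      (.assign 13 ((.var 9 + .const 1 - .var 0) * .var 1 + .var 7)))
    (.assign 13 (.var 8)) ⨾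
  .set 6 (.var 3) (.var 13) ⨾ .set 7 (.var 3) (.var 12) ⨾
  .set 8 (.var 13 * .var 4 + .var 12) (.const 1) ⨾ .assign 3 (.var 3 + .const 1)

/-- Adds the extra interconnections. -/
def extras : Cmd :=
  .assign 2 (.const 0) ⨾ .assign 3 (.const 0) ⨾
  .for 6 (.var 0) (.for 7 (.var 1) (locate ⨾
    .ite (.get 11 (.var 12) * (.eq (.get 10 (.var 12)) (.var 12) *
      .eq (.get 18 (.var 12)) (.const 0))) addEdge .skip))

/-- Arrays 6 and 7 hold the list `L`, whose length is in variable 3. -/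
structure HoldsList (L : List (StateNode k n × StateNode k n)) (s : Store) : Prop where
  var3 : s.var 3 = L.length
  arr : ∀ (j : ℕ) (h : j < L.length), s.arr 6 j = (L[j]).1.index ∧ s.arr 7 j = (L[j]).2.index

theorem HoldsList.append {L : List (StateNode k n × StateNode k n)} (h : HoldsList L s)
    {x y : StateNode k n} {s' : Store} (h3 : s'.var 3 = L.length + 1)
    (h6 : ∀ j, s'.arr 6 j = if j = L.length then x.index else s.arr 6 j)
    (h7 : ∀ j, s'.arr 7 j = if j = L.length then y.index else s.arr 7 j) :
    HoldsList (L ++ [(x, y)]) s' := by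
  refine ⟨by simp [h3], fun j hj => ?_⟩
  rw [h6, h7]
  rcases Nat.lt_or_ge j L.length with hlt | hge
  · rw [if_neg hlt.ne, if_neg hlt.ne, List.getElem_append_left hlt]
    exact h.arr j hlt
  · obtain rfl : j = L.length := by simp at hj; omega
    simp

theorem HoldsEdges.insert {F : Set (StateNode k n × StateNode k n)} (h : HoldsEdges F s)
    {x y : StateNode k n} {s' : Store}
    (h8 : ∀ i, s'.arr 8 i = if i = x.index * (k * n) + y.index then 1 else s.arr 8 i) :
    HoldsEdges (F ∪ {(x, y)}) s' := by
  intro v w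
  rw [h8]
  by_cases hvw : (v, w) = (x, y)
  · obtain ⟨rfl, rfl⟩ := Prod.mk.injEq _ _ _ _ ▸ hvw
    simp
  · rw [if_neg, h]
    · exact ite_eq_of_iff (by simp [hvw])
    · intro h
      obtain ⟨h1, h2⟩ := mul_add_inj (index_lt w) (index_lt y) h
      exact hvw (by rw [index_inj h1, index_inj h2])

theorem place_lt (a v : StateNode k n) : place a v < k * n :=
  index_lt ((⟨off k a.1 v.1, off_lt a.1.2 v.1.2⟩, v.2) : StateNode k n)

/-- The loops run over offsets rather than subsystems, so that states come in the order of `place`,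
as `extraList_append` requires. Accessibility never has to be computed, and each state takes
constant time. -/
theorem extras_runs (hb : Bounds W k n) (hs : I.Linked m a link s)
    (hk : I.comps.Nonempty → k ≠ 1)
    (h8 : HoldsEdges (inter (graphOf (tildeMate m link))) s) (h18 : HoldsMarks I m s) :
    Runs W extras s (300 * (k * n)) fun s' => s'.var 2 = 0 ∧ ∃ L,
      I.ExtraList m a (inter (graphOf (tildeMate m link))) (k * n) L ∧ HoldsList L s' ∧
      HoldsEdges (inter (graphOf (tildeMate m link)) ∪ {f | f ∈ L}) s' := by
  classical
  have h1N := hb.one_le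
  have hlin := hb.lin
  have hkk := hb.k_le
  have hnn := hb.n_le
  refine Runs.seq (T := 2) (R := fun s' => s' = s.setVar 2 0)
    (Runs.of_wp ⟨by simp; omega, rfl⟩ (by decide)) (fun s1 hF1 e1 => ?_)
    (T' := 298 * (k * n)) (by omega)
  refine Runs.seq (T := 2) (R := fun s' => s' = s1.setVar 3 0)
    (Runs.of_wp ⟨by simp; omega, rfl⟩ (by decide)) (fun s2 hF2 e2 => ?_)
    (T' := 296 * (k * n)) (by omega)
  have hs2 : I.Linked m a link s2 :=
    (hs.frame hF1 (by decide) (by decide)).frame hF2 (by decide) (by decide)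
  have a2 : s2.arr = s.arr := by simp [e2, e1]
  have e22 : s2.var 2 = 0 := by simp [e2, e1]
  -- The bound on the length keeps the list counter within a word.
  refine (Runs.for₂ k n 150 (fun t s' => ∃ L, L.length ≤ t ∧
      I.ExtraList m a (inter (graphOf (tildeMate m link))) t L ∧ HoldsList L s' ∧
      HoldsEdges (inter (graphOf (tildeMate m link)) ∪ {f | f ∈ L}) s')
    (by decide) (by decide) (by decide)
    (fun s' hF => by exact (hF.var 0 (by decide)).trans hs2.matched.ready.var0) (by omega)
    (fun s' hF => by exact (hF.var 1 (by decide)).trans hs2.matched.ready.var1) (by omega)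
    ?_ ?_ ?_ ?_).mono le_rfl (fun s' hF h => ?_)
  · rintro t s' u ⟨L, h1, h2, h3, h4⟩
    exact ⟨⟨L, h1, h2, ⟨by simpa using h3.var3, h3.arr⟩, h4⟩,
      ⟨L, h1, h2, ⟨by simpa using h3.var3, h3.arr⟩, h4⟩⟩
  · refine ⟨[], le_rfl, ExtraList.nil, ⟨by simp [e2], by simp⟩, fun v w => ?_⟩
    rw [a2, h8]
    exact ite_eq_of_iff (by simp)
  · intro o ho j hj s3 h6 h7 hF3 hI3
    obtain ⟨L, hL, hEx, hList, hEdges⟩ := hI3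
    have hs3 : I.Linked m a link s3 := hs2.frame hF3 (by decide) (by decide)
    have g0 := hs3.matched.ready.var0
    have g1 := hs3.matched.ready.var1
    have g4 := hs3.matched.ready.var4
    have hrot := rot_lt a.1.2 ho
    have halt := a.1.2
    let v : StateNode k n := (⟨rot k a.1 o, hrot⟩, ⟨j, hj⟩)
    have hplace : place a v = o * n + j := by rw [place, off_rot a.1.2 ho]
    have hv : v.index = rot k a.1 o * n + j := rfl
    have hvlt := index_lt v
    refine Runs.seq (T := 30) (R := fun s' => s' = (s3.setVar 11 v.1).setVar 12 v.index)
      (Runs.of_wp ?_ (by decide)) (fun s4 hF4 e4 => ?_) (T' := 100) (by omega)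
    · simp only [locate, Cmd.wp, Expr.eval_add, Expr.eval_mul, Expr.eval_sub, Expr.eval_var,
        Expr.eval_lt, Expr.eval_const, Store.setVar_var, Nat.reduceEqDiff, reduceIte, h6, h7, g0,
        g1, hs3.var9, ne_eq, ite_eq_right_iff, one_ne_zero, imp_false, not_not]
      refine ⟨fun h => ⟨by omega, ?_⟩, fun h => ⟨by omega, ?_⟩⟩
      · have hr : rot k a.1 o = a.1 + 1 + o := if_pos h
        rw [hv, hr] at hvlt
        exact ⟨by omega, by simp [v, StateNode.index, hr]⟩
      · have hr : rot k a.1 o = a.1 + 1 + o - k := if_neg h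
        rw [hv, hr] at hvlt
        exact ⟨by omega, by simp [v, StateNode.index, hr]⟩
    have hs4 : I.Linked m a link s4 := hs3.frame hF4 (by decide) (by decide)
    have f11 : s4.var 11 = v.1 := by simp [e4]
    have f12 : s4.var 12 = v.index := by simp [e4]
    have f3 : s4.var 3 = L.length := by simp [e4, hList.var3]
    have f7 : s4.var 7 = j := by simp [e4, h7]
    have f0 := hs4.matched.ready.var0
    have f1 := hs4.matched.ready.var1
    have f4 := hs4.matched.ready.var4
    have fa : s4.arr = s3.arr := by simp [e4]
    have f18 : s4.arr 18 v.index = if ∃ w, IsStart m w ∧ I.first w = v.index then 1 else 0 := by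
      rw [fa, hF3.arr 18 (by decide), a2]
      exact h18 v
    have hcond : (Expr.get 11 (.var 12) * (.eq (.get 10 (.var 12)) (.var 12) *
        .eq (.get 18 (.var 12)) (.const 0))).eval s4 ≠ 0 ↔ I.NeedsEdge m v := by
      rw [needsEdge_iff]
      simp only [Expr.eval_mul, Expr.eval_get, Expr.eval_eq, Expr.eval_var, Expr.eval_const, f12,
        (hs4.comps v).1, (hs4.comps v).2, f18]
      by_cases c1 : I.component v ∈ I.comps <;> by_cases c2 : I.first v = v.index <;>
        by_cases c3 : ∃ w, IsStart m w ∧ I.first w = v.index <;> simp only [c1, c2, c3] <;> simp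
    refine Runs.ite (T := 60) (fun hne => ?_) (fun heq => ?_) (by decide)
    · have hneed := hcond.1 hne
      have hxlt := index_lt (extraSource a v)
      have hL' : L.length < k * n := by
        have : v.index < k * n := index_lt v
        have h1 := place_lt a v
        omega
      have hil := hb.index_lt'' hxlt (index_lt v)
      refine Runs.seq (T := 35) (R := fun s' => s' = s4.setVar 13 (extraSource a v).index)
        (Runs.of_wp ?_ (by decide)) (fun s5 _ e5 => Runs.of_wp ?_ (by decide)) (T' := 20)
        (by omega)
      · simp only [Cmd.wp, Expr.eval_add, Expr.eval_mul, Expr.eval_sub, Expr.eval_var,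
          Expr.eval_lt, Expr.eval_eq, Expr.eval_const, f11, f7, f0, f1, hs4.var9, hs4.var8, ne_eq,
          ite_eq_right_iff, one_ne_zero, imp_false, not_not]
        refine ⟨fun h => ?_, fun h => ?_⟩
        · have he : (extraSource a v).index = rot k a.1 0 * n + j := by
            rw [extraSource, if_pos (Fin.ext h)]
            rfl
          rw [he] at hxlt ⊢
          refine ⟨fun h' => ?_, fun h' => ?_⟩
          · have hr : rot k a.1 0 = a.1 + 1 := if_pos h'
            rw [hr] at hxlt ⊢
            exact ⟨by omega, rfl⟩
          · have hr : rot k a.1 0 = a.1 + 1 - k := if_neg h'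
            rw [hr] at hxlt ⊢
            exact ⟨by omega, rfl⟩
        · have he : extraSource a v = a := if_neg fun h' => h (congrArg Fin.val h')
          rw [he] at hxlt ⊢
          exact ⟨by omega, rfl⟩
      · simp only [Cmd.wp, Expr.eval_add, Expr.eval_mul, Expr.eval_var, Expr.eval_const, e5,
          Store.setVar_var, Store.setArr_var, Nat.reduceEqDiff, reduceIte, f3, f4, f12]
        refine ⟨⟨by omega, by omega⟩, ⟨by omega, by omega⟩, ⟨by omega, by omega⟩, by omega,
          L ++ [(extraSource a v, v)], by simpa using hL,
          hs.plan.extraList_append hk hEx hneed hplace,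
          hList.append (by simp) (fun i => by simp [fa]) (fun i => by simp [fa]), ?_⟩
        rw [show inter (graphOf (tildeMate m link)) ∪ {f | f ∈ L ++ [(extraSource a v, v)]} =
          inter (graphOf (tildeMate m link)) ∪ {f | f ∈ L} ∪ {(extraSource a v, v)} by
            ext f
            simp only [Set.mem_union, Set.mem_ofPred_eq, List.mem_append, List.mem_singleton,
              Set.mem_singleton_iff, or_assoc]]
        exact hEdges.insert fun i => by simp [fa]
    · refine Runs.of_wp ⟨L, by omega, hEx.skip fun u hu hn => ?_, ⟨?_, ?_⟩, ?_⟩ (by decide)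
      · rw [place_inj (hu.trans hplace.symm)] at hn
        exact hcond.2 hn heq
      · rw [f3]
      · rw [fa]; exact hList.arr
      · intro x y
        rw [fa]; exact hEdges x y
  · simp only [Expr.time]
    have : k * (n * (150 + 1 + 7) + 1 + 5 + 1 + 7) + 1 + 5 = 158 * (k * n) + 14 * k + 6 := by ring
    omega
  · obtain ⟨L, -, h1, h2, h3⟩ := h
    exact ⟨by rw [hF.var 2 (by decide), e22], L, h1, h2, h3⟩

end CompositeSystem

/-! ## The whole program -/

namespace CompositeSystem

open WordRAM

variable {k n W : ℕ} {I : CompositeSystem k n} {s : Store}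

theorem HoldsGraphs.frame {c : Cmd} {s s' : Store} (h : I.HoldsGraphs s) (hF : Frame c s s')
    (ha : ∀ a ∈ [2, 3], a ∉ c.arrs) : I.HoldsGraphs s' := by
  rw [HoldsGraphs, hF.arr 2 (ha 2 (by decide)), hF.arr 3 (ha 3 (by decide))]
  exact h

theorem HoldsComps.frame {c : Cmd} {s s' : Store} (h : I.HoldsComps s) (hF : Frame c s s')
    (ha : ∀ a ∈ [10, 11], a ∉ c.arrs) : I.HoldsComps s' := by
  rw [HoldsComps, hF.arr 10 (ha 10 (by decide)), hF.arr 11 (ha 11 (by decide))]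
  exact h

/-- The construction of the bipartite graphs. -/
def buildGraphs : Cmd := prepare ⨾ closure ⨾ components ⨾ graphs

/-- The computation of `M*`. -/
def findStar : Cmd := successors ⨾ collect ⨾ linkUp ⨾ writeStar

/-- The construction of the bipartite graphs and of `M*`. -/
def firstPhase : Cmd := buildGraphs ⨾ Kuhn.program ⨾ findStar

/-- The remaining steps of the algorithm. -/
def secondPhase : Cmd := writeTilde ⨾ extras

theorem buildGraphs_runs (hb : Bounds W k n) (hs : I.IsInput s) :
    Runs W buildGraphs s (1700 * (k * n) ^ 3)
      fun s' => I.Ready s' ∧ I.HoldsComps s' ∧ I.HoldsGraphs s' := by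
  have h1 := hb.one_le
  have hsq : k * n ≤ (k * n) ^ 2 := Nat.le_self_pow (by decide) _
  have hcb : (k * n) ^ 2 ≤ (k * n) ^ 3 := Nat.pow_le_pow_right h1 (by decide)
  refine Runs.seq (prepare_runs hb hs) (fun s1 _ h1 => ?_) (T' := 1500 * (k * n) ^ 3) (by omega)
  refine Runs.seq (closure_runs hb h1) (fun s2 hF2 h2 => ?_) (T' := 1200 * (k * n) ^ 3) (by omega)
  have h1 := h1.frame hF2 (by decide) (by decide)
  refine Runs.seq (components_runs hb h1 h2) (fun s3 hF3 h3 => ?_) (T' := 1000 * (k * n) ^ 3)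
    (by omega)
  have h1 := h1.frame hF3 (by decide) (by decide)
  refine (graphs_runs hb h1 h3).mono (by omega) fun s4 hF4 h4 => ?_
  exact ⟨h1.frame hF4 (by decide) (by decide), h3.frame hF4 (by decide), h4⟩

theorem findStar_runs {m : StateNode k n → Option (RightNode k n)} {a : StateNode k n}
    (hb : Bounds W k n) (hs : I.Matched m a s) (h15 : ∀ i, s.arr 15 i = 0)
    (h21 : ∀ i, s.arr 21 i = 0) :
    Runs W findStar s (400 * (k * n) ^ 2) fun s' => ∃ link, IsLinking m a link ∧
      I.Matched m a s' ∧ HoldsLink m link s' ∧ s'.var 8 = a.index ∧ s'.var 9 = a.1 ∧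
      ∀ v, s'.arr 4 v.index = (starMate m link v).code := by
  have h1 := hb.one_le
  have hsq : k * n ≤ (k * n) ^ 2 := Nat.le_self_pow (by decide) _
  refine Runs.seq (successors_runs hb hs fun _ => h15 _) (fun s1 hF1 h1 => ?_)
    (T' := 300 * (k * n) ^ 2) (by omega)
  have hs1 := hs.frame hF1 (by decide) (by decide)
  refine Runs.seq (collect_runs hb hs1 h1 fun i => by rw [hF1.arr 21 (by decide), h21])
    (fun s2 hF2 h2 => ?_) (T' := 200 * (k * n) ^ 2) (by omega)
  have hs2 := hs1.frame hF2 (by decide) (by decide)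
  have h1 : HoldsNext m a s2 := by
    refine ⟨?_, ?_, (hF2.var 8 (by decide)).trans h1.var8, (hF2.var 9 (by decide)).trans h1.var9⟩
    · rw [hF2.arr 15 (by decide)]; exact h1.some
    · rw [hF2.arr 15 (by decide)]; exact h1.none
  refine Runs.seq (linkUp_runs hb hs2 h1 h2) (fun s3 hF3 h3 => ?_)
    (T' := 100 * (k * n) ^ 2) (by omega)
  have hs3 := hs2.frame hF3 (by decide) (by decide)
  obtain ⟨link, hl, h3⟩ := h3
  refine (writeStar_runs hb hs3 h3).mono (by omega) fun s4 hF4 h4 => ?_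
  refine ⟨link, hl, hs3.frame hF4 (by decide) (by decide), fun v hv => ?_, ?_, ?_, h4⟩
  · rw [hF4.arr 17 (by decide)]; exact h3 v hv
  · rw [hF4.var 8 (by decide), hF3.var 8 (by decide), h1.var8]
  · rw [hF4.var 9 (by decide), hF3.var 9 (by decide), h1.var9]

theorem firstPhase_runs (hb : Bounds W k n) (hI : IsStructurallyControllable I.fullMatrix I.B)
    (hs : I.IsInput s) : Runs W firstPhase s (4100 * (k * n) ^ 3) fun s' => I.HoldsGraphs s' ∧
      ∃ m a link, I.Linked m a link s' ∧
        (∀ v, s'.arr 4 v.index = (starMate m link v).code) ∧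
        (∀ i, s'.arr 8 i = 0) ∧ ∀ i, s'.arr 18 i = 0 := by
  have h1 := hb.one_le
  have hlin := hb.lin
  have hsq : k * n ≤ (k * n) ^ 2 := Nat.le_self_pow (by decide) _
  have hcb : (k * n) ^ 2 ≤ (k * n) ^ 3 := Nat.pow_le_pow_right h1 (by decide)
  have hzero : ∀ a, 2 ≤ a → ∀ i, s.arr a i = 0 := hs.2.2.2.2.2.2.2
  refine Runs.seq (buildGraphs_runs hb hs) (fun s1 hF1 ⟨h1, hc1, hg1⟩ => ?_)
    (T' := 2400 * (k * n) ^ 3) (by omega)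
  refine Runs.seq (Kuhn.program_runs (N := k * n) (by omega) hb.one_le h1.var4 h1.var5
    (fun v _ => by rw [hF1.arr 12 (by decide), hzero 12 (by decide)]) rfl)
    (fun s2 hF2 h2 => ?_) (T' := 400 * (k * n) ^ 3) (by omega)
  have hr2 := h1.frame hF2 (by decide) (by decide)
  have hc2 := hc1.frame hF2 (by decide)
  have hg2 := hg1.frame hF2 (by decide)
  rw [← hF2.arr 3 (by decide)] at h2
  -- Some input edge exists because every state, and there is at least one, is reachable from the
  -- input.
  have hB : ∃ v, I.B v = true := by
    obtain ⟨v, -⟩ := exists_index hb.one_le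
    obtain ⟨w, hw, -⟩ := hI.reachable v
    exact ⟨w, hw⟩
  obtain ⟨m, hm, hme⟩ := exists_greedy hg2 h2 hB
  obtain ⟨a, ha⟩ := hm.input
  refine (findStar_runs hb ⟨hr2, hm, hme, ha⟩
    (fun i => by rw [hF2.arr 15 (by decide), hF1.arr 15 (by decide), hzero 15 (by decide)])
    (fun i => by rw [hF2.arr 21 (by decide), hF1.arr 21 (by decide), hzero 21 (by decide)])).mono
    (by omega) fun s3 hF3 ⟨link, hl, hs3, hl3, h8, h9, h4⟩ => ?_
  refine ⟨hg2.frame hF3 (by decide), m, a, link, ⟨hs3, ⟨hm, ha, hl, fun v hv hk => ?_⟩,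
    hc2.frame hF3 (by decide), hl3, h8, h9⟩, h4, fun i => ?_, fun i => ?_⟩
  · exact hm.not_isStart hk hI v hv
  · rw [hF3.arr 8 (by decide), hF2.arr 8 (by decide), hF1.arr 8 (by decide), hzero 8 (by decide)]
  · rw [hF3.arr 18 (by decide), hF2.arr 18 (by decide), hF1.arr 18 (by decide),
      hzero 18 (by decide)]

theorem secondPhase_runs {m : StateNode k n → Option (RightNode k n)} {a : StateNode k n}
    {link : StateNode k n → StateNode k n} (hb : Bounds W k n)
    (hI : IsStructurallyControllable I.fullMatrix I.B) (hs : I.Linked m a link s)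
    (h8 : ∀ i, s.arr 8 i = 0) (h18 : ∀ i, s.arr 18 i = 0) :
    Runs W secondPhase s (400 * (k * n)) fun s' => s'.var 2 = 0 ∧
      (∀ v, s'.arr 5 v.index = (tildeMate m link v).code) ∧ ∃ L,
      I.ExtraList m a (inter (graphOf (tildeMate m link))) (k * n) L ∧ HoldsList L s' ∧
      HoldsEdges (inter (graphOf (tildeMate m link)) ∪ {f | f ∈ L}) s' := by
  refine Runs.seq (writeTilde_runs hb hs h8 h18) (fun s1 hF1 ⟨h5, h8, h18⟩ => ?_)
    (T' := 300 * (k * n)) (by omega)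
  refine (extras_runs hb (hs.frame hF1 (by decide) (by decide)) (fun hne hk => ?_) h8 h18).mono
    le_rfl fun s2 hF2 ⟨h2, h⟩ => ⟨h2, fun v => ?_, h⟩
  · exact hne.ne_empty (comps_eq_empty I hk hI)
  · rw [hF2.arr 5 (by decide), h5]

/-- `16 = 2 + 4 + 10` suffices, as each term of the required bound is at most its coefficient times
`(k * n) ^ 2`. -/
theorem bounds_of_le {k n C : ℕ} (hk : 0 < k) (hn : 0 < n) (hC : 16 ≤ C) :
    Bounds (C * (k * n) ^ C) k n := by
  refine ⟨hk, hn, ?_⟩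
  have h1 : 1 ≤ k * n := Nat.mul_pos hk hn
  have hsq : k * n ≤ (k * n) ^ 2 := Nat.le_self_pow (by decide) _
  have hpow : (k * n) ^ 2 ≤ (k * n) ^ C := Nat.pow_le_pow_right h1 (by omega)
  have := Nat.mul_le_mul hC hpow
  omega

end CompositeSystem

theorem mainTheorem3 :
    (∃ (P₁ P₂ : WordRAM.Cmd) (C : ℕ), ∀ (k n : ℕ), 0 < k → 0 < n →
      ∀ I : CompositeSystem k n, IsStructurallyControllable I.fullMatrix I.B →
      ∀ s₀ : WordRAM.Store, I.IsInput s₀ →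
      ∃ (τ : Trace k n) (s₁ s₂ : WordRAM.Store) (t₁ t₂ : ℕ),
        τ.IsRun I ∧
        WordRAM.Exec (C * (k * n) ^ C) P₁ s₀ t₁ s₁ ∧
        I.HoldsGraphs s₁ ∧ τ.HoldsMatching s₁ ∧
        WordRAM.Exec (C * (k * n) ^ C) P₂ s₁ t₂ s₂ ∧
        τ.HoldsResult s₂ ∧
        t₁ + t₂ ≤ C * (k * n) ^ 3 ∧
        t₂ ≤ C * (k * n) ^ 2) ∧
    (∀ (k n : ℕ) (I : CompositeSystem k n) (τ : Trace k n), τ.IsPartialRun I →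
      τ.passes ≤ k * n ∧ τ.extra.length ≤ k * n) := by
  refine ⟨?_, fun k n I τ h => h.bounds⟩
  -- The two phases need `4100 * (k * n) ^ 3` and `400 * (k * n)` steps. The value is kept opaque so
  -- that the power with exponent `C` is not unfolded.
  obtain ⟨C, hC⟩ : ∃ C, C = 4500 := ⟨_, rfl⟩
  refine ⟨CompositeSystem.firstPhase, CompositeSystem.secondPhase, C,
    fun k n hk hn I hI s₀ hs₀ => ?_⟩
  have hb := CompositeSystem.bounds_of_le (C := C) hk hn (by omega)
  obtain ⟨t₁, s₁, he₁, ht₁, hg, m, a, link, hs₁, h4, h8, h18⟩ :=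
    CompositeSystem.firstPhase_runs hb hI hs₀
  obtain ⟨t₂, s₂, he₂, ht₂, h2, h5, L, hL, hlist, hedges⟩ :=
    CompositeSystem.secondPhase_runs hb hI hs₁ h8 h18
  have h1 := hb.one_le
  have hsq : k * n ≤ (k * n) ^ 2 := Nat.le_self_pow (by decide) _
  have hcb : (k * n) ^ 2 ≤ (k * n) ^ 3 := Nat.pow_le_pow_right h1 (by decide)
  refine ⟨_, s₁, s₂, t₁, t₂, hs₁.plan.isRun hL, he₁, hg, fun e he => ?_, he₂,
    ⟨h2, fun j hj e he => ?_, hlist.var3, hlist.arr, fun v w => ?_⟩, ?_, ?_⟩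
  · rw [h4, CompositeSystem.mem_graphOf.1 he]
  · obtain rfl : j = 0 := Nat.le_zero.1 hj
    rw [Nat.zero_mul, Nat.zero_add, h5, CompositeSystem.mem_graphOf.1 he]
  · rw [hedges v w]
    exact CompositeSystem.ite_eq_of_iff (by
      simp [Trace.output, Trace.edgesAfter, Trace.final])
  · subst hC
    omega
  · subst hC
    omega
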